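/- Let $N\ge 0$ be an integer and let $x_1(0)<\dots<x_N(0)$, $m_j(0)>0$, $n_j(0)>0$ ($1\le j\le N$) be given. Consider the peakon equations $$\dot x_j=u(x_j)v(x_j),\qquad \dot m_j=-m_j\langle u_x\rangle(x_j)\,v(x_j),\qquad \dot n_j=-n_j\langle v_x\rangle(x_j)\,u(x_j),$$ where $u(x)=\sum_k m_k e^{-|x-x_k|}$, $v(x)=\sum_k n_k e^{-|x-x_k|}$, and $\langle f\rangle(a)$ is the arithmetic mean of the left and right limits of $f$ at $a$. They have a solution on $[0,\infty)$ with these initial values, and every such solution has the following properties. The limits $m_j(\infty)=\lim_{t\to\infty}m_j(t)$ and $n_j(\infty)=\lim_{t\to\infty}n_j(t)$ exist and are finite and positive. Put $\mathbf m_j=[m_j,n_j]^T$, $\mathbf m_j^*=[n_j,m_j]$, $\langle \mathbf u,\mathbf w\rangle=u_1w_2+u_2w_1$, and $$\lambda_j=\frac1{2m_j(\infty)n_j(\infty)}=\frac{1}{\langle\mathbf m_j(\infty),\mathbf m_j(\infty)\rangle}.$$ 1. For every $t\ge0$, let $P\in M_{2N,N}$ and $P^*\in M_{N,2N}$ be the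 block diagonal matrices with blocks $\mathbf m_1(t),\dots,\mathbf m_N(t)$ and $\mathbf m_1^*(t),\dots,\mathbf m_N^*(t)$, let $E_{ij}=e^{-|x_i(t)-x_j(t)|}$, let $T\in M_{N,N}$ be lower triangular with $1$ on and $2$ below the diagonal, and let $\mathbf 1$ be the $2\times2$ identity matrix. The set of $\lambda\in\mathbb C$ for which $\Psi=\lambda\,(T\otimes\mathbf 1)PEP^*\,\Psi$ has a solution $0\ne\Psi\in\mathbb C^{2N}$ is $\{\lambda_1,\dots,\lambda_N\}$. Every nonzero eigenvalue of $(T\otimes\mathbf 1)PEP^*$ is simple (a simple root of the characteristic polynomial). 2. $\lambda_1>\lambda_2>\dots>\lambda_N>0$. 3. For each $j$, $\dot x_j(t)\to\frac1{2\lambda_j}$ and $x_j(t)=\frac{t}{2\lambda_j}+O(1)$ as $t\to\infty$. 4. For every $t\ge 0$, let $\mathbf m=2\sum_j\mathbf m_j(t)\,\delta_{x_j(t)}$ and $\mathbf m^*=2\sum_j\mathbf m_j^*(t)\,\delta_{x_j(t)}$. Call $z\in\mathbb C$ an eigenvalue of the boundary value problem $$\partial_x\phi_1=z\,\mathbf m^*\langle\boldsymbol\phi_2\rangle+\phi_3,\quad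 \partial_x\boldsymbol\phi_2=z\,\mathbf m\,\phi_3,\quad \partial_x\phi_3=\phi_1,\qquad \phi_3(-\infty)=0,\ \boldsymbol\phi_2(-\infty)=0,\ \phi_3(+\infty)=0$$ if it has, in the sense of distributions, a solution $(\phi_1,\boldsymbol\phi_2,\phi_3)$ that is not almost everywhere zero, with $\phi_1:\mathbb R\to\mathbb C$ locally integrable, $\boldsymbol\phi_2:\mathbb R\to\mathbb C^2$ of locally bounded variation and $\phi_3:\mathbb R\to\mathbb C$ continuous. The set of eigenvalues is $\{\pm i\sqrt{\lambda_j}:1\le j\le N\}$. -/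

import Mathlib

open Filter Topology Asymptotics MeasureTheory Set
open scoped ContDiff Kronecker

noncomputable section

namespace Peakon

/-- Arithmetic mean of the left-hand and right-hand limits of `f` at `a`. -/
def avg {F : Type*} [TopologicalSpace F] [AddCommGroup F] [Module ℝ F] (f : ℝ → F) (a : ℝ) : F :=
  (1 / 2 : ℝ) • (Function.leftLim f a + Function.rightLim f a)

/-- The peakon potential `y ↦ ∑ₖ wₖ exp (-|y - xₖ|)` with positions `x` and momenta `w`. -/
def potential {N : ℕ} (x w : Fin N → ℝ) (y : ℝ) : ℝ :=
  ∑ k, w k * Real.exp (-|y - x k|)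

/-- The peakon equations of the two-component Novikov system on `[0, ∞)`:
`ẋⱼ = u(xⱼ) v(xⱼ)`, `ṁⱼ = -mⱼ ⟨uₓ⟩(xⱼ) v(xⱼ)`, `ṅⱼ = -nⱼ ⟨vₓ⟩(xⱼ) u(xⱼ)`, where
`u = ∑ mₖ exp (-|· - xₖ|)` and `v = ∑ nₖ exp (-|· - xₖ|)`
(one-sided derivatives in time at `t = 0`). -/
structure IsPeakonFlow {N : ℕ} (x m n : ℝ → Fin N → ℝ) : Prop where
  pos : ∀ t, 0 ≤ t → ∀ j, HasDerivWithinAt (fun s => x s j)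
    (potential (x t) (m t) (x t j) * potential (x t) (n t) (x t j)) (Ici 0) t
  mom_m : ∀ t, 0 ≤ t → ∀ j, HasDerivWithinAt (fun s => m s j)
    (-(m t j) * avg (deriv (potential (x t) (m t))) (x t j) * potential (x t) (n t) (x t j))
    (Ici 0) t
  mom_n : ∀ t, 0 ≤ t → ∀ j, HasDerivWithinAt (fun s => n s j)
    (-(n t j) * avg (deriv (potential (x t) (n t))) (x t j) * potential (x t) (m t) (x t j))
    (Ici 0) t

/-- The dual (row) vector `w* = [w₂, w₁]` of `w = [w₁, w₂]ᵀ`. -/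
def dual {R : Type*} (w : Fin 2 → R) : Fin 2 → R := ![w 1, w 0]

/-- The symmetric bilinear form `⟨u, w⟩ = u* w = u₁ w₂ + u₂ w₁`. -/
def pairing {R : Type*} [CommRing R] (u w : Fin 2 → R) : R := dual u ⬝ᵥ w

/-- The vector masses `𝐦ⱼ = [mⱼ, nⱼ]ᵀ`. -/
def mass {N : ℕ} (m n : Fin N → ℝ) (j : Fin N) : Fin 2 → ℝ := ![m j, n j]

/-- The vector masses, viewed in `ℂ²`. -/
def massC {N : ℕ} (m n : Fin N → ℝ) (j : Fin N) : Fin 2 → ℂ := fun a => (mass m n j a : ℂ)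

/-- The block diagonal matrix with diagonal blocks the columns `𝐦ⱼ`. -/
def matP {N : ℕ} (m n : Fin N → ℝ) : Matrix (Fin N × Fin 2) (Fin N) ℝ :=
  Matrix.of fun ia j => if ia.1 = j then mass m n j ia.2 else 0

/-- The block diagonal matrix with diagonal blocks the rows `𝐦ⱼ*`. -/
def matPstar {N : ℕ} (m n : Fin N → ℝ) : Matrix (Fin N) (Fin N × Fin 2) ℝ :=
  Matrix.of fun i jb => if i = jb.1 then dual (mass m n i) jb.2 else 0

/-- The matrix with entries `exp (-|xᵢ - xⱼ|)`. -/
def matE {N : ℕ} (x : Fin N → ℝ) : Matrix (Fin N) (Fin N) ℝ :=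
  Matrix.of fun i j => Real.exp (-|x i - x j|)

/-- The lower triangular matrix with `1` on the diagonal and `2` below it. -/
def matT (N : ℕ) : Matrix (Fin N) (Fin N) ℝ :=
  Matrix.of fun i j => if i = j then 1 else if j < i then 2 else 0

/-- The matrix `(T ⊗ 1) P E P*`, of size `2N × 2N`. -/
def specMatrix {N : ℕ} (x m n : Fin N → ℝ) : Matrix (Fin N × Fin 2) (Fin N × Fin 2) ℝ :=
  (matT N ⊗ₖ (1 : Matrix (Fin 2) (Fin 2) ℝ)) * matP m n * matE x * matPstar m n

/-- The matrix `(T ⊗ 1) P E P*`, viewed as a complex matrix. -/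
def specMatrixC {N : ℕ} (x m n : Fin N → ℝ) : Matrix (Fin N × Fin 2) (Fin N × Fin 2) ℂ :=
  (specMatrix x m n).map Complex.ofReal

/-- `f' = h + ∑ₖ cₖ δ_{xₖ}` in the sense of distributions on `ℝ`,
for locally integrable `f` and `h`. -/
structure HasDistribDeriv {N : ℕ} {F : Type*} [NormedAddCommGroup F] [NormedSpace ℝ F]
    (f h : ℝ → F) (x : Fin N → ℝ) (c : Fin N → F) : Prop where
  locallyIntegrable : LocallyIntegrable f volume
  locallyIntegrable_deriv : LocallyIntegrable h volume
  integral_eq : ∀ η : ℝ → ℝ, ContDiff ℝ ∞ η → HasCompactSupport η →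
    -∫ y, deriv η y • f y = (∫ y, η y • h y) + ∑ k, η (x k) • c k

/-- `(φ₁, φ₂, φ₃)` solves, in the sense of distributions, the system
`φ₁' = z 𝐦* φ₂ + φ₃`, `φ₂' = z 𝐦 φ₃`, `φ₃' = φ₁` with `𝐦 = 2 ∑ 𝐦ₖ δ_{xₖ}`,
`𝐦* = 2 ∑ 𝐦ₖ* δ_{xₖ}` and boundary conditions `φ₃(-∞) = 0`, `φ₂(-∞) = 0`, `φ₃(+∞) = 0`.
Here `φ₃` is continuous, `φ₂` is of locally bounded variation, and
the product `𝐦* φ₂` is defined as `𝐦* ⟨φ₂⟩`. -/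
structure IsBVPSolution {N : ℕ} (x m n : Fin N → ℝ) (z : ℂ)
    (φ₁ : ℝ → ℂ) (φ₂ : ℝ → Fin 2 → ℂ) (φ₃ : ℝ → ℂ) : Prop where
  bv : LocallyBoundedVariationOn φ₂ univ
  cont : Continuous φ₃
  eq₁ : HasDistribDeriv φ₁ φ₃ x (fun k => z * (2 * pairing (massC m n k) (avg φ₂ (x k))))
  eq₂ : HasDistribDeriv φ₂ 0 x (fun k => (z * 2 * φ₃ (x k)) • massC m n k)
  eq₃ : HasDistribDeriv φ₃ φ₁ x 0
  left₃ : Tendsto φ₃ atBot (𝓝 0)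
  left₂ : Tendsto φ₂ atBot (𝓝 0)
  right₃ : Tendsto φ₃ atTop (𝓝 0)

/-- `z` is an eigenvalue of the boundary value problem: there is a solution that does not vanish
(functions that vanish almost everywhere count as zero). -/
def IsBVPEigenvalue {N : ℕ} (x m n : Fin N → ℝ) (z : ℂ) : Prop :=
  ∃ φ₁ φ₂ φ₃, IsBVPSolution x m n z φ₁ φ₂ φ₃ ∧
    ¬ (φ₁ =ᵐ[volume] 0 ∧ φ₂ =ᵐ[volume] 0 ∧ φ₃ =ᵐ[volume] 0)

end Peakon

end

open Filter Topology Asymptotics MeasureTheory Set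
open scoped ContDiff Kronecker

noncomputable section

namespace Peakon

/-! ### Scalar differential inequalities on the half line -/

/-! The flow is isospectral. Between two peaks a solution of the spectral problem has `φ₃ = p eˣ + q
e⁻ˣ` and constant `φ₂`, and crossing a peak changes these coefficients by an explicit jump. Along
the flow the coefficients satisfy a linear time evolution in every gap
(`IsScaledFlow.transfer_evolution`, the Lax pair in concrete form). To the right of all peaks this
evolution leaves the growing coefficient `p` constant. With `l = 1/κ`, the equation `p = 0` singles
out the nonzero eigenvalues `κ` of the `N × N` matrix `EG`, where `G = P*(T ⊗ 1)P`
(`isRoot_redMatrixC_iff`). A connectedness argument then shows that the whole characteristic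
polynomial of `EG` is conserved. That of `(T ⊗ 1)PEP*` is `X ^ N` times it.

The trace gives conservation of the energy `H = ∑ mⱼ nₖ Eⱼₖ`, which bounds every `mⱼ nⱼ` and every
velocity from above. The determinant bounds every `mⱼ nⱼ` below by some `c > 0`. A peak's product
`mⱼ nⱼ` is driven up by its left neighbours and down by its right ones, so a sum of the `mⱼ nⱼ` with
rapidly growing weights is a bounded Lyapunov function whose derivative dominates all interactions
(`exists_weight`). Hence the interactions are integrable in time, `log mⱼ` and `log nⱼ` converge,
and all gaps tend to infinity (`IsScaledFlow.exists_isScattering`).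

The velocities tend to `mⱼ(∞) nⱼ(∞)`, which is nondecreasing in `j` because the order is preserved.
Equality is excluded by looking at a group of peaks with a common limiting speed: its front peak is
eventually no faster, and its rear peak no slower, than that speed, so the group cannot spread
(`IsScattering.strictMono_mul`). With strictly ordered speeds the interactions are controlled by
exponentials of gaps that open at a positive rate, and the positions are asymptotically linear up to
a convergent error.

As the gaps open, `E → 1` and `EG` becomes lower triangular with diagonal `2 mⱼ(∞) nⱼ(∞)`. By
isospectrality these are the eigenvalues at every time, and they are distinct. The boundary value
problem is solved by superposing the functions `exp (-|y - xₖ|)`; evaluating at the peaks turns it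
into `φ = -z² EG φ` (`isBVPEigenvalue_iff`).

Global existence uses the same conservation law, which holds for any time-dependent speed factor:
the field, in logarithmic momenta, is cut off where it is large, and energy conservation shows that
the cutoff is never felt. -/

theorem monotoneOn_Ici_of_hasDerivWithinAt {f f' : ℝ → ℝ} {a : ℝ}
    (hf : ∀ t, a ≤ t → HasDerivWithinAt f (f' t) (Ici a) t) (hf' : ∀ t, a ≤ t → 0 ≤ f' t) :
    MonotoneOn f (Ici a) :=
  monotoneOn_of_hasDerivWithinAt_nonneg (convex_Ici a)
    (fun t ht => (hf t ht).continuousWithinAt)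
    (fun t ht => (hf t (interior_subset ht)).mono interior_subset)
    (fun t ht => hf' t (interior_subset ht))

/-- A function whose logarithmic derivative is locally bounded stays positive. -/
theorem pos_of_abs_deriv_le {f f' : ℝ → ℝ}
    (hf : ∀ t, 0 ≤ t → HasDerivWithinAt f (f' t) (Ici 0) t) (h0 : 0 < f 0)
    (hK : ∀ T, 0 ≤ T → ∃ K, ∀ t, 0 ≤ t → t ≤ T → |f' t| ≤ K * |f t|) :
    ∀ t, 0 ≤ t → 0 < f t := by
  have hne : ∀ t, 0 ≤ t → f t ≠ 0 := by
    intro T hT hz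
    obtain ⟨K, hK⟩ := hK T hT
    -- The bound on `f'` makes `f² exp (2Kt)` nondecreasing on `[0, T]`, so `f` cannot reach zero
    -- there.
    have hd : ∀ t, 0 ≤ t → HasDerivWithinAt (fun t => f t ^ 2 * Real.exp (2 * K * t))
        ((2 * f t * f' t + 2 * K * f t ^ 2) * Real.exp (2 * K * t)) (Ici 0) t := by
      intro t ht
      have h1 := ((hf t ht).pow 2).mul
        (((hasDerivAt_id t).const_mul (2 * K)).exp.hasDerivWithinAt (s := Ici 0))
      refine h1.congr_deriv ?_
      simp
      ring
    have hmono : MonotoneOn (fun t => f t ^ 2 * Real.exp (2 * K * t)) (Icc 0 T) := by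
      refine monotoneOn_of_hasDerivWithinAt_nonneg (convex_Icc 0 T)
        (fun t ht => ((hd t ht.1).mono Icc_subset_Ici_self).continuousWithinAt)
        (fun t ht => (hd t (interior_subset ht).1).mono
          (interior_subset.trans Icc_subset_Ici_self)) (fun t ht => ?_)
      have ht := interior_subset ht
      have h2 := hK t ht.1 ht.2
      refine mul_nonneg ?_ (Real.exp_pos _).le
      have h3 : |f t * f' t| ≤ K * f t ^ 2 := by
        rw [abs_mul, ← sq_abs (f t)]
        nlinarith [abs_nonneg (f t)]
      linarith [(abs_le.mp h3).1]
    have := hmono (left_mem_Icc.mpr hT) (right_mem_Icc.mpr hT) hT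
    simp [hz] at this
    nlinarith [sq_nonneg (f 0), pow_pos h0 2]
  intro t ht
  by_contra hneg
  have hc : ContinuousOn f (Icc 0 t) := fun s hs =>
    ((hf s hs.1).mono Icc_subset_Ici_self).continuousWithinAt
  obtain ⟨s, hs, hs0⟩ := intermediate_value_Icc' ht hc ⟨not_lt.mp hneg, h0.le⟩
  exact hne s hs.1 hs0

/-! ### The mean of the one-sided derivatives of the potential -/

theorem hasDerivAt_exp_neg_abs_sub {y c : ℝ} (h : y ≠ c) :
    HasDerivAt (fun y => Real.exp (-|y - c|))
      (-(SignType.sign (y - c) : ℝ) * Real.exp (-|y - c|)) y := by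
  have h1 := (((hasDerivAt_abs (sub_ne_zero.mpr h)).comp y
    ((hasDerivAt_id y).sub_const c)).neg).exp
  refine h1.congr_deriv ?_
  simp [mul_comm]

theorem deriv_potential {N : ℕ} (x w : Fin N → ℝ) {y : ℝ} (h : ∀ k, y ≠ x k) :
    deriv (potential x w) y =
      ∑ k, w k * (-(SignType.sign (y - x k) : ℝ) * Real.exp (-|y - x k|)) := by
  have := HasDerivAt.fun_sum (u := Finset.univ)
    (fun k _ => (hasDerivAt_exp_neg_abs_sub (h k)).const_mul (w k))
  exact this.deriv

theorem eventually_left_sign (a c : ℝ) :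
    ∀ᶠ y in 𝓝[<] a, y ≠ c ∧ (SignType.sign (y - c) : ℝ) = if c < a then 1 else -1 := by
  split_ifs with h
  · filter_upwards [nhdsWithin_le_nhds (lt_mem_nhds h)] with y hy
    exact ⟨hy.ne', by simp [sign_pos (sub_pos.mpr hy)]⟩
  · filter_upwards [self_mem_nhdsWithin] with y hy
    have hy : y < c := lt_of_lt_of_le hy (not_lt.mp h)
    exact ⟨hy.ne, by simp [sign_neg (sub_neg.mpr hy)]⟩

theorem eventually_right_sign (a c : ℝ) :
    ∀ᶠ y in 𝓝[>] a, y ≠ c ∧ (SignType.sign (y - c) : ℝ) = if a < c then -1 else 1 := by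
  split_ifs with h
  · filter_upwards [nhdsWithin_le_nhds (gt_mem_nhds h)] with y hy
    exact ⟨hy.ne, by simp [sign_neg (sub_neg.mpr hy)]⟩
  · filter_upwards [self_mem_nhdsWithin] with y hy
    have hy : c < y := lt_of_le_of_lt (not_lt.mp h) hy
    exact ⟨hy.ne', by simp [sign_pos (sub_pos.mpr hy)]⟩

theorem tendsto_deriv_potential {N : ℕ} (x w : Fin N → ℝ) (a : ℝ) (l : Filter ℝ) (hl : l ≤ 𝓝 a)
    (σ : Fin N → ℝ) (h : ∀ k, ∀ᶠ y in l, y ≠ x k ∧ (SignType.sign (y - x k) : ℝ) = σ k) :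
    Tendsto (deriv (potential x w)) l
      (𝓝 (∑ k, w k * (-σ k * Real.exp (-|a - x k|)))) := by
  have h1 : Tendsto (fun y => ∑ k, w k * (-σ k * Real.exp (-|y - x k|))) l
      (𝓝 (∑ k, w k * (-σ k * Real.exp (-|a - x k|)))) := by
    have : Continuous (fun y => ∑ k, w k * (-σ k * Real.exp (-|y - x k|))) := by fun_prop
    exact (this.tendsto a).mono_left hl
  refine h1.congr' ?_
  filter_upwards [eventually_all.mpr h] with y hy
  rw [deriv_potential x w (fun k => (hy k).1)]
  exact Finset.sum_congr rfl fun k _ => by rw [(hy k).2]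

/-- A peak sitting at `a` has opposite one-sided slopes, so it drops out of the mean. This agrees
with `sign 0 = 0`. -/
theorem avg_deriv_potential {N : ℕ} (x w : Fin N → ℝ) (a : ℝ) :
    avg (deriv (potential x w)) a =
      -∑ k, w k * ((SignType.sign (a - x k) : ℝ) * Real.exp (-|a - x k|)) := by
  unfold avg
  rw [leftLim_eq_of_tendsto
      (tendsto_deriv_potential x w a _ nhdsWithin_le_nhds _ fun k => eventually_left_sign a (x k)),
    rightLim_eq_of_tendsto
      (tendsto_deriv_potential x w a _ nhdsWithin_le_nhds _ fun k => eventually_right_sign a (x k)),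
    smul_eq_mul, ← Finset.sum_add_distrib, Finset.mul_sum, ← Finset.sum_neg_distrib]
  refine Finset.sum_congr rfl fun k _ => ?_
  rcases lt_trichotomy (x k) a with h | h | h
  · simp [h, h.not_gt]; ring
  · simp [h]
  · simp [h, h.not_gt]; ring

/-! ### Flows with a time-dependent speed -/

/-- The index-wise sign of `j - k`. -/
def idxSign {N : ℕ} (j k : Fin N) : ℝ := if k < j then 1 else if j < k then -1 else 0

/-- The value `w(xⱼ)` of the potential at a peak. -/
def peakVal {N : ℕ} (x w : Fin N → ℝ) (j : Fin N) : ℝ := ∑ k, w k * Real.exp (-|x j - x k|)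

/-- Minus the mean slope of the potential at a peak. -/
def peakSlope {N : ℕ} (x w : Fin N → ℝ) (j : Fin N) : ℝ :=
  ∑ k, w k * (idxSign j k * Real.exp (-|x j - x k|))

/-- Ordered peakons with positive momenta, moving along the peakon equations with
the time-dependent speed `s`. -/
structure IsScaledFlow {N : ℕ} (s : ℝ → ℝ) (x m n : ℝ → Fin N → ℝ) : Prop where
  strictMono : ∀ t, 0 ≤ t → StrictMono (x t)
  m_pos : ∀ t, 0 ≤ t → ∀ j, 0 < m t j
  n_pos : ∀ t, 0 ≤ t → ∀ j, 0 < n t j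
  deriv_x : ∀ t, 0 ≤ t → ∀ j, HasDerivWithinAt (fun τ => x τ j)
    (s t * (peakVal (x t) (m t) j * peakVal (x t) (n t) j)) (Ici 0) t
  deriv_m : ∀ t, 0 ≤ t → ∀ j, HasDerivWithinAt (fun τ => m τ j)
    (s t * (m t j * peakSlope (x t) (m t) j * peakVal (x t) (n t) j)) (Ici 0) t
  deriv_n : ∀ t, 0 ≤ t → ∀ j, HasDerivWithinAt (fun τ => n τ j)
    (s t * (n t j * peakSlope (x t) (n t) j * peakVal (x t) (m t) j)) (Ici 0) t

theorem sign_sub_eq_idxSign {N : ℕ} {x : Fin N → ℝ} (hx : StrictMono x) (j k : Fin N) :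
    (SignType.sign (x j - x k) : ℝ) = idxSign j k := by
  unfold idxSign
  rcases lt_trichotomy k j with h | h | h
  · simp [h, sign_pos (sub_pos.mpr (hx h))]
  · simp [h]
  · simp [h, h.not_gt, sign_neg (sub_neg.mpr (hx h))]

theorem avg_deriv_potential_eq_neg_peakSlope {N : ℕ} {x : Fin N → ℝ} (hx : StrictMono x)
    (w : Fin N → ℝ) (j : Fin N) :
    avg (deriv (potential x w)) (x j) = -peakSlope x w j := by
  rw [avg_deriv_potential, peakSlope]
  simp_rw [sign_sub_eq_idxSign hx]

theorem abs_sign_le (a : ℝ) : |(SignType.sign a : ℝ)| ≤ 1 := by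
  rcases lt_trichotomy a 0 with h | h | h
  · simp [h]
  · simp [h]
  · simp [h]

theorem abs_exp_neg_abs_sub_le (a b c : ℝ) :
    |Real.exp (-|a - c|) - Real.exp (-|b - c|)| ≤ |a - b| := by
  wlog h : |a - c| ≤ |b - c| generalizing a b
  · rw [abs_sub_comm, abs_sub_comm a b]
    exact this b a (le_of_not_ge h)
  rw [abs_of_nonneg (sub_nonneg.mpr (Real.exp_le_exp.mpr (neg_le_neg h)))]
  have h1 : |b - c| - |a - c| ≤ |a - b| := by
    rw [abs_sub_comm a b]
    have := abs_sub_abs_le_abs_sub (b - c) (a - c)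
    simpa using this
  have h2 : Real.exp (-|b - c|) = Real.exp (-|a - c|) * Real.exp (|a - c| - |b - c|) := by
    rw [← Real.exp_add]; ring_nf
  have h3 := Real.add_one_le_exp (|a - c| - |b - c|)
  have h4 : Real.exp (-|a - c|) ≤ 1 := Real.exp_le_one_iff.mpr (by simp)
  have h5 := Real.exp_pos (-|a - c|)
  rw [h2]
  nlinarith

theorem abs_potential_le {N : ℕ} (x w : Fin N → ℝ) (y : ℝ) : |potential x w y| ≤ ∑ k, |w k| := by
  refine (Finset.abs_sum_le_sum_abs _ _).trans (Finset.sum_le_sum fun k _ => ?_)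
  rw [abs_mul, abs_of_pos (Real.exp_pos _)]
  exact mul_le_of_le_one_right (abs_nonneg _) (Real.exp_le_one_iff.mpr (by simp))

theorem abs_potential_sub_le {N : ℕ} (x w : Fin N → ℝ) (y z : ℝ) :
    |potential x w y - potential x w z| ≤ (∑ k, |w k|) * |y - z| := by
  unfold potential
  rw [← Finset.sum_sub_distrib, Finset.sum_mul]
  refine (Finset.abs_sum_le_sum_abs _ _).trans (Finset.sum_le_sum fun k _ => ?_)
  rw [← mul_sub, abs_mul]
  exact mul_le_mul_of_nonneg_left (abs_exp_neg_abs_sub_le _ _ _) (abs_nonneg _)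

theorem abs_avg_deriv_potential_le {N : ℕ} (x w : Fin N → ℝ) (a : ℝ) :
    |avg (deriv (potential x w)) a| ≤ ∑ k, |w k| := by
  rw [avg_deriv_potential, abs_neg]
  refine (Finset.abs_sum_le_sum_abs _ _).trans (Finset.sum_le_sum fun k _ => ?_)
  rw [abs_mul, abs_mul, abs_of_pos (Real.exp_pos _)]
  refine mul_le_of_le_one_right (abs_nonneg _) ?_
  exact mul_le_one₀ (abs_sign_le _) (Real.exp_pos _).le (Real.exp_le_one_iff.mpr (by simp))

theorem exists_bound_of_continuousOn_Ici {N : ℕ} {w : ℝ → Fin N → ℝ}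
    (hw : ∀ j, ContinuousOn (fun t => w t j) (Ici 0)) (T : ℝ) :
    ∃ K, 0 ≤ K ∧ ∀ t, 0 ≤ t → t ≤ T → ∑ k, |w t k| ≤ K := by
  have hc : ContinuousOn (fun t => ∑ k, |w t k|) (Icc 0 T) :=
    continuousOn_finsetSum _ fun k _ => ((hw k).mono Icc_subset_Ici_self).abs
  obtain ⟨K, hK⟩ := isCompact_Icc.exists_bound_of_continuousOn hc
  exact ⟨max K 0, le_max_right _ _, fun t h0 hT =>
    ((le_abs_self _).trans (hK t ⟨h0, hT⟩)).trans (le_max_left _ _)⟩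

/-- The velocity `u v` is Lipschitz in space with a constant that is bounded on compact time
intervals, so no gap closes in finite time. The logarithmic rates of the momenta are bounded in the
same way, so they stay positive. These bounds do not presuppose the order of the peaks; only the
final rewriting in terms of `peakSlope` does. -/
theorem IsPeakonFlow.isScaledFlow {N : ℕ} {x m n : ℝ → Fin N → ℝ} (h : IsPeakonFlow x m n)
    (hx : StrictMono (x 0)) (hm : ∀ j, 0 < m 0 j) (hn : ∀ j, 0 < n 0 j) :
    IsScaledFlow (fun _ => 1) x m n := by
  have hcm := fun T => exists_bound_of_continuousOn_Ici
    (fun j => fun t ht => (h.mom_m t ht j).continuousWithinAt) T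
  have hcn := fun T => exists_bound_of_continuousOn_Ici
    (fun j => fun t ht => (h.mom_n t ht j).continuousWithinAt) T
  have hmono : ∀ t, 0 ≤ t → StrictMono (x t) := by
    intro t ht j k hjk
    have := pos_of_abs_deriv_le (f := fun t => x t k - x t j)
      (fun t ht => (h.pos t ht k).sub (h.pos t ht j)) (sub_pos.mpr (hx hjk)) (fun T _ => by
        obtain ⟨A, hA0, hA⟩ := hcm T
        obtain ⟨B, hB0, hB⟩ := hcn T
        refine ⟨A * B + A * B, fun t h0 hT => ?_⟩
        have h1 := abs_potential_sub_le (x t) (m t) (x t k) (x t j)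
        have h2 := abs_potential_sub_le (x t) (n t) (x t k) (x t j)
        have h3 := abs_potential_le (x t) (m t) (x t j)
        have h4 := abs_potential_le (x t) (n t) (x t k)
        have hA := hA t h0 hT
        have hB := hB t h0 hT
        set d := |x t k - x t j|
        have hd : 0 ≤ d := abs_nonneg _
        rw [show ∀ a b c e : ℝ, a * b - c * e = (a - c) * b + c * (b - e) by intros; ring]
        refine (abs_add_le _ _).trans ?_
        rw [abs_mul, abs_mul, add_mul]
        refine add_le_add ?_ ?_
        · calc _ ≤ (A * d) * B := mul_le_mul (h1.trans (by gcongr)) (h4.trans hB)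
                (abs_nonneg _) (by positivity)
            _ = _ := by ring
        · calc _ ≤ A * (B * d) := mul_le_mul (h3.trans hA) (h2.trans (by gcongr))
                (abs_nonneg _) (by positivity)
            _ = _ := by ring) t ht
    linarith
  have key : ∀ a b c A B : ℝ, 0 ≤ A → |b| ≤ A → |c| ≤ B → |-a * b * c| ≤ A * B * |a| := by
    intro a b c A B hA hb hc
    rw [abs_mul, abs_mul, abs_neg]
    nlinarith [mul_le_mul hb hc (abs_nonneg c) hA, abs_nonneg a]
  have hmpos : ∀ t, 0 ≤ t → ∀ j, 0 < m t j := fun t ht j =>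
    pos_of_abs_deriv_le (fun t ht => h.mom_m t ht j) (hm j) (fun T _ => by
      obtain ⟨A, hA0, hA⟩ := hcm T
      obtain ⟨B, hB0, hB⟩ := hcn T
      exact ⟨A * B, fun t h0 hT => key _ _ _ A B hA0
        ((abs_avg_deriv_potential_le _ _ _).trans (hA t h0 hT))
        ((abs_potential_le _ _ _).trans (hB t h0 hT))⟩) t ht
  have hnpos : ∀ t, 0 ≤ t → ∀ j, 0 < n t j := fun t ht j =>
    pos_of_abs_deriv_le (fun t ht => h.mom_n t ht j) (hn j) (fun T _ => by
      obtain ⟨A, hA0, hA⟩ := hcm T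
      obtain ⟨B, hB0, hB⟩ := hcn T
      exact ⟨B * A, fun t h0 hT => key _ _ _ B A hB0
        ((abs_avg_deriv_potential_le _ _ _).trans (hB t h0 hT))
        ((abs_potential_le _ _ _).trans (hA t h0 hT))⟩) t ht
  refine ⟨hmono, hmpos, hnpos, fun t ht j => ?_, fun t ht j => ?_, fun t ht j => ?_⟩
  · simpa [peakVal, potential] using h.pos t ht j
  · refine (h.mom_m t ht j).congr_deriv ?_
    rw [avg_deriv_potential_eq_neg_peakSlope (hmono t ht)]
    simp [peakVal, potential]
  · refine (h.mom_n t ht j).congr_deriv ?_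
    rw [avg_deriv_potential_eq_neg_peakSlope (hmono t ht)]
    simp [peakVal, potential]

theorem IsScaledFlow.isPeakonFlow {N : ℕ} {s : ℝ → ℝ} {x m n : ℝ → Fin N → ℝ}
    (h : IsScaledFlow s x m n) (hs : ∀ t, 0 ≤ t → s t = 1) : IsPeakonFlow x m n := by
  refine ⟨fun t ht j => ?_, fun t ht j => ?_, fun t ht j => ?_⟩
  · simpa [hs t ht, peakVal, potential] using h.deriv_x t ht j
  · refine (h.deriv_m t ht j).congr_deriv ?_
    rw [avg_deriv_potential_eq_neg_peakSlope (h.strictMono t ht)]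
    simp [hs t ht, peakVal, potential]
  · refine (h.deriv_n t ht j).congr_deriv ?_
    rw [avg_deriv_potential_eq_neg_peakSlope (h.strictMono t ht)]
    simp [hs t ht, peakVal, potential]


/-! ### Partial sums along the peaks -/

/-- The sum of the first `k` entries. -/
def psum {N : ℕ} {A : Type*} [AddCommMonoid A] (f : Fin N → A) (k : ℕ) : A :=
  ∑ i, if i.val < k then f i else 0

theorem psum_zero {N : ℕ} {A : Type*} [AddCommMonoid A] (f : Fin N → A) : psum f 0 = 0 := by
  simp [psum]

theorem psum_card {N : ℕ} {A : Type*} [AddCommMonoid A] (f : Fin N → A) :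
    psum f N = ∑ i, f i := by
  simp [psum]

theorem psum_succ {N : ℕ} {A : Type*} [AddCommMonoid A] (f : Fin N → A) (j : Fin N) :
    psum f (j.val + 1) = psum f j.val + f j := by
  unfold psum
  rw [← Finset.add_sum_erase _ _ (Finset.mem_univ j),
    ← Finset.add_sum_erase (a := j) (f := fun i => if i.val < j.val then f i else 0) _
      (Finset.mem_univ j)]
  simp only [Nat.lt_succ_self, if_true, lt_irrefl, if_false, zero_add]
  rw [add_comm]
  congr 1
  refine Finset.sum_congr rfl fun i hi => ?_
  have : i.val ≠ j.val := fun h => Finset.ne_of_mem_erase hi (Fin.ext h)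
  congr 1
  simp only [eq_iff_iff]
  omega

/-- Moments of the part of a potential lying to the left: `∑_{i<k} wᵢ exp xᵢ`. -/
def leftMom {N : ℕ} (x w : Fin N → ℝ) (k : ℕ) : ℝ := psum (fun i => w i * Real.exp (x i)) k

/-- Moments of the part of a potential lying to the right: `∑_{i≥k} wᵢ exp (-xᵢ)`. -/
def rightMom {N : ℕ} (x w : Fin N → ℝ) (k : ℕ) : ℝ :=
  ∑ i, w i * Real.exp (-x i) - psum (fun i => w i * Real.exp (-x i)) k

theorem leftMom_succ {N : ℕ} (x w : Fin N → ℝ) (j : Fin N) :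
    leftMom x w (j + 1) = leftMom x w j + w j * Real.exp (x j) := psum_succ _ _

theorem rightMom_succ {N : ℕ} (x w : Fin N → ℝ) (j : Fin N) :
    rightMom x w j = rightMom x w (j + 1) + w j * Real.exp (-x j) := by
  unfold rightMom; rw [psum_succ]; ring

/-- For ordered points the kernel `exp (-|xⱼ - xᵢ|)` is a product of exponentials on each side of
the diagonal; the term `i = j` is counted on the right. A general module covers both the real
momenta and the complex eigenvectors. -/
theorem sum_exp_neg_abs_smul {N : ℕ} {A : Type*} [AddCommGroup A] [Module ℝ A] {x : Fin N → ℝ}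
    (hx : StrictMono x) (w : Fin N → A) (j : Fin N) :
    ∑ i, Real.exp (-|x j - x i|) • w i =
      Real.exp (-x j) • psum (fun i => Real.exp (x i) • w i) j +
      Real.exp (x j) • (∑ i, Real.exp (-x i) • w i - psum (fun i => Real.exp (-x i) • w i) j) := by
  unfold psum
  rw [← Finset.sum_sub_distrib, Finset.smul_sum, Finset.smul_sum, ← Finset.sum_add_distrib]
  refine Finset.sum_congr rfl fun i _ => ?_
  by_cases h : i.val < j.val
  · have h1 : x i < x j := hx h
    simp only [h, if_true, sub_self, smul_zero, add_zero, smul_smul, ← Real.exp_add]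
    rw [abs_of_pos (sub_pos.mpr h1)]
    ring_nf
  · have h1 : x j ≤ x i := hx.monotone (not_lt.mp h)
    simp only [h, if_false, sub_zero, smul_zero, zero_add, smul_smul, ← Real.exp_add]
    rw [abs_of_nonpos (sub_nonpos.mpr h1)]
    ring_nf

theorem peakVal_eq {N : ℕ} {x : Fin N → ℝ} (hx : StrictMono x) (w : Fin N → ℝ) (j : Fin N) :
    peakVal x w j = leftMom x w j * Real.exp (-x j) + w j +
      rightMom x w (j + 1) * Real.exp (x j) := by
  have h := sum_exp_neg_abs_smul hx w j
  have h2 := rightMom_succ x w j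
  have h3 : Real.exp (-x j) * Real.exp (x j) = 1 := by rw [← Real.exp_add]; simp
  simp only [smul_eq_mul] at h
  unfold peakVal
  simp_rw [mul_comm (w _)]
  rw [h]
  unfold rightMom leftMom at *
  simp_rw [mul_comm (w _)] at *
  linear_combination Real.exp (x j) * h2 + w j * h3

/-- The signs are absorbed into the weights; the peak's own term receives weight zero, so the right
part starts at `j + 1`. -/
theorem peakSlope_eq {N : ℕ} {x : Fin N → ℝ} (hx : StrictMono x) (w : Fin N → ℝ) (j : Fin N) :
    peakSlope x w j = leftMom x w j * Real.exp (-x j) -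
      rightMom x w (j + 1) * Real.exp (x j) := by
  have h := sum_exp_neg_abs_smul hx (fun i => idxSign j i * w i) j
  have e1 : psum (fun i => Real.exp (x i) • (idxSign j i * w i)) j = leftMom x w j := by
    unfold leftMom psum
    refine Finset.sum_congr rfl fun i _ => ?_
    by_cases hi : i.val < j.val
    · have : i < j := hi
      simp [idxSign, this, hi, mul_comm]
    · simp [hi]
  have e2 : ∑ i, Real.exp (-x i) • (idxSign j i * w i) -
      psum (fun i => Real.exp (-x i) • (idxSign j i * w i)) j = -rightMom x w (j + 1) := by
    unfold rightMom psum
    rw [← Finset.sum_sub_distrib, ← Finset.sum_sub_distrib, ← Finset.sum_neg_distrib]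
    refine Finset.sum_congr rfl fun i _ => ?_
    rcases lt_trichotomy i j with hi | hi | hi
    · have h1 : i.val < j.val := hi
      have h2 : i.val < j.val + 1 := by omega
      simp [h1, h2]
    · simp [hi, idxSign]
    · have h1 : ¬ i.val < j.val := by have : j.val < i.val := hi; omega
      have h2 : ¬ i.val < j.val + 1 := by have : j.val < i.val := hi; omega
      simp [h1, h2, idxSign, hi, hi.not_gt, mul_comm]
  rw [e1, e2] at h
  simp only [smul_eq_mul] at h
  rw [peakSlope]
  rw [Finset.sum_congr rfl fun i _ => show
    w i * (idxSign j i * Real.exp (-|x j - x i|)) =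
      Real.exp (-|x j - x i|) * (idxSign j i * w i) by ring, h]
  ring

/-! ### The transfer recursion of the spectral problem -/

/-- Coefficients of a solution between two peaks: `φ₃ = p eˣ + q e⁻ˣ`, `φ₂ = z (r₁, r₂)`. -/
structure TransferState where
  p : ℂ
  q : ℂ
  r₁ : ℂ
  r₂ : ℂ

/-- The value of `φ₃` at the point `X`. -/
def TransferState.val (Y : TransferState) (X : ℝ) : ℂ :=
  Y.p * (Real.exp X : ℂ) + Y.q * (Real.exp (-X) : ℂ)

/-- The jump of the coefficients across a peak at `X` with masses `a`, `b`. -/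
def TransferState.jump (l : ℂ) (X a b : ℝ) (Y : TransferState) : TransferState where
  p := Y.p - l * (a * (Y.r₂ + b * Y.val X) + b * (Y.r₁ + a * Y.val X)) * (Real.exp (-X) : ℂ)
  q := Y.q + l * (a * (Y.r₂ + b * Y.val X) + b * (Y.r₁ + a * Y.val X)) * (Real.exp X : ℂ)
  r₁ := Y.r₁ + 2 * a * Y.val X
  r₂ := Y.r₂ + 2 * b * Y.val X

/-- The coefficients after `k` peaks, for the solution `φ₃ = eˣ`, `φ₂ = 0` to the left. -/
def transfer {N : ℕ} (l : ℂ) (x m n : Fin N → ℝ) : ℕ → TransferState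
  | 0 => ⟨1, 0, 0, 0⟩
  | k + 1 => if h : k < N then
      (transfer l x m n k).jump l (x ⟨k, h⟩) (m ⟨k, h⟩) (n ⟨k, h⟩) else transfer l x m n k

theorem transfer_succ {N : ℕ} (l : ℂ) (x m n : Fin N → ℝ) (j : Fin N) :
    transfer l x m n (j + 1) = (transfer l x m n j).jump l (x j) (m j) (n j) := by
  rw [transfer, dif_pos j.2]

/-- The time evolution of the coefficients in a gap where
`u = α₁ e⁻ˣ + β₁ eˣ` and `v = α₂ e⁻ˣ + β₂ eˣ`. -/
structure IsTransferEvolution (l s α₁ α₂ β₁ β₂ : ℂ) (Y : ℝ → TransferState) (S : Set ℝ)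
    (t : ℝ) : Prop where
  deriv_p : HasDerivWithinAt (fun τ => (Y τ).p)
    (s * (-(α₁ * β₂ + α₂ * β₁) * (Y t).p + 2 * β₁ * β₂ * (Y t).q +
      (β₁ * (Y t).r₂ + β₂ * (Y t).r₁) / 2)) S t
  deriv_q : HasDerivWithinAt (fun τ => (Y τ).q)
    (s * (-(2 * α₁ * α₂) * (Y t).p + (α₁ * β₂ + α₂ * β₁) * (Y t).q +
      (α₁ * (Y t).r₂ + α₂ * (Y t).r₁) / 2)) S t
  deriv_r₁ : HasDerivWithinAt (fun τ => (Y τ).r₁)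
    (s * ((Y t).r₁ / 2 / l + (β₁ * (Y t).q - α₁ * (Y t).p) / l -
      (β₁ * α₂ - α₁ * β₂) * (Y t).r₁)) S t
  deriv_r₂ : HasDerivWithinAt (fun τ => (Y τ).r₂)
    (s * ((Y t).r₂ / 2 / l + (β₂ * (Y t).q - α₂ * (Y t).p) / l +
      (β₁ * α₂ - α₁ * β₂) * (Y t).r₂)) S t

/-- Compatibility of the gap evolution with the jump conditions, where `l` plays the role of `-z²`.
The peak at `X` contributes to the coefficients of `eˣ` in the gap on its left and of `e⁻ˣ` in the
gap on its right. Once the peakon equations are inserted, the claim is a rational identity in `exp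
X`. -/
theorem IsTransferEvolution.jump {l s α₁ α₂ β₁ β₂ : ℂ} {Y : ℝ → TransferState} {S : Set ℝ}
    {t : ℝ} {X a b : ℝ → ℝ} {X' a' b' : ℝ} (hl : l ≠ 0)
    (hY : IsTransferEvolution l s α₁ α₂ (β₁ + a t * (Real.exp (-X t) : ℂ))
      (β₂ + b t * (Real.exp (-X t) : ℂ)) Y S t)
    (hX : HasDerivWithinAt X X' S t) (ha : HasDerivWithinAt a a' S t)
    (hb : HasDerivWithinAt b b' S t)
    (eX : (X' : ℂ) = s * ((α₁ * (Real.exp (-X t) : ℂ) + a t + β₁ * (Real.exp (X t) : ℂ)) *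
      (α₂ * (Real.exp (-X t) : ℂ) + b t + β₂ * (Real.exp (X t) : ℂ))))
    (ea : (a' : ℂ) = s * (a t * (α₁ * (Real.exp (-X t) : ℂ) - β₁ * (Real.exp (X t) : ℂ)) *
      (α₂ * (Real.exp (-X t) : ℂ) + b t + β₂ * (Real.exp (X t) : ℂ))))
    (eb : (b' : ℂ) = s * (b t * (α₂ * (Real.exp (-X t) : ℂ) - β₂ * (Real.exp (X t) : ℂ)) *
      (α₁ * (Real.exp (-X t) : ℂ) + a t + β₁ * (Real.exp (X t) : ℂ)))) :
    IsTransferEvolution l s (α₁ + a t * (Real.exp (X t) : ℂ)) (α₂ + b t * (Real.exp (X t) : ℂ))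
      β₁ β₂ (fun τ => (Y τ).jump l (X τ) (a τ) (b τ)) S t := by
  have dp := hX.exp.ofReal_comp
  have dq := hX.neg.exp.ofReal_comp
  have da := ha.ofReal_comp
  have db := hb.ofReal_comp
  have dv : HasDerivWithinAt (fun τ => (Y τ).val (X τ)) _ S t :=
    (hY.deriv_p.mul dp).add (hY.deriv_q.mul dq)
  have dw : HasDerivWithinAt (fun τ => l * ((a τ : ℂ) * ((Y τ).r₂ + (b τ : ℂ) * (Y τ).val (X τ)) +
      (b τ : ℂ) * ((Y τ).r₁ + (a τ : ℂ) * (Y τ).val (X τ)))) _ S t :=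
    ((da.mul (hY.deriv_r₂.add (db.mul dv))).add
      (db.mul (hY.deriv_r₁.add (da.mul dv)))).const_mul l
  have hne : Real.exp (X t) ≠ 0 := (Real.exp_pos _).ne'
  have hneC : Complex.exp (X t) ≠ 0 := Complex.exp_ne_zero _
  simp only [Real.exp_neg, Complex.ofReal_inv] at eX ea eb
  refine ⟨(hY.deriv_p.sub (dw.mul dq)).congr_deriv ?_, (hY.deriv_q.add (dw.mul dp)).congr_deriv ?_,
    (hY.deriv_r₁.add ((da.const_mul 2).mul dv)).congr_deriv ?_,
    (hY.deriv_r₂.add ((db.const_mul 2).mul dv)).congr_deriv ?_⟩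
  all_goals
    simp only [TransferState.jump, TransferState.val, Complex.ofReal_mul, Complex.ofReal_neg,
      Real.exp_neg, Complex.ofReal_inv, Pi.neg_apply, Pi.add_apply, Pi.mul_apply, eX, ea, eb]
    generalize Real.exp (X t) = e at *
    have he : (e : ℂ) ≠ 0 := Complex.ofReal_ne_zero.mpr hne
    field_simp
    ring

/-- On the far left `α₁ = α₂ = 0`, and the state `(1, 0, 0, 0)` is a stationary solution of the gap
evolution. Each peak carries the evolution one gap further. -/
theorem IsScaledFlow.transfer_evolution {N : ℕ} {s : ℝ → ℝ} {x m n : ℝ → Fin N → ℝ}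
    (h : IsScaledFlow s x m n) {l : ℂ} (hl : l ≠ 0) {t : ℝ} (ht : 0 ≤ t) (k : ℕ) (hk : k ≤ N) :
    IsTransferEvolution l (s t) (leftMom (x t) (m t) k) (leftMom (x t) (n t) k)
      (rightMom (x t) (m t) k) (rightMom (x t) (n t) k)
      (fun τ => transfer l (x τ) (m τ) (n τ) k) (Ici 0) t := by
  induction k with
  | zero =>
    constructor <;> simpa [transfer, leftMom, psum_zero] using hasDerivWithinAt_const _ _ _
  | succ k ih =>
    have ih := ih (by omega)
    set j : Fin N := ⟨k, hk⟩
    have hj : k = j.val := rfl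
    rw [hj] at ih ⊢
    simp_rw [transfer_succ]
    rw [leftMom_succ, leftMom_succ]
    rw [rightMom_succ, rightMom_succ] at ih
    push_cast at ih ⊢
    have hx := h.strictMono t ht
    have := IsTransferEvolution.jump (X := fun τ => x τ j) (a := fun τ => m τ j)
      (b := fun τ => n τ j) hl (by simpa using ih) (h.deriv_x t ht j)
      (h.deriv_m t ht j) (h.deriv_n t ht j)
      (by rw [peakVal_eq hx, peakVal_eq hx]; push_cast; ring)
      (by rw [peakVal_eq hx, peakSlope_eq hx]; push_cast; ring)
      (by rw [peakVal_eq hx, peakSlope_eq hx]; push_cast; ring)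
    simpa using this

theorem eq_of_hasDerivWithinAt_zero {E : Type*} [NormedAddCommGroup E] [NormedSpace ℝ E]
    {f : ℝ → E} (hf : ∀ t, 0 ≤ t → HasDerivWithinAt f 0 (Ici 0) t) {t : ℝ} (ht : 0 ≤ t) :
    f t = f 0 := by
  refine (convex_Ici (0 : ℝ)).is_const_of_fderivWithin_eq_zero (𝕜 := ℝ)
    (fun t ht => (hf t ht).differentiableWithinAt) (fun t ht => ?_) ht self_mem_Ici
  rw [(hf t ht).hasFDerivWithinAt.fderivWithin (uniqueDiffOn_Ici 0 t ht)]
  ext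
  simp

/-- The growing coefficient to the right of all peaks is a constant of motion. -/
theorem IsScaledFlow.transfer_p_eq {N : ℕ} {s : ℝ → ℝ} {x m n : ℝ → Fin N → ℝ}
    (h : IsScaledFlow s x m n) {l : ℂ} (hl : l ≠ 0) {t : ℝ} (ht : 0 ≤ t) :
    (transfer l (x t) (m t) (n t) N).p = (transfer l (x 0) (m 0) (n 0) N).p := by
  refine eq_of_hasDerivWithinAt_zero (f := fun t => (transfer l (x t) (m t) (n t) N).p)
    (fun t ht => ?_) ht
  -- To the right of all peaks `β₁ = β₂ = 0`, and every term of the equation for `p` contains one of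
  -- them.
  refine (h.transfer_evolution hl ht N le_rfl).deriv_p.congr_deriv ?_
  simp [rightMom, psum_card]


/-! ### The reduced spectral matrix -/

/-- The lower triangular matrix with entries `T_{ij} ⟨𝐦ᵢ, 𝐦ⱼ⟩`. -/
def matG {N : ℕ} (m n : Fin N → ℝ) : Matrix (Fin N) (Fin N) ℝ :=
  Matrix.of fun i j => matT N i j * (m i * n j + n i * m j)

/-- The matrix `E (T ∘ ⟨𝐦ᵢ, 𝐦ⱼ⟩)`, which carries the nonzero spectrum. -/
def redMatrix {N : ℕ} (x m n : Fin N → ℝ) : Matrix (Fin N) (Fin N) ℝ := matE x * matG m n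

/-- The reduced spectral matrix, viewed as a complex matrix. -/
def redMatrixC {N : ℕ} (x m n : Fin N → ℝ) : Matrix (Fin N) (Fin N) ℂ :=
  (redMatrix x m n).map Complex.ofReal

theorem matPstar_mul_matT_mul_matP {N : ℕ} (m n : Fin N → ℝ) :
    matPstar m n * ((matT N ⊗ₖ (1 : Matrix (Fin 2) (Fin 2) ℝ)) * matP m n) = matG m n := by
  ext i j
  simp only [Matrix.mul_apply, Fintype.sum_prod_type, matPstar, matP, matG, Matrix.of_apply,
    Matrix.kroneckerMap_apply, Fin.sum_univ_two, dual, mass]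
  simp [ite_mul, Finset.sum_add_distrib]
  ring

/-- `AB` and `BA` share their characteristic polynomial up to a power of `X`, here with `A = (T ⊗
1)P` and `B = EP*`; the size drops from `2N` to `N`. -/
theorem charpoly_specMatrix {N : ℕ} (x m n : Fin N → ℝ) :
    (specMatrix x m n).charpoly = Polynomial.X ^ N * (redMatrix x m n).charpoly := by
  have h := Matrix.charpoly_mul_comm_of_le
    (A := (matT N ⊗ₖ (1 : Matrix (Fin 2) (Fin 2) ℝ)) * matP m n) (B := matE x * matPstar m n)
    (by simp [mul_two])
  rw [specMatrix, Matrix.mul_assoc, h, Matrix.mul_assoc (matE x), matPstar_mul_matT_mul_matP,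
    redMatrix]
  simp [mul_two]

theorem charpoly_specMatrixC {N : ℕ} (x m n : Fin N → ℝ) :
    (specMatrixC x m n).charpoly = Polynomial.X ^ N * (redMatrixC x m n).charpoly := by
  have h := congrArg (Polynomial.map Complex.ofRealHom) (charpoly_specMatrix x m n)
  rw [← Matrix.charpoly_map, Polynomial.map_mul, ← Matrix.charpoly_map] at h
  rw [Polynomial.map_pow, Polynomial.map_X] at h
  exact h

theorem isRoot_charpoly_iff {ι : Type*} [Fintype ι] [DecidableEq ι] (A : Matrix ι ι ℂ) (κ : ℂ) :
    A.charpoly.IsRoot κ ↔ ∃ φ : ι → ℂ, φ ≠ 0 ∧ A.mulVec φ = κ • φ := by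
  rw [Polynomial.IsRoot, Matrix.eval_charpoly, ← Matrix.exists_mulVec_eq_zero_iff]
  refine exists_congr fun φ => and_congr_right fun _ => ?_
  have h : (Matrix.scalar ι κ).mulVec φ = κ • φ := by
    ext i
    simp [Matrix.scalar_apply, Matrix.mulVec_diagonal]
  rw [Matrix.sub_mulVec, sub_eq_zero, h, eq_comm]

/-- Row `j` of `T` forms twice the sum of the earlier entries plus the `j`-th one. This is the mean
of a step function with jumps of twice the entries, which is how `⟨φ₂⟩` enters. -/
theorem matG_mulVec {N : ℕ} (m n : Fin N → ℝ) (φ : Fin N → ℂ) (j : Fin N) :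
    ((matG m n).map Complex.ofReal).mulVec φ j =
      m j * (2 * psum (fun i => n i * φ i) j + n j * φ j) +
      n j * (2 * psum (fun i => m i * φ i) j + m j * φ j) := by
  have h : ∀ w : Fin N → ℂ, 2 * psum w j + w j = ∑ i, (matT N j i : ℂ) * w i := by
    intro w
    have hw : w j = ∑ i, if j = i then w i else 0 := by simp
    rw [hw, psum, Finset.mul_sum, ← Finset.sum_add_distrib]
    refine Finset.sum_congr rfl fun i _ => ?_
    rcases lt_trichotomy i j with h | h | h
    · have h' : i.val < j.val := h
      simp [matT, h, h', h.ne']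
    · simp [matT, h]
    · have h' : ¬ i.val < j.val := not_lt.mpr h.le
      simp [matT, h.not_gt, h', h.ne]
  rw [h fun i => n i * φ i, h fun i => m i * φ i]
  simp only [Matrix.mulVec, dotProduct, Matrix.map_apply, matG, Matrix.of_apply]
  rw [Finset.mul_sum, Finset.mul_sum, ← Finset.sum_add_distrib]
  refine Finset.sum_congr rfl fun i _ => ?_
  push_cast
  ring

theorem matE_mulVec {N : ℕ} {x : Fin N → ℝ} (hx : StrictMono x) (w : Fin N → ℂ) (j : Fin N) :
    ((matE x).map Complex.ofReal).mulVec w j =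
      (Real.exp (-x j) : ℂ) * psum (fun i => (Real.exp (x i) : ℂ) * w i) j +
      (Real.exp (x j) : ℂ) * (∑ i, (Real.exp (-x i) : ℂ) * w i -
        psum (fun i => (Real.exp (-x i) : ℂ) * w i) j) := by
  have := sum_exp_neg_abs_smul hx w j
  simp only [Complex.real_smul] at this
  rw [← this]
  rfl

/-- A vector that reproduces its own values through the transfer recursion with
leading coefficient `c` is `c` times the transfer solution. -/
theorem transfer_eq_of_val {N : ℕ} {l c : ℂ} {x m n : Fin N → ℝ} (φ w : Fin N → ℂ)
    (hw : ∀ j, w j = m j * (2 * psum (fun i => n i * φ i) j + n j * φ j) +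
      n j * (2 * psum (fun i => m i * φ i) j + m j * φ j))
    (hφ : ∀ j : Fin N, φ j =
      (c - l * psum (fun i => (Real.exp (-x i) : ℂ) * w i) j) * (Real.exp (x j) : ℂ) +
      l * psum (fun i => (Real.exp (x i) : ℂ) * w i) j * (Real.exp (-x j) : ℂ))
    (k : ℕ) (hk : k ≤ N) :
    c * (transfer l x m n k).p = c - l * psum (fun i => (Real.exp (-x i) : ℂ) * w i) k ∧
    c * (transfer l x m n k).q = l * psum (fun i => (Real.exp (x i) : ℂ) * w i) k ∧
    c * (transfer l x m n k).r₁ = 2 * psum (fun i => m i * φ i) k ∧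
    c * (transfer l x m n k).r₂ = 2 * psum (fun i => n i * φ i) k ∧
    ∀ i : Fin N, i.val < k → φ i = c * (transfer l x m n i).val (x i) := by
  induction k with
  | zero => simp [transfer, psum_zero]
  | succ k ih =>
    obtain ⟨hp, hq, h1, h2, hv⟩ := ih (by omega)
    set j : Fin N := ⟨k, hk⟩
    have hj : k = j.val := rfl
    rw [hj] at hp hq h1 h2 hv ⊢
    have hval : φ j = c * (transfer l x m n j).val (x j) := by
      rw [hφ j, ← hp, ← hq, TransferState.val]
      ring
    have hwj := hw j
    simp only [transfer_succ, psum_succ, TransferState.jump]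
    refine ⟨?_, ?_, ?_, ?_, fun i hi => ?_⟩
    · linear_combination hp - l * (Real.exp (-x j) : ℂ) * (m j * h2 + n j * h1 - hwj) +
        2 * l * (Real.exp (-x j) : ℂ) * m j * n j * hval
    · linear_combination hq + l * (Real.exp (x j) : ℂ) * (m j * h2 + n j * h1 - hwj) -
        2 * l * (Real.exp (x j) : ℂ) * m j * n j * hval
    · linear_combination h1 - 2 * m j * hval
    · linear_combination h2 - 2 * n j * hval
    · rcases Nat.lt_succ_iff_lt_or_eq.mp hi with hi | hi
      · exact hv i hi
      · rw [Fin.ext hi]; exact hval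

/-- The nonzero eigenvalues of the reduced matrix are read off from the transfer recursion. -/
theorem isRoot_redMatrixC_iff {N : ℕ} {x : Fin N → ℝ} (hx : StrictMono x) (m n : Fin N → ℝ)
    {κ : ℂ} (hκ : κ ≠ 0) :
    (redMatrixC x m n).charpoly.IsRoot κ ↔ (transfer κ⁻¹ x m n N).p = 0 := by
  have hEG : ∀ φ : Fin N → ℂ, (redMatrixC x m n).mulVec φ =
      ((matE x).map Complex.ofReal).mulVec (((matG m n).map Complex.ofReal).mulVec φ) := by
    intro φ
    rw [Matrix.mulVec_mulVec, redMatrixC, redMatrix]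
    congr 1
    exact Matrix.map_mul (f := Complex.ofRealHom)
  rw [isRoot_charpoly_iff]
  constructor
  · rintro ⟨φ, hφ0, hφ⟩
    set w := ((matG m n).map Complex.ofReal).mulVec φ with hw
    have hj : ∀ j, φ j = κ⁻¹ * ((matE x).map Complex.ofReal).mulVec w j := by
      intro j
      rw [hw, ← hEG, hφ]
      simp [hκ]
    -- The constant `c` is the coefficient of `eˣ` to the left of all peaks. No such term survives
    -- on the far right, so `c p = 0`; and `c = 0` would make `φ` vanish at every peak.
    have key := transfer_eq_of_val (l := κ⁻¹)
      (c := κ⁻¹ * ∑ i, (Real.exp (-x i) : ℂ) * w i) (x := x) φ w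
      (fun j => matG_mulVec m n φ j)
      (fun j => by rw [hj j, matE_mulVec hx]; ring) N le_rfl
    have h1 := key.1
    rw [psum_card, sub_self] at h1
    refine (mul_eq_zero.mp h1).resolve_left fun hc => hφ0 ?_
    ext i
    rw [key.2.2.2.2 i i.2, hc]
    simp
  · intro hp
    -- The eigenvector consists of the values of the transfer solution at the peaks.
    set φ : Fin N → ℂ := fun j => (transfer κ⁻¹ x m n j).val (x j) with hφ
    set w := ((matG m n).map Complex.ofReal).mulVec φ with hw
    have key : ∀ k ≤ N, (transfer κ⁻¹ x m n k).p =
        1 - κ⁻¹ * psum (fun i => (Real.exp (-x i) : ℂ) * w i) k ∧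
        (transfer κ⁻¹ x m n k).q = κ⁻¹ * psum (fun i => (Real.exp (x i) : ℂ) * w i) k ∧
        (transfer κ⁻¹ x m n k).r₁ = 2 * psum (fun i => m i * φ i) k ∧
        (transfer κ⁻¹ x m n k).r₂ = 2 * psum (fun i => n i * φ i) k := by
      intro k
      induction k with
      | zero => simp [transfer, psum_zero]
      | succ k ih =>
        intro hk
        obtain ⟨hp, hq, h1, h2⟩ := ih (by omega)
        set j : Fin N := ⟨k, hk⟩
        have hj : k = j.val := rfl
        rw [hj] at hp hq h1 h2 ⊢
        have hwj : w j = _ := matG_mulVec m n φ j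
        have hval : φ j = (transfer κ⁻¹ x m n j).val (x j) := rfl
        simp only [transfer_succ, psum_succ, TransferState.jump, ← hval]
        refine ⟨?_, ?_, ?_, ?_⟩
        · linear_combination hp - κ⁻¹ * (Real.exp (-x j) : ℂ) * (m j * h2 + n j * h1 - hwj)
        · linear_combination hq + κ⁻¹ * (Real.exp (x j) : ℂ) * (m j * h2 + n j * h1 - hwj)
        · linear_combination h1
        · linear_combination h2
    -- The condition `p = 0` fixes the total right moment. This shows both that `φ ≠ 0` and that the
    -- right part of `EGφ` has the required value.
    have htot : 1 = κ⁻¹ * ∑ i, (Real.exp (-x i) : ℂ) * w i := by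
      have := (key N le_rfl).1
      rw [hp, psum_card] at this
      linear_combination -this
    refine ⟨φ, fun h0 => ?_, ?_⟩
    · have : w = 0 := by rw [hw, h0, Matrix.mulVec_zero]
      simp [this] at htot
    · ext j
      rw [hEG, ← hw, matE_mulVec hx, Pi.smul_apply, smul_eq_mul]
      have h1 := (key j j.2.le).1
      have h2 := (key j j.2.le).2.1
      have h3 : κ * κ⁻¹ = 1 := mul_inv_cancel₀ hκ
      have : φ j = (transfer κ⁻¹ x m n j).p * (Real.exp (x j) : ℂ) +
        (transfer κ⁻¹ x m n j).q * (Real.exp (-x j) : ℂ) := rfl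
      rw [this, h1, h2]
      linear_combination κ * (Real.exp (x j) : ℂ) * (-htot) -
        ((Real.exp (-x j) : ℂ) * psum (fun i => (Real.exp (x i) : ℂ) * w i) j +
      (Real.exp (x j) : ℂ) * (∑ i, (Real.exp (-x i) : ℂ) * w i -
        psum (fun i => (Real.exp (-x i) : ℂ) * w i) j)) * h3


/-! ### Constants of motion -/

theorem continuous_redMatrixC {N : ℕ} : Continuous
    (fun q : (Fin N → ℝ) × (Fin N → ℝ) × (Fin N → ℝ) => redMatrixC q.1 q.2.1 q.2.2) := by
  refine continuous_pi fun i => continuous_pi fun j => ?_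
  simp only [redMatrixC, redMatrix, Matrix.map_apply, Matrix.mul_apply, matE, matG,
    Matrix.of_apply]
  fun_prop

/-- Over `ℂ` a monic polynomial is determined by its multiset of roots, and in degree `N` this is
contained in `N` copies of the finite set `R`. -/
theorem finite_eval_of_roots_subset {R : Set ℂ} (hR : R.Finite) (N : ℕ) (κ : ℂ) :
    {c : ℂ | ∃ p : Polynomial ℂ, p.Monic ∧ p.natDegree = N ∧ (∀ r, p.IsRoot r → r ∈ R) ∧
      p.eval κ = c}.Finite := by
  refine ((Set.finite_Iic (N • hR.toFinset.val)).image
    (fun S : Multiset ℂ => (S.map (fun a => κ - a)).prod)).subset ?_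
  rintro c ⟨p, hp, hN, hroots, rfl⟩
  refine ⟨p.roots, ?_, ((IsAlgClosed.splits p).eval_eq_prod_roots_of_monic hp κ).symm⟩
  rw [mem_Iic, Multiset.le_iff_count]
  intro a
  rw [Multiset.count_nsmul]
  by_cases ha : a ∈ p.roots
  · have h1 : Multiset.count a hR.toFinset.val = 1 :=
      Multiset.count_eq_one_of_mem hR.toFinset.nodup (by
        simpa using hroots a (Polynomial.isRoot_of_mem_roots ha))
    rw [h1, mul_one, ← hN]
    exact (Multiset.count_le_card _ _).trans (Polynomial.card_roots' p)
  · simp [Multiset.count_eq_zero_of_notMem ha]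

theorem IsScaledFlow.continuousOn {N : ℕ} {s : ℝ → ℝ} {x m n : ℝ → Fin N → ℝ}
    (h : IsScaledFlow s x m n) : ContinuousOn (fun t => (x t, m t, n t)) (Ici 0) :=
  (continuousOn_pi.mpr fun j t ht => (h.deriv_x t ht j).continuousWithinAt).prodMk
    ((continuousOn_pi.mpr fun j t ht => (h.deriv_m t ht j).continuousWithinAt).prodMk
      (continuousOn_pi.mpr fun j t ht => (h.deriv_n t ht j).continuousWithinAt))

/-- The transfer criterion fixes only the set of nonzero roots and says nothing of multiplicities,
nor of `κ = 0`, which is therefore inserted by hand. The value of the polynomial at any point is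
continuous in time and takes finitely many values, so it is constant on the connected half line. -/
theorem IsScaledFlow.charpoly_redMatrixC {N : ℕ} {s : ℝ → ℝ} {x m n : ℝ → Fin N → ℝ}
    (h : IsScaledFlow s x m n) {t : ℝ} (ht : 0 ≤ t) :
    (redMatrixC (x t) (m t) (n t)).charpoly = (redMatrixC (x 0) (m 0) (n 0)).charpoly := by
  have hroot : ∀ t, 0 ≤ t → ∀ κ, (redMatrixC (x t) (m t) (n t)).charpoly.IsRoot κ →
      κ ∈ insert 0 {κ | (redMatrixC (x 0) (m 0) (n 0)).charpoly.IsRoot κ} := by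
    intro t ht κ hκ
    rcases eq_or_ne κ 0 with h0 | h0
    · exact Or.inl h0
    · right
      rw [isRoot_redMatrixC_iff (h.strictMono t ht) _ _ h0, h.transfer_p_eq (inv_ne_zero h0) ht,
        ← isRoot_redMatrixC_iff (h.strictMono 0 le_rfl) _ _ h0] at hκ
      exact hκ
  have hfin : (insert 0 {κ | (redMatrixC (x 0) (m 0) (n 0)).charpoly.IsRoot κ}).Finite :=
    (Polynomial.finite_setOfPred_isRoot (Matrix.charpoly_monic _).ne_zero).insert 0
  refine Polynomial.funext fun κ => ?_
  have hc : ContinuousOn (fun t => (redMatrixC (x t) (m t) (n t)).charpoly.eval κ) (Ici 0) := by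
    simp_rw [Matrix.eval_charpoly]
    have := continuous_redMatrixC.comp_continuousOn h.continuousOn
    exact (continuous_const.sub continuous_id).matrix_det.comp_continuousOn this
  have hpre := isPreconnected_Ici.image _ hc
  by_contra hne
  refine (hpre.infinite_of_nontrivial ⟨_, mem_image_of_mem _ ht, _,
    mem_image_of_mem _ self_mem_Ici, hne⟩) ((finite_eval_of_roots_subset hfin N κ).subset ?_)
  rintro _ ⟨τ, hτ, rfl⟩
  exact ⟨_, Matrix.charpoly_monic _, by simp [Matrix.charpoly_natDegree_eq_dim],
    hroot τ hτ, rfl⟩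

theorem IsScaledFlow.charpoly_redMatrix {N : ℕ} {s : ℝ → ℝ} {x m n : ℝ → Fin N → ℝ}
    (h : IsScaledFlow s x m n) {t : ℝ} (ht : 0 ≤ t) :
    (redMatrix (x t) (m t) (n t)).charpoly = (redMatrix (x 0) (m 0) (n 0)).charpoly := by
  refine Polynomial.map_injective Complex.ofRealHom Complex.ofRealHom.injective ?_
  rw [← Matrix.charpoly_map, ← Matrix.charpoly_map]
  exact h.charpoly_redMatrixC ht

/-- The Hamiltonian `∑ mⱼ nₖ exp (-|xⱼ - xₖ|)`. -/
def energy {N : ℕ} (x m n : Fin N → ℝ) : ℝ := ∑ j, ∑ k, m j * n k * Real.exp (-|x j - x k|)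

/-- Since `E` and the pairing are symmetric, only the symmetric part of `T` contributes, and every
entry of `T + Tᵀ` is `2`. -/
theorem trace_redMatrix {N : ℕ} (x m n : Fin N → ℝ) :
    (redMatrix x m n).trace = 2 * energy x m n := by
  have h1 : (redMatrix x m n).trace = ∑ i, ∑ k,
      Real.exp (-|x i - x k|) * (matT N k i * (m k * n i + n k * m i)) := by
    simp [Matrix.trace, redMatrix, Matrix.mul_apply, matE, matG]
  have h2 : (redMatrix x m n).trace = ∑ i, ∑ k,
      Real.exp (-|x i - x k|) * (matT N i k * (m k * n i + n k * m i)) := by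
    rw [h1, Finset.sum_comm]
    refine Finset.sum_congr rfl fun i _ => Finset.sum_congr rfl fun k _ => ?_
    rw [abs_sub_comm]
    ring
  have h3 : energy x m n = ∑ i, ∑ k, n i * m k * Real.exp (-|x i - x k|) := by
    rw [energy, Finset.sum_comm]
    refine Finset.sum_congr rfl fun i _ => Finset.sum_congr rfl fun k _ => ?_
    rw [abs_sub_comm]
    ring
  have hT : ∀ i k : Fin N, matT N k i + matT N i k = 2 := by
    intro i k
    rcases lt_trichotomy i k with h | h | h
    · simp [matT, h, h.ne, h.ne', h.not_gt]
    · simp [matT, h]; norm_num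
    · simp [matT, h, h.ne, h.ne', h.not_gt]
  have h4 : (redMatrix x m n).trace + (redMatrix x m n).trace =
      2 * (energy x m n + energy x m n) := by
    nth_rewrite 1 [h1]
    rw [h2]
    nth_rewrite 1 [h3]
    rw [energy]
    simp only [← Finset.sum_add_distrib, Finset.mul_sum]
    refine Finset.sum_congr rfl fun i _ => Finset.sum_congr rfl fun k _ => ?_
    linear_combination Real.exp (-|x i - x k|) * (m k * n i + n k * m i) * hT i k
  linarith

theorem IsScaledFlow.energy_eq {N : ℕ} {s : ℝ → ℝ} {x m n : ℝ → Fin N → ℝ}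
    (h : IsScaledFlow s x m n) {t : ℝ} (ht : 0 ≤ t) :
    energy (x t) (m t) (n t) = energy (x 0) (m 0) (n 0) := by
  have h1 := Matrix.trace_eq_neg_charpoly_nextCoeff (redMatrix (x t) (m t) (n t))
  rw [h.charpoly_redMatrix ht, ← Matrix.trace_eq_neg_charpoly_nextCoeff, trace_redMatrix,
    trace_redMatrix] at h1
  linarith

theorem det_matG {N : ℕ} (m n : Fin N → ℝ) : (matG m n).det = ∏ j, (2 * (m j * n j)) := by
  rw [Matrix.det_of_isLowerTriangular]
  · refine Finset.prod_congr rfl fun j _ => ?_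
    simp [matG, matT]
    ring
  · intro i j hij
    have hij : i < j := hij
    simp [matG, matT, hij.ne, hij.not_gt]

/-- For ordered points `Eᵢⱼ = exp (-xᵢ) exp (-xⱼ) exp (2 x_{min(i,j)})`, and `exp (2xᵢ)` telescopes
into its positive increments, as for the covariance of a time-changed Brownian motion. -/
theorem exists_matE_eq {N : ℕ} {x : Fin N → ℝ} (hx : StrictMono x) :
    ∃ d : Fin N → ℝ, (∀ k, 0 < d k ∧ d k ≤ Real.exp (2 * x k)) ∧
      matE x = (Matrix.of fun i k => if k ≤ i then Real.exp (-x i) else 0) * Matrix.diagonal d *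
        (Matrix.of fun i k => if k ≤ i then Real.exp (-x i) else 0).transpose := by
  -- The index is shifted by one and `g 0 = 0`, so the first increment is all of `exp (2x)` at the
  -- first peak.
  set g : ℕ → ℝ := fun k => if k = 0 then 0 else
    if h : k - 1 < N then Real.exp (2 * x ⟨k - 1, h⟩) else 0 with hg
  have hg0 : g 0 = 0 := by simp [hg]
  have hgs : ∀ j : Fin N, g (j + 1) = Real.exp (2 * x j) := by intro j; simp [hg]
  set d : Fin N → ℝ := fun j => g (j + 1) - g j with hd
  have hps : ∀ k ≤ N, psum d k = g k := by
    intro k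
    induction k with
    | zero => simp [psum_zero, hg0]
    | succ k ih =>
      intro hk
      have := psum_succ d ⟨k, hk⟩
      simp only at this
      rw [this, ih (by omega)]
      simp [hd]
  have hgnn : ∀ k, 0 ≤ g k := by
    intro k
    simp only [hg]
    split_ifs <;> positivity
  refine ⟨d, fun k => ⟨?_, ?_⟩, ?_⟩
  · simp only [hd, hgs, sub_pos]
    rcases Nat.eq_zero_or_pos k.val with h0 | h0
    · rw [h0, hg0]; positivity
    · have := hgs ⟨k.val - 1, by omega⟩
      rw [show k.val = (k.val - 1) + 1 by omega, this, Real.exp_lt_exp]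
      have : x ⟨k.val - 1, by omega⟩ < x k := hx (by rw [Fin.lt_def]; simp; omega)
      linarith
  · simp only [hd, hgs]
    linarith [hgnn k]
  · ext i j
    have key : ∀ i j : Fin N, i ≤ j → matE x i j = ∑ k, (if k ≤ i then Real.exp (-x i) else 0) *
        d k * (if k ≤ j then Real.exp (-x j) else 0) := by
      intro i j hij
      have h1 := hps (i + 1) i.2
      rw [hgs] at h1
      have h2 : matE x i j = Real.exp (-x i) * Real.exp (-x j) * Real.exp (2 * x i) := by
        rw [← Real.exp_add, ← Real.exp_add, matE, Matrix.of_apply,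
          abs_of_nonpos (sub_nonpos.mpr (hx.monotone hij))]
        ring_nf
      rw [h2, ← h1, psum, Finset.mul_sum]
      refine Finset.sum_congr rfl fun k _ => ?_
      by_cases hk : k ≤ i
      · have hk' : k.val < i.val + 1 := Nat.lt_succ_of_le hk
        simp [hk, hk.trans hij, hk']
        ring
      · have hk' : ¬ k.val < i.val + 1 := fun h => hk (Nat.le_of_lt_succ h)
        simp [hk, hk']
    rw [Matrix.mul_apply]
    simp only [Matrix.mul_diagonal, Matrix.transpose_apply, Matrix.of_apply]
    rcases le_total i j with h | h
    · exact key i j h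
    · have : matE x i j = matE x j i := by simp [matE, abs_sub_comm]
      rw [this, key j i h]
      exact Finset.sum_congr rfl fun k _ => by ring

/-- The factorization gives the determinant as a product of numbers `exp (-2xᵢ) dᵢ`, each in `(0,
1]`. -/
theorem det_matE_mem_Ioc {N : ℕ} {x : Fin N → ℝ} (hx : StrictMono x) :
    (matE x).det ∈ Ioc 0 1 := by
  obtain ⟨d, hd, h⟩ := exists_matE_eq hx
  have hA : (Matrix.of fun i k => if k ≤ i then Real.exp (-x i) else 0 :
      Matrix (Fin N) (Fin N) ℝ).det = ∏ i, Real.exp (-x i) := by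
    rw [Matrix.det_of_isLowerTriangular]
    · simp
    · intro i j hij
      have hij : i < j := hij
      simp [hij.not_ge]
  have hdet : (matE x).det = ∏ i, (Real.exp (-x i) * d i * Real.exp (-x i)) := by
    rw [h, Matrix.det_mul, Matrix.det_mul, Matrix.det_transpose, hA, Matrix.det_diagonal,
      Finset.prod_mul_distrib, Finset.prod_mul_distrib]
  rw [hdet]
  have hpos : ∀ i, 0 < Real.exp (-x i) * d i * Real.exp (-x i) := fun i => by
    have := (hd i).1
    positivity
  refine ⟨Finset.prod_pos fun i _ => hpos i, Finset.prod_le_one (fun i _ => (hpos i).le) ?_⟩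
  intro i _
  calc _ ≤ Real.exp (-x i) * Real.exp (2 * x i) * Real.exp (-x i) := by
        have := (hd i).2
        gcongr
    _ = 1 := by rw [← Real.exp_add, ← Real.exp_add]; simp; ring

theorem mul_exp_le_energy {N : ℕ} {x m n : Fin N → ℝ} (hm : ∀ j, 0 < m j) (hn : ∀ j, 0 < n j)
    (j k : Fin N) : m j * n k * Real.exp (-|x j - x k|) ≤ energy x m n := by
  have hnn : ∀ i l, 0 ≤ m i * n l * Real.exp (-|x i - x l|) := fun i l => by
    have := hm i; have := hn l; positivity
  exact (Finset.single_le_sum (f := fun k => m j * n k * Real.exp (-|x j - x k|))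
      (fun l _ => hnn j l) (Finset.mem_univ k)).trans
    (Finset.single_le_sum (f := fun j => ∑ k, m j * n k * Real.exp (-|x j - x k|))
      (fun i _ => Finset.sum_nonneg fun l _ => hnn i l) (Finset.mem_univ j))

theorem mul_le_energy {N : ℕ} {x m n : Fin N → ℝ} (hm : ∀ j, 0 < m j) (hn : ∀ j, 0 < n j)
    (j : Fin N) : m j * n j ≤ energy x m n := by
  simpa using mul_exp_le_energy (x := x) hm hn j j

/-- The products `mⱼ nⱼ` stay away from zero. -/
theorem IsScaledFlow.exists_le_mul {N : ℕ} {s : ℝ → ℝ} {x m n : ℝ → Fin N → ℝ}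
    (h : IsScaledFlow s x m n) : ∃ c, 0 < c ∧ ∀ t, 0 ≤ t → ∀ j, c ≤ m t j * n t j := by
  -- The conserved determinant is `det E · ∏ 2 mⱼ nⱼ` with `det E ≤ 1`. Hence the product stays
  -- above `D`, and no factor can be small while the energy bounds the others.
  set D := (redMatrix (x 0) (m 0) (n 0)).det with hD
  have hprod : ∀ t, 0 ≤ t → D = (matE (x t)).det * ∏ j, (2 * (m t j * n t j)) := by
    intro t ht
    rw [← det_matG, ← Matrix.det_mul]
    change D = (redMatrix (x t) (m t) (n t)).det
    rw [hD, Matrix.det_eq_sign_charpoly_coeff, Matrix.det_eq_sign_charpoly_coeff,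
      h.charpoly_redMatrix ht]
  have hpos : ∀ t, 0 ≤ t → ∀ j, 0 < 2 * (m t j * n t j) := fun t ht j => by
    have := h.m_pos t ht j; have := h.n_pos t ht j; positivity
  have hDpos : 0 < D := by
    rw [hprod 0 le_rfl]
    exact mul_pos (det_matE_mem_Ioc (h.strictMono 0 le_rfl)).1
      (Finset.prod_pos fun j _ => hpos 0 le_rfl j)
  set H := energy (x 0) (m 0) (n 0)
  -- Taking the maximum with `1` allows the `N - 1` remaining factors to be bounded by `B ^ N`.
  set B := max 1 (2 * H)
  have hB : 1 ≤ B := le_max_left _ _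
  refine ⟨D / (2 * B ^ N), by positivity, fun t ht j => ?_⟩
  have h1 : D ≤ ∏ j, (2 * (m t j * n t j)) := by
    rw [hprod t ht]
    exact mul_le_of_le_one_left (Finset.prod_nonneg fun j _ => (hpos t ht j).le)
      (det_matE_mem_Ioc (h.strictMono t ht)).2
  have h2 : ∏ i ∈ Finset.univ.erase j, (2 * (m t i * n t i)) ≤ B ^ N := by
    calc _ ≤ ∏ i ∈ Finset.univ.erase j, B := by
          refine Finset.prod_le_prod (fun i _ => (hpos t ht i).le) fun i _ => ?_
          have := mul_le_energy (x := x t) (h.m_pos t ht) (h.n_pos t ht) i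
          rw [h.energy_eq ht] at this
          exact (by linarith : _ ≤ 2 * H).trans (le_max_right _ _)
      _ ≤ B ^ N := by
          rw [Finset.prod_const]
          exact pow_le_pow_right₀ hB (by simp)
  rw [← Finset.mul_prod_erase _ _ (Finset.mem_univ j)] at h1
  rw [div_le_iff₀ (by positivity)]
  nlinarith [mul_le_mul_of_nonneg_left h2 (hpos t ht j).le]


/-! ### Convergence controlled by a monotone quantity -/

theorem exists_tendsto_of_monotoneOn {f : ℝ → ℝ} {a B : ℝ} (hf : MonotoneOn f (Ici a))
    (hB : ∀ t, a ≤ t → f t ≤ B) : ∃ L, Tendsto f atTop (𝓝 L) ∧ ∀ t, a ≤ t → f t ≤ L := by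
  have hm : Monotone (fun t => f (max t a)) := fun s t hst =>
    hf (mem_Ici.mpr (le_max_right _ _)) (mem_Ici.mpr (le_max_right _ _)) (max_le_max_right a hst)
  have hb : BddAbove (range fun t => f (max t a)) :=
    ⟨B, by rintro _ ⟨t, rfl⟩; exact hB _ (le_max_right _ _)⟩
  have h := tendsto_atTop_ciSup hm hb
  refine ⟨_, h.congr' ?_, fun t ht => ?_⟩
  · filter_upwards [eventually_ge_atTop a] with t ht
    rw [max_eq_left ht]
  · have := le_ciSup hb t
    rwa [max_eq_left ht] at this

theorem le_of_monotoneOn_of_tendsto {f : ℝ → ℝ} {a L : ℝ} (hf : MonotoneOn f (Ici a))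
    (hL : Tendsto f atTop (𝓝 L)) {t : ℝ} (ht : a ≤ t) : f t ≤ L :=
  ge_of_tendsto hL (by
    filter_upwards [eventually_ge_atTop t] with s hs
    exact hf ht (ht.trans hs) hs)

/-- If `|f'| ≤ K Φ'`, then `f` converges whenever `Φ` does, with a corresponding rate. -/
theorem exists_tendsto_of_abs_deriv_le {f f' Φ Φ' : ℝ → ℝ} {a B K : ℝ} (hK : 0 ≤ K)
    (hf : ∀ t, a ≤ t → HasDerivWithinAt f (f' t) (Ici a) t)
    (hΦ : ∀ t, a ≤ t → HasDerivWithinAt Φ (Φ' t) (Ici a) t)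
    (hfΦ : ∀ t, a ≤ t → |f' t| ≤ K * Φ' t) (h0 : ∀ t, a ≤ t → 0 ≤ Φ' t)
    (hB : ∀ t, a ≤ t → Φ t ≤ B) :
    ∃ L, Tendsto f atTop (𝓝 L) ∧ ∀ t, a ≤ t → |f t - L| ≤ K * (B - Φ t) := by
  -- Both `KΦ + f` and `KΦ - f` are nondecreasing; their limits give the limit of `f`, and their
  -- monotonicity gives the rate.
  have hmp : MonotoneOn (fun t => K * Φ t + f t) (Ici a) :=
    monotoneOn_Ici_of_hasDerivWithinAt (fun t ht => ((hΦ t ht).const_mul K).add (hf t ht))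
      fun t ht => by linarith [(abs_le.mp (hfΦ t ht)).1]
  have hmm : MonotoneOn (fun t => K * Φ t - f t) (Ici a) :=
    monotoneOn_Ici_of_hasDerivWithinAt (fun t ht => ((hΦ t ht).const_mul K).sub (hf t ht))
      fun t ht => by linarith [(abs_le.mp (hfΦ t ht)).2]
  have hKB : ∀ t, a ≤ t → K * Φ t ≤ K * B := fun t ht => mul_le_mul_of_nonneg_left (hB t ht) hK
  have hfub : ∀ t, a ≤ t → K * Φ t + f t ≤ 2 * (K * B) - (K * Φ a - f a) := by
    intro t ht
    have h1 := hmm self_mem_Ici ht ht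
    simp only at h1
    linarith [hKB t ht]
  obtain ⟨L₁, hL₁, -⟩ := exists_tendsto_of_monotoneOn hmp hfub
  obtain ⟨L₂, hL₂, hle⟩ := exists_tendsto_of_monotoneOn
    (monotoneOn_Ici_of_hasDerivWithinAt hΦ h0) hB
  have hL₂B : L₂ ≤ B := le_of_tendsto hL₂ (by
    filter_upwards [eventually_ge_atTop a] with t ht using hB t ht)
  have hlim : Tendsto f atTop (𝓝 (L₁ - K * L₂)) := by
    have := hL₁.sub (hL₂.const_mul K)
    simpa using this
  refine ⟨L₁ - K * L₂, hlim, fun t ht => ?_⟩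
  have h1 : K * Φ t + f t ≤ L₁ := le_of_monotoneOn_of_tendsto hmp hL₁ ht
  have h2 : K * Φ t - f t ≤ K * L₂ - (L₁ - K * L₂) :=
    le_of_monotoneOn_of_tendsto hmm ((hL₂.const_mul K).sub hlim) ht
  have h3 := mul_le_mul_of_nonneg_left hL₂B hK
  rw [abs_le]
  constructor <;> linarith

theorem tendsto_atTop_of_le_deriv {f f' : ℝ → ℝ} {a δ : ℝ} (hδ : 0 < δ)
    (hf : ∀ t, a ≤ t → HasDerivWithinAt f (f' t) (Ici a) t) (h : ∀ t, a ≤ t → δ ≤ f' t) :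
    Tendsto f atTop atTop := by
  have hm : MonotoneOn (fun t => f t - δ * t) (Ici a) :=
    monotoneOn_Ici_of_hasDerivWithinAt
      (fun t ht => (hf t ht).sub ((hasDerivAt_id t).const_mul δ).hasDerivWithinAt)
      fun t ht => by simpa using h t ht
  refine tendsto_atTop_mono' atTop (f₁ := fun t => δ * t + (f a - δ * a)) ?_ ?_
  · filter_upwards [eventually_ge_atTop a] with t ht
    have := hm self_mem_Ici ht ht
    simp only at this
    linarith
  · exact tendsto_atTop_add_const_right _ _ (tendsto_id.const_mul_atTop hδ)

/-- An integrable function with integrable derivative tends to zero. -/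
theorem tendsto_zero_of_le_deriv {f f' Φ Φ' : ℝ → ℝ} {a B K : ℝ} (hK : 0 < K)
    (hf : ∀ t, a ≤ t → HasDerivWithinAt f (f' t) (Ici a) t)
    (hΦ : ∀ t, a ≤ t → HasDerivWithinAt Φ (Φ' t) (Ici a) t)
    (hfΦ : ∀ t, a ≤ t → |f' t| ≤ K * Φ' t) (h0 : ∀ t, a ≤ t → 0 ≤ f t)
    (hfK : ∀ t, a ≤ t → f t ≤ K * Φ' t) (hB : ∀ t, a ≤ t → Φ t ≤ B) :
    Tendsto f atTop (𝓝 0) := by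
  have hΦ0 : ∀ t, a ≤ t → 0 ≤ Φ' t := fun t ht => by
    have := (h0 t ht).trans (hfK t ht)
    exact nonneg_of_mul_nonneg_right this hK
  obtain ⟨L, hL, -⟩ := exists_tendsto_of_abs_deriv_le hK.le hf hΦ hfΦ hΦ0 hB
  have hL0 : 0 ≤ L := ge_of_tendsto hL (by
    filter_upwards [eventually_ge_atTop a] with t ht using h0 t ht)
  rcases hL0.eq_or_lt with h | h
  · rwa [h]
  exfalso
  obtain ⟨T, hT⟩ := eventually_atTop.mp (hL.eventually (lt_mem_nhds (half_lt_self h)))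
  have hsub : Ici (max a T) ⊆ Ici a := Ici_subset_Ici.mpr (le_max_left _ _)
  -- A positive limit `L` would keep `Φ'` above `L / (2K)` from some time on, against the
  -- boundedness of `Φ`.
  have := tendsto_atTop_of_le_deriv (f := Φ) (f' := Φ') (a := max a T) (δ := L / 2 / K)
    (by positivity) (fun t ht => (hΦ t (hsub ht)).mono hsub) (fun t ht => by
      rw [div_le_iff₀ hK, mul_comm]
      exact (hT t ((le_max_right _ _).trans ht)).le.trans (hfK t (hsub ht)))
  obtain ⟨t, ht1, ht2⟩ := ((this.eventually_gt_atTop B).and (eventually_ge_atTop a)).exists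
  exact absurd (hB t ht2) (not_le.mpr ht1)

/-! ### Interaction terms -/

/-- The part of `w(xⱼ)` due to the peaks on the left. -/
def leftPart {N : ℕ} (x w : Fin N → ℝ) (j : Fin N) : ℝ :=
  ∑ k, if k < j then w k * Real.exp (-|x j - x k|) else 0

/-- The part of `w(xⱼ)` due to the peaks on the right. -/
def rightPart {N : ℕ} (x w : Fin N → ℝ) (j : Fin N) : ℝ :=
  ∑ k, if j < k then w k * Real.exp (-|x j - x k|) else 0

theorem peakVal_eq_parts {N : ℕ} (x w : Fin N → ℝ) (j : Fin N) :
    peakVal x w j = leftPart x w j + w j + rightPart x w j := by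
  have : w j = ∑ k, if k = j then w k * Real.exp (-|x j - x k|) else 0 := by simp
  rw [this, peakVal, leftPart, rightPart, ← Finset.sum_add_distrib, ← Finset.sum_add_distrib]
  refine Finset.sum_congr rfl fun k _ => ?_
  rcases lt_trichotomy k j with h | h | h
  · simp [h, h.ne, h.not_gt]
  · simp [h]
  · simp [h, h.ne', h.not_gt]

theorem peakSlope_eq_parts {N : ℕ} (x w : Fin N → ℝ) (j : Fin N) :
    peakSlope x w j = leftPart x w j - rightPart x w j := by
  rw [peakSlope, leftPart, rightPart, ← Finset.sum_sub_distrib]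
  refine Finset.sum_congr rfl fun k _ => ?_
  rcases lt_trichotomy k j with h | h | h
  · simp [idxSign, h, h.not_gt]
  · simp [idxSign, h]
  · simp [idxSign, h, h.not_gt]

theorem leftPart_nonneg {N : ℕ} {x w : Fin N → ℝ} (hw : ∀ j, 0 < w j) (j : Fin N) :
    0 ≤ leftPart x w j := Finset.sum_nonneg fun k _ => by
  have := hw k
  split_ifs <;> positivity

theorem rightPart_nonneg {N : ℕ} {x w : Fin N → ℝ} (hw : ∀ j, 0 < w j) (j : Fin N) :
    0 ≤ rightPart x w j := Finset.sum_nonneg fun k _ => by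
  have := hw k
  split_ifs <;> positivity

/-- The interaction strength `nⱼ mₖ Eⱼₖ + mⱼ nₖ Eⱼₖ` of two peaks. -/
def inter {N : ℕ} (x m n : Fin N → ℝ) (j k : Fin N) : ℝ :=
  (n j * m k + m j * n k) * Real.exp (-|x j - x k|)

theorem inter_comm {N : ℕ} (x m n : Fin N → ℝ) (j k : Fin N) :
    inter x m n j k = inter x m n k j := by
  unfold inter; rw [abs_sub_comm]; ring

theorem inter_nonneg {N : ℕ} {x m n : Fin N → ℝ} (hm : ∀ j, 0 < m j) (hn : ∀ j, 0 < n j)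
    (j k : Fin N) : 0 ≤ inter x m n j k := by
  have := hm j; have := hm k; have := hn j; have := hn k
  unfold inter; positivity

/-- The interaction of a peak with the peaks on its left. -/
def interL {N : ℕ} (x m n : Fin N → ℝ) (j : Fin N) : ℝ :=
  ∑ k, if k < j then inter x m n j k else 0

/-- The interaction of a peak with the peaks on its right. -/
def interR {N : ℕ} (x m n : Fin N → ℝ) (j : Fin N) : ℝ :=
  ∑ k, if j < k then inter x m n j k else 0

theorem interL_eq {N : ℕ} (x m n : Fin N → ℝ) (j : Fin N) :
    interL x m n j = n j * leftPart x m j + m j * leftPart x n j := by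
  rw [interL, leftPart, leftPart, Finset.mul_sum, Finset.mul_sum, ← Finset.sum_add_distrib]
  refine Finset.sum_congr rfl fun k _ => ?_
  split_ifs
  · unfold inter; ring
  · ring

theorem interR_eq {N : ℕ} (x m n : Fin N → ℝ) (j : Fin N) :
    interR x m n j = n j * rightPart x m j + m j * rightPart x n j := by
  rw [interR, rightPart, rightPart, Finset.mul_sum, Finset.mul_sum, ← Finset.sum_add_distrib]
  refine Finset.sum_congr rfl fun k _ => ?_
  split_ifs
  · unfold inter; ring
  · ring

theorem interL_nonneg {N : ℕ} {x m n : Fin N → ℝ} (hm : ∀ j, 0 < m j) (hn : ∀ j, 0 < n j)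
    (j : Fin N) : 0 ≤ interL x m n j :=
  Finset.sum_nonneg fun k _ => by split_ifs; exacts [inter_nonneg hm hn _ _, le_rfl]

theorem interR_nonneg {N : ℕ} {x m n : Fin N → ℝ} (hm : ∀ j, 0 < m j) (hn : ∀ j, 0 < n j)
    (j : Fin N) : 0 ≤ interR x m n j :=
  Finset.sum_nonneg fun k _ => by split_ifs; exacts [inter_nonneg hm hn _ _, le_rfl]

/-- The triangle inequality gives `Eⱼᵢ Eⱼₖ ≤ Eᵢₖ`, so the expanded velocity is bounded by the energy
term by term. -/
theorem peakVal_mul_peakVal_le_energy {N : ℕ} {x m n : Fin N → ℝ} (hm : ∀ j, 0 < m j)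
    (hn : ∀ j, 0 < n j) (j : Fin N) : peakVal x m j * peakVal x n j ≤ energy x m n := by
  rw [peakVal, peakVal, Finset.sum_mul_sum, energy]
  refine Finset.sum_le_sum fun i _ => Finset.sum_le_sum fun k _ => ?_
  have h1 : Real.exp (-|x j - x i|) * Real.exp (-|x j - x k|) ≤ Real.exp (-|x i - x k|) := by
    rw [← Real.exp_add]
    refine Real.exp_le_exp.mpr ?_
    have := abs_sub_le (x i) (x j) (x k)
    rw [abs_sub_comm (x i) (x j)] at this
    linarith
  have := mul_le_mul_of_nonneg_left h1 (mul_pos (hm i) (hn k)).le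
  linarith

/-- The time derivative of `mⱼ nⱼ`. -/
def mulDeriv {N : ℕ} (x m n : Fin N → ℝ) (j : Fin N) : ℝ :=
  m j * peakSlope x m j * peakVal x n j * n j + m j * (n j * peakSlope x n j * peakVal x m j)

theorem parts_mul_le_energy {N : ℕ} {x m n : Fin N → ℝ} (hm : ∀ j, 0 < m j)
    (hn : ∀ j, 0 < n j) (j : Fin N) :
    m j * (leftPart x n j + rightPart x n j) ≤ energy x m n := by
  have h := peakVal_mul_peakVal_le_energy (x := x) hm hn j
  rw [peakVal_eq_parts, peakVal_eq_parts] at h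
  have := hm j; have := hn j
  have := leftPart_nonneg (x := x) hm j; have := leftPart_nonneg (x := x) hn j
  have := rightPart_nonneg (x := x) hm j; have := rightPart_nonneg (x := x) hn j
  refine le_trans ?_ h
  refine mul_le_mul ?_ ?_ ?_ ?_ <;> linarith

/-- Peaks on the left increase `mⱼ nⱼ` and peaks on the right decrease it. The part linear in the
interactions has coefficient `mⱼ nⱼ`, between `c` and `H`. The quadratic part costs at most another
`2H`, whence the factor `3H`. -/
theorem mulDeriv_bounds {N : ℕ} {x m n : Fin N → ℝ} {c H : ℝ} (hm : ∀ j, 0 < m j)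
    (hn : ∀ j, 0 < n j) (hH : energy x m n = H) (j : Fin N) (hc : c ≤ m j * n j) :
    c * interL x m n j - 3 * H * interR x m n j ≤ mulDeriv x m n j ∧
    mulDeriv x m n j ≤ 3 * H * interL x m n j - c * interR x m n j := by
  have h1 := parts_mul_le_energy (x := x) hm hn j
  have h2 := mul_le_energy (x := x) hm hn j
  rw [hH] at h1 h2
  rw [mulDeriv, interL_eq, interR_eq, peakVal_eq_parts, peakVal_eq_parts, peakSlope_eq_parts,
    peakSlope_eq_parts]
  have hmj := hm j; have hnj := hn j
  have hA := leftPart_nonneg (x := x) hm j; have hC := leftPart_nonneg (x := x) hn j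
  have hB := rightPart_nonneg (x := x) hm j; have hD := rightPart_nonneg (x := x) hn j
  generalize leftPart x m j = A at *
  generalize leftPart x n j = C at *
  generalize rightPart x m j = B at *
  generalize rightPart x n j = D at *
  generalize m j = a at *
  generalize n j = b at *
  have hmC : a * C ≤ H := by nlinarith
  have hmD : a * D ≤ H := by nlinarith
  have e1 : (b * A) * (a * C) ≤ (b * A) * H := mul_le_mul_of_nonneg_left hmC (by positivity)
  have e2 : (b * B) * (a * D) ≤ (b * B) * H := mul_le_mul_of_nonneg_left hmD (by positivity)
  have hl : 0 ≤ b * A + a * C := by positivity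
  have hr : 0 ≤ b * B + a * D := by positivity
  have e3 : c * (b * A + a * C) ≤ (a * b) * (b * A + a * C) := mul_le_mul_of_nonneg_right hc hl
  have e4 : c * (b * B + a * D) ≤ (a * b) * (b * B + a * D) := mul_le_mul_of_nonneg_right hc hr
  have e5 : (a * b) * (b * A + a * C) ≤ H * (b * A + a * C) := mul_le_mul_of_nonneg_right h2 hl
  have e6 : (a * b) * (b * B + a * D) ≤ H * (b * B + a * D) := mul_le_mul_of_nonneg_right h2 hr
  have hH0 : 0 ≤ H := by nlinarith
  have e7 : 0 ≤ H * (a * C) := by positivity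
  have e8 : 0 ≤ H * (a * D) := by positivity
  have e9 : 0 ≤ (b * A) * (a * C) := by positivity
  have e10 : 0 ≤ (b * B) * (a * D) := by positivity
  have key : a * (A - B) * (C + b + D) * b + a * (b * (C - D) * (A + a + B)) =
      2 * ((b * A) * (a * C)) - 2 * ((b * B) * (a * D)) +
        (a * b) * (b * A + a * C) - (a * b) * (b * B + a * D) := by ring
  rw [key]
  constructor <;> linarith

/-- Apart from the main term `mⱼ nⱼ` of the velocity, everything is bounded by the interactions.
Products of two outside contributions are reduced to a single interaction through `mⱼ nⱼ ≥ c` and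
the energy bound, at the price of the factor `H / c`. -/
theorem abs_rate_le {N : ℕ} {x m n : Fin N → ℝ} {c H : ℝ} (hm : ∀ j, 0 < m j)
    (hn : ∀ j, 0 < n j) (hH : energy x m n = H) (j : Fin N) (hc0 : 0 < c)
    (hc : c ≤ m j * n j) :
    |peakSlope x m j * peakVal x n j| ≤ (1 + H / c) * (interL x m n j + interR x m n j) ∧
    |peakSlope x n j * peakVal x m j| ≤ (1 + H / c) * (interL x m n j + interR x m n j) ∧
    m j * n j ≤ peakVal x m j * peakVal x n j ∧
    peakVal x m j * peakVal x n j ≤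
      m j * n j + (1 + H / c) * (interL x m n j + interR x m n j) := by
  have h1 := parts_mul_le_energy (x := x) hm hn j
  rw [hH] at h1
  rw [interL_eq, interR_eq, peakVal_eq_parts, peakVal_eq_parts, peakSlope_eq_parts,
    peakSlope_eq_parts]
  have hmj := hm j; have hnj := hn j
  have hA := leftPart_nonneg (x := x) hm j; have hC := leftPart_nonneg (x := x) hn j
  have hB := rightPart_nonneg (x := x) hm j; have hD := rightPart_nonneg (x := x) hn j
  generalize leftPart x m j = A at *
  generalize leftPart x n j = C at *
  generalize rightPart x m j = B at *
  generalize rightPart x n j = D at *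
  generalize m j = a at *
  generalize n j = b at *
  have hprod : (A + B) * (C + D) ≤ H / c * (b * (A + B)) := by
    rw [div_mul_eq_mul_div, le_div_iff₀ hc0]
    calc (A + B) * (C + D) * c ≤ (A + B) * (C + D) * (a * b) := by gcongr
      _ = (a * (C + D)) * (b * (A + B)) := by ring
      _ ≤ H * (b * (A + B)) := by gcongr
  have hHc : 0 ≤ H / c := div_nonneg (by nlinarith [mul_nonneg hmj.le (add_nonneg hC hD)]) hc0.le
  have e1 : 0 ≤ H / c * (a * (C + D)) := by positivity
  have hAB : |A - B| ≤ A + B := abs_le.mpr ⟨by linarith, by linarith⟩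
  have hCD : |C - D| ≤ C + D := abs_le.mpr ⟨by linarith, by linarith⟩
  have h0 : 0 ≤ a * (C + D) := by positivity
  have h0' : 0 ≤ b * (A + B) := by positivity
  have h0'' : 0 ≤ (A + B) * (C + D) := by positivity
  refine ⟨?_, ?_, ?_, ?_⟩
  · rw [abs_mul, abs_of_nonneg (show 0 ≤ C + b + D by positivity)]
    have := mul_le_mul_of_nonneg_right hAB (show 0 ≤ C + b + D by positivity)
    linarith
  · rw [abs_mul, abs_of_nonneg (show 0 ≤ A + a + B by positivity)]
    have := mul_le_mul_of_nonneg_right hCD (show 0 ≤ A + a + B by positivity)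
    linarith
  · linarith
  · linarith

theorem sum_interR_eq {N : ℕ} (x m n : Fin N → ℝ) (g : Fin N → ℝ) :
    ∑ j, g j * interR x m n j = ∑ j, ∑ k, if k < j then g k * inter x m n j k else 0 := by
  simp only [interR, Finset.mul_sum, mul_ite, mul_zero]
  rw [Finset.sum_comm]
  refine Finset.sum_congr rfl fun j _ => Finset.sum_congr rfl fun k _ => ?_
  rw [inter_comm]

/-- A weighted sum of the `mⱼ nⱼ` grows at least as fast as the total interaction. -/
theorem exists_weight {N : ℕ} {c H : ℝ} (hc : 0 < c) (hH : 0 ≤ H) :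
    ∃ g : Fin N → ℝ, (∀ j, 0 < g j) ∧ ∀ x m n : Fin N → ℝ, (∀ j, 0 < m j) → (∀ j, 0 < n j) →
      energy x m n = H → (∀ j, c ≤ m j * n j) →
      c / 2 * ∑ j, (interL x m n j + interR x m n j) ≤ ∑ j, g j * mulDeriv x m n j := by
  -- The choice is `c w = c + 3H`. With weights `w ^ j`, a pair `k < j` gains `c w ^ j` at `j` and
  -- loses `3H w ^ k` at `k`, a net gain of at least `c`. The final constant is `c / 2` because each
  -- pair appears in both `interL` and `interR`.
  set w := 1 + 3 * H / c with hw
  have hw1 : 1 ≤ w := by rw [hw]; have : 0 ≤ 3 * H / c := by positivity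
                         linarith
  have hcw : c * w = c + 3 * H := by rw [hw]; field_simp
  refine ⟨fun j => w ^ j.val, fun j => by positivity, fun x m n hm hn hE hp => ?_⟩
  have hsum : ∑ j, interR x m n j = ∑ j, interL x m n j := by
    have := sum_interR_eq x m n (fun _ => 1)
    simpa [interL] using this
  rw [Finset.sum_add_distrib, hsum]
  calc c / 2 * (∑ j, interL x m n j + ∑ j, interL x m n j) = ∑ j, c * interL x m n j := by
        rw [← Finset.mul_sum]; ring
    _ ≤ ∑ j, (w ^ j.val * (c * interL x m n j)) - ∑ j, (w ^ j.val * (3 * H)) * interR x m n j := by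
        rw [sum_interR_eq, ← Finset.sum_sub_distrib]
        refine Finset.sum_le_sum fun j _ => ?_
        rw [interL, Finset.mul_sum, Finset.mul_sum, ← Finset.sum_sub_distrib]
        refine Finset.sum_le_sum fun k _ => ?_
        by_cases hkj : k < j
        · simp only [hkj, if_true]
          have h1 : w ^ (k.val + 1) ≤ w ^ j.val := pow_le_pow_right₀ hw1 hkj
          have h2 : 1 ≤ w ^ k.val := one_le_pow₀ hw1
          have h3 : c ≤ w ^ j.val * c - w ^ k.val * (3 * H) := by
            have h4 : w ^ (k.val + 1) * c = w ^ k.val * (c + 3 * H) := by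
              rw [pow_succ, ← hcw]; ring
            nlinarith [mul_le_mul_of_nonneg_right h1 hc.le]
          have := mul_le_mul_of_nonneg_right h3 (inter_nonneg (x := x) hm hn j k)
          linarith
        · simp [hkj]
    _ ≤ _ := by
        rw [← Finset.sum_sub_distrib]
        refine Finset.sum_le_sum fun j _ => ?_
        have := mul_le_mul_of_nonneg_left (mulDeriv_bounds hm hn hE j (hp j)).1
          (show 0 ≤ w ^ j.val by positivity)
        linarith


/-! ### Scattering -/

section Scattering

variable {N : ℕ} {x m n : ℝ → Fin N → ℝ}

/-- The velocity of a peak. -/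
def vel (x m n : ℝ → Fin N → ℝ) (t : ℝ) (j : Fin N) : ℝ :=
  peakVal (x t) (m t) j * peakVal (x t) (n t) j

theorem IsScaledFlow.hasDeriv_x (h : IsScaledFlow (fun _ => 1) x m n) {t : ℝ} (ht : 0 ≤ t)
    (j : Fin N) : HasDerivWithinAt (fun τ => x τ j) (vel x m n t j) (Ici 0) t := by
  simpa [vel] using h.deriv_x t ht j

theorem IsScaledFlow.hasDeriv_mul (h : IsScaledFlow (fun _ => 1) x m n) {t : ℝ} (ht : 0 ≤ t)
    (j : Fin N) : HasDerivWithinAt (fun τ => m τ j * n τ j) (mulDeriv (x t) (m t) (n t) j)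
      (Ici 0) t := by
  refine ((h.deriv_m t ht j).mul (h.deriv_n t ht j)).congr_deriv ?_
  simp [mulDeriv]

theorem IsScaledFlow.hasDeriv_log_m (h : IsScaledFlow (fun _ => 1) x m n) {t : ℝ} (ht : 0 ≤ t)
    (j : Fin N) : HasDerivWithinAt (fun τ => Real.log (m τ j))
      (peakSlope (x t) (m t) j * peakVal (x t) (n t) j) (Ici 0) t := by
  have h0 := (h.m_pos t ht j).ne'
  refine ((h.deriv_m t ht j).log h0).congr_deriv ?_
  field_simp

theorem IsScaledFlow.hasDeriv_log_n (h : IsScaledFlow (fun _ => 1) x m n) {t : ℝ} (ht : 0 ≤ t)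
    (j : Fin N) : HasDerivWithinAt (fun τ => Real.log (n τ j))
      (peakSlope (x t) (n t) j * peakVal (x t) (m t) j) (Ici 0) t := by
  have h0 := (h.n_pos t ht j).ne'
  refine ((h.deriv_n t ht j).log h0).congr_deriv ?_
  field_simp

theorem IsScaledFlow.hasDeriv_exp_gap (h : IsScaledFlow (fun _ => 1) x m n) {t : ℝ} (ht : 0 ≤ t)
    (j k : Fin N) : HasDerivWithinAt (fun τ => Real.exp (x τ j - x τ k))
      (Real.exp (x t j - x t k) * (vel x m n t j - vel x m n t k)) (Ici 0) t :=
  ((h.hasDeriv_x ht j).sub (h.hasDeriv_x ht k)).exp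

theorem exp_neg_abs_eq_of_lt {x : Fin N → ℝ} (hx : StrictMono x) {j k : Fin N} (hjk : j < k) :
    Real.exp (-|x j - x k|) = Real.exp (x j - x k) := by
  rw [abs_of_neg (sub_neg.mpr (hx hjk)), neg_neg]

theorem inter_le_interR {x m n : Fin N → ℝ} (hm : ∀ j, 0 < m j) (hn : ∀ j, 0 < n j)
    {j k : Fin N} (hjk : j < k) : inter x m n j k ≤ interR x m n j := by
  have := Finset.single_le_sum (f := fun k => if j < k then inter x m n j k else 0)
    (fun k _ => by split_ifs; exacts [inter_nonneg hm hn _ _, le_rfl]) (Finset.mem_univ k)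
  simp only [hjk, if_true] at this
  exact this

theorem inter_le_interL {x m n : Fin N → ℝ} (hm : ∀ j, 0 < m j) (hn : ∀ j, 0 < n j)
    {j k : Fin N} (hjk : k < j) : inter x m n j k ≤ interL x m n j := by
  have := Finset.single_le_sum (f := fun k => if k < j then inter x m n j k else 0)
    (fun k _ => by split_ifs; exacts [inter_nonneg hm hn _ _, le_rfl]) (Finset.mem_univ k)
  simp only [hjk, if_true] at this
  exact this

theorem mul_exp_le_inter {x m n : Fin N → ℝ} (hm : ∀ j, 0 < m j) (hn : ∀ j, 0 < n j)
    (j k : Fin N) : n j * m k * Real.exp (-|x j - x k|) ≤ inter x m n j k := by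
  have := hm j; have := hn k
  unfold inter
  gcongr
  have : 0 ≤ m j * n k := by positivity
  linarith

/-- A flow whose momenta converge and whose peaks separate, with its energy `H` and
a lower bound `c` for the products `mⱼ nⱼ`. -/
structure IsScattering (x m n : ℝ → Fin N → ℝ) (minf ninf : Fin N → ℝ) (c H : ℝ) : Prop where
  flow : IsScaledFlow (fun _ => 1) x m n
  c_pos : 0 < c
  H_nonneg : 0 ≤ H
  energy_eq : ∀ t, 0 ≤ t → energy (x t) (m t) (n t) = H
  le_mul : ∀ t, 0 ≤ t → ∀ j, c ≤ m t j * n t j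
  minf_pos : ∀ j, 0 < minf j
  ninf_pos : ∀ j, 0 < ninf j
  tendsto_m : ∀ j, Tendsto (fun t => m t j) atTop (𝓝 (minf j))
  tendsto_n : ∀ j, Tendsto (fun t => n t j) atTop (𝓝 (ninf j))
  tendsto_gap : ∀ j k, j < k → Tendsto (fun t => Real.exp (x t j - x t k)) atTop (𝓝 0)

theorem tendsto_exp_of_tendsto_log {f : ℝ → ℝ} (hf : ∀ t, 0 ≤ t → 0 < f t) {L : ℝ}
    (h : Tendsto (fun t => Real.log (f t)) atTop (𝓝 L)) : Tendsto f atTop (𝓝 (Real.exp L)) := by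
  refine ((Real.continuous_exp.tendsto L).comp h).congr' ?_
  filter_upwards [eventually_ge_atTop 0] with t ht
  exact Real.exp_log (hf t ht)

/-- The weighted sum `Φ` is bounded by the energy, and its derivative dominates the interactions,
hence also the rates of `log mⱼ` and `log nⱼ`. Convergence of the logarithms makes the limits
positive. Once the momenta are close to their limits, `Φ'` also dominates the exponentials of the
gaps. -/
theorem IsScaledFlow.exists_isScattering (h : IsScaledFlow (fun _ => 1) x m n) :
    ∃ minf ninf c H, IsScattering x m n minf ninf c H := by
  obtain ⟨c, hc, hcm⟩ := h.exists_le_mul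
  set H := energy (x 0) (m 0) (n 0) with hHdef
  have hE : ∀ t, 0 ≤ t → energy (x t) (m t) (n t) = H := fun t ht => h.energy_eq ht
  have hH : 0 ≤ H := Finset.sum_nonneg fun j _ => Finset.sum_nonneg fun k _ => by
    have := h.m_pos 0 le_rfl j; have := h.n_pos 0 le_rfl k; positivity
  obtain ⟨g, hg, hgI⟩ := exists_weight (N := N) hc hH
  set Φ : ℝ → ℝ := fun t => ∑ j, g j * (m t j * n t j)
  set Φ' : ℝ → ℝ := fun t => ∑ j, g j * mulDeriv (x t) (m t) (n t) j
  have hΦ : ∀ t, 0 ≤ t → HasDerivWithinAt Φ (Φ' t) (Ici 0) t := fun t ht =>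
    HasDerivWithinAt.fun_sum fun j _ => (h.hasDeriv_mul ht j).const_mul (g j)
  have hB : ∀ t, 0 ≤ t → Φ t ≤ ∑ j, g j * H := fun t ht =>
    Finset.sum_le_sum fun j _ => mul_le_mul_of_nonneg_left
      ((mul_le_energy (h.m_pos t ht) (h.n_pos t ht) j).trans (hE t ht).le) (hg j).le
  have hnn : ∀ t, 0 ≤ t → ∀ j, 0 ≤ interL (x t) (m t) (n t) j + interR (x t) (m t) (n t) j :=
    fun t ht j => add_nonneg (interL_nonneg (h.m_pos t ht) (h.n_pos t ht) j)
      (interR_nonneg (h.m_pos t ht) (h.n_pos t ht) j)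
  have hI : ∀ t, 0 ≤ t → ∀ j, interL (x t) (m t) (n t) j + interR (x t) (m t) (n t) j ≤
      2 / c * Φ' t := by
    intro t ht j
    have h1 := hgI (x t) (m t) (n t) (h.m_pos t ht) (h.n_pos t ht) (hE t ht) (hcm t ht)
    have h2 := Finset.single_le_sum (fun j _ => hnn t ht j) (Finset.mem_univ j)
    calc _ ≤ _ := h2
      _ = 2 / c * (c / 2 * ∑ j, (interL (x t) (m t) (n t) j + interR (x t) (m t) (n t) j)) := by
          field_simp
      _ ≤ _ := mul_le_mul_of_nonneg_left h1 (by positivity)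
  have hK : 0 ≤ (1 + H / c) * (2 / c) := by positivity
  have hK' : ∀ t, 0 ≤ t → ∀ j, (1 + H / c) *
      (interL (x t) (m t) (n t) j + interR (x t) (m t) (n t) j) ≤
      (1 + H / c) * (2 / c) * Φ' t := fun t ht j => by
    rw [mul_assoc]; exact mul_le_mul_of_nonneg_left (hI t ht j) (by positivity)
  have hrate := fun t (ht : 0 ≤ t) j =>
    abs_rate_le (h.m_pos t ht) (h.n_pos t ht) (hE t ht) j hc (hcm t ht j)
  have hm : ∀ j, ∃ L, 0 < L ∧ Tendsto (fun t => m t j) atTop (𝓝 L) := by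
    intro j
    have hΦ0 : ∀ t, 0 ≤ t → 0 ≤ Φ' t := fun t ht =>
      nonneg_of_mul_nonneg_right ((hnn t ht j).trans (hI t ht j)) (by positivity)
    obtain ⟨L, hL, -⟩ := exists_tendsto_of_abs_deriv_le hK (fun t ht => h.hasDeriv_log_m ht j) hΦ
      (fun t ht => (hrate t ht j).1.trans (hK' t ht j)) hΦ0 hB
    exact ⟨_, Real.exp_pos L, tendsto_exp_of_tendsto_log (fun t ht => h.m_pos t ht j) hL⟩
  have hn : ∀ j, ∃ L, 0 < L ∧ Tendsto (fun t => n t j) atTop (𝓝 L) := by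
    intro j
    have hΦ0 : ∀ t, 0 ≤ t → 0 ≤ Φ' t := fun t ht =>
      nonneg_of_mul_nonneg_right ((hnn t ht j).trans (hI t ht j)) (by positivity)
    obtain ⟨L, hL, -⟩ := exists_tendsto_of_abs_deriv_le hK (fun t ht => h.hasDeriv_log_n ht j) hΦ
      (fun t ht => (hrate t ht j).2.1.trans (hK' t ht j)) hΦ0 hB
    exact ⟨_, Real.exp_pos L, tendsto_exp_of_tendsto_log (fun t ht => h.n_pos t ht j) hL⟩
  choose minf hminf hmt using hm
  choose ninf hninf hnt using hn
  refine ⟨minf, ninf, c, H, h, hc, hH, hE, hcm, hminf, hninf, hmt, hnt, fun j k hjk => ?_⟩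
  -- Half the limit of `nⱼ mₖ`: eventually the interaction is at least `q` times the exponential of
  -- the gap. The factor `1 + H` used below covers that exponential together with its derivative, as
  -- velocities lie in `[0, H]`.
  set q := ninf j * minf k / 2 with hq
  have hqpos : 0 < q := by have := hninf j; have := hminf k; positivity
  have hlim : Tendsto (fun t => n t j * m t k) atTop (𝓝 (ninf j * minf k)) :=
    (hnt j).mul (hmt k)
  have hlt : q < ninf j * minf k := by rw [hq] at *; linarith
  obtain ⟨T, hT⟩ := eventually_atTop.mp (hlim.eventually (lt_mem_nhds hlt))
  have hsub : Ici (max 0 T) ⊆ Ici (0 : ℝ) := Ici_subset_Ici.mpr (le_max_left _ _)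
  have hbound : ∀ t, max 0 T ≤ t → Real.exp (x t j - x t k) ≤ 2 / c / q * Φ' t := by
    intro t ht
    have ht0 : 0 ≤ t := hsub ht
    have h1 := (mul_exp_le_inter (x := x t) (h.m_pos t ht0) (h.n_pos t ht0) j k).trans
      (inter_le_interR (h.m_pos t ht0) (h.n_pos t ht0) hjk)
    rw [exp_neg_abs_eq_of_lt (h.strictMono t ht0) hjk] at h1
    have h2 := hI t ht0 j
    have h3 := interL_nonneg (x := x t) (h.m_pos t ht0) (h.n_pos t ht0) j
    have h4 := mul_le_mul_of_nonneg_right (hT t ((le_max_right _ _).trans ht)).le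
      (Real.exp_pos (x t j - x t k)).le
    rw [div_mul_eq_mul_div, le_div_iff₀ hqpos]
    linarith
  have hV : ∀ t, 0 ≤ t → ∀ j, 0 ≤ vel x m n t j ∧ vel x m n t j ≤ H := fun t ht j =>
    ⟨(mul_pos (h.m_pos t ht j) (h.n_pos t ht j)).le.trans (hrate t ht j).2.2.1,
      (peakVal_mul_peakVal_le_energy (h.m_pos t ht) (h.n_pos t ht) j).trans (hE t ht).le⟩
  have hKpos : 0 < (1 + H) * (2 / c / q) := by positivity
  have hle : ∀ t, max 0 T ≤ t → (1 + H) * Real.exp (x t j - x t k) ≤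
      (1 + H) * (2 / c / q) * Φ' t := fun t ht => by
    rw [mul_assoc]; exact mul_le_mul_of_nonneg_left (hbound t ht) (by positivity)
  refine tendsto_zero_of_le_deriv (a := max 0 T) hKpos
    (fun t ht => (h.hasDeriv_exp_gap (hsub ht) j k).mono hsub)
    (fun t ht => (hΦ t (hsub ht)).mono hsub) (fun t ht => ?_) (fun t _ => (Real.exp_pos _).le)
    (fun t ht => ?_) (fun t ht => hB t (hsub ht))
  · refine le_trans ?_ (hle t ht)
    have h1 := hV t (hsub ht) j
    have h2 := hV t (hsub ht) k
    rw [abs_mul, abs_of_pos (Real.exp_pos _), mul_comm]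
    refine mul_le_mul_of_nonneg_right (abs_le.mpr ⟨?_, ?_⟩) (Real.exp_pos _).le <;> linarith
  · refine le_trans ?_ (hle t ht)
    have := Real.exp_pos (x t j - x t k)
    nlinarith

namespace IsScattering

variable {minf ninf : Fin N → ℝ} {c H : ℝ}

theorem tendsto_exp_neg_abs (h : IsScattering x m n minf ninf c H) {j k : Fin N} (hjk : j ≠ k) :
    Tendsto (fun t => Real.exp (-|x t j - x t k|)) atTop (𝓝 0) := by
  rcases hjk.lt_or_gt with hlt | hlt
  · refine (h.tendsto_gap j k hlt).congr' ?_
    filter_upwards [eventually_ge_atTop 0] with t ht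
    rw [exp_neg_abs_eq_of_lt (h.flow.strictMono t ht) hlt]
  · refine (h.tendsto_gap k j hlt).congr' ?_
    filter_upwards [eventually_ge_atTop 0] with t ht
    rw [abs_sub_comm, exp_neg_abs_eq_of_lt (h.flow.strictMono t ht) hlt]

theorem tendsto_coef (h : IsScattering x m n minf ninf c H) (j k : Fin N) :
    Tendsto (fun t => n t j * m t k + m t j * n t k) atTop
      (𝓝 (ninf j * minf k + minf j * ninf k)) :=
  ((h.tendsto_n j).mul (h.tendsto_m k)).add ((h.tendsto_m j).mul (h.tendsto_n k))

theorem tendsto_inter (h : IsScattering x m n minf ninf c H) {j k : Fin N} (hjk : j ≠ k) :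
    Tendsto (fun t => inter (x t) (m t) (n t) j k) atTop (𝓝 0) := by
  simpa [inter] using (h.tendsto_coef j k).mul (h.tendsto_exp_neg_abs hjk)

theorem tendsto_interL_add_interR (h : IsScattering x m n minf ninf c H) (j : Fin N) :
    Tendsto (fun t => interL (x t) (m t) (n t) j + interR (x t) (m t) (n t) j) atTop (𝓝 0) := by
  have hL : Tendsto (fun t => interL (x t) (m t) (n t) j) atTop (𝓝 (∑ _k : Fin N, 0)) :=
    tendsto_finsetSum _ fun k _ => by
      split_ifs with hk
      · exact h.tendsto_inter hk.ne'
      · exact tendsto_const_nhds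
  have hR : Tendsto (fun t => interR (x t) (m t) (n t) j) atTop (𝓝 (∑ _k : Fin N, 0)) :=
    tendsto_finsetSum _ fun k _ => by
      split_ifs with hk
      · exact h.tendsto_inter hk.ne
      · exact tendsto_const_nhds
  simpa using hL.add hR

theorem tendsto_mul (h : IsScattering x m n minf ninf c H) (j : Fin N) :
    Tendsto (fun t => m t j * n t j) atTop (𝓝 (minf j * ninf j)) :=
  (h.tendsto_m j).mul (h.tendsto_n j)

theorem vel_bounds (h : IsScattering x m n minf ninf c H) {t : ℝ} (ht : 0 ≤ t) (j : Fin N) :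
    m t j * n t j ≤ vel x m n t j ∧ vel x m n t j ≤ m t j * n t j +
      (1 + H / c) * (interL (x t) (m t) (n t) j + interR (x t) (m t) (n t) j) :=
  (abs_rate_le (h.flow.m_pos t ht) (h.flow.n_pos t ht) (h.energy_eq t ht) j h.c_pos
    (h.le_mul t ht j)).2.2

theorem tendsto_vel (h : IsScattering x m n minf ninf c H) (j : Fin N) :
    Tendsto (fun t => vel x m n t j) atTop (𝓝 (minf j * ninf j)) := by
  have hub := (h.tendsto_mul j).add ((h.tendsto_interL_add_interR j).const_mul (1 + H / c))
  rw [mul_zero, add_zero] at hub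
  refine tendsto_of_tendsto_of_tendsto_of_le_of_le' (h.tendsto_mul j) hub ?_ ?_
  · filter_upwards [eventually_ge_atTop 0] with t ht using (h.vel_bounds ht j).1
  · filter_upwards [eventually_ge_atTop 0] with t ht using (h.vel_bounds ht j).2

/-- Three positions are allowed so that two gaps can be compared through their difference. -/
theorem tendsto_comb (h : IsScattering x m n minf ninf c H) (α β γ : ℝ) (i j k : Fin N)
    (hpos : 0 < α * (minf i * ninf i) + β * (minf j * ninf j) + γ * (minf k * ninf k)) :
    Tendsto (fun t => α * x t i + β * x t j + γ * x t k) atTop atTop := by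
  have hlim := (((h.tendsto_vel i).const_mul α).add ((h.tendsto_vel j).const_mul β)).add
    ((h.tendsto_vel k).const_mul γ)
  obtain ⟨T, hT⟩ := eventually_atTop.mp (hlim.eventually (lt_mem_nhds (half_lt_self hpos)))
  have hsub : Ici (max 0 T) ⊆ Ici (0 : ℝ) := Ici_subset_Ici.mpr (le_max_left _ _)
  exact tendsto_atTop_of_le_deriv (half_pos hpos)
    (fun t ht => ((((h.flow.hasDeriv_x (hsub ht) i).const_mul α).add
      ((h.flow.hasDeriv_x (hsub ht) j).const_mul β)).add
      ((h.flow.hasDeriv_x (hsub ht) k).const_mul γ)).mono hsub)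
    (fun t ht => (hT t ((le_max_right _ _).trans ht)).le)

/-- A peak with a larger limiting speed would overtake those ahead of it. -/
theorem monotone_mul (h : IsScattering x m n minf ninf c H) :
    Monotone fun j => minf j * ninf j := by
  intro j k hjk
  rcases hjk.eq_or_lt with rfl | hlt
  · exact le_rfl
  by_contra hlt'
  have hlt' : minf k * ninf k < minf j * ninf j := not_le.mp hlt'
  have := h.tendsto_comb 1 (-1) 0 j k k (by linarith)
  obtain ⟨t, ht1, ht2⟩ := ((this.eventually_gt_atTop 0).and (eventually_ge_atTop 0)).exists
  have := h.flow.strictMono t ht2 hlt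
  linarith

/-- The interaction with the right is negligible against that with a neighbour of
the same asymptotic speed on the left. -/
theorem tendsto_interR_div (h : IsScattering x m n minf ninf c H) {b l : Fin N}
    (hl : minf l * ninf l = minf b * ninf b)
    (hb : ∀ k, b < k → minf b * ninf b < minf k * ninf k) :
    Tendsto (fun t => interR (x t) (m t) (n t) b / Real.exp (x t l - x t b)) atTop (𝓝 0) := by
  have hsum : Tendsto (fun t => ∑ k, if b < k then
      (n t b * m t k + m t b * n t k) * Real.exp (-(1 * x t k + (-2) * x t b + 1 * x t l)) else 0)
      atTop (𝓝 (∑ _k : Fin N, 0)) := by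
    refine tendsto_finsetSum _ fun k _ => ?_
    split_ifs with hk
    -- The combination is the gap from `b` to `k` minus the gap from `l` to `b`. Since `l` and `b`
    -- have equal limiting speeds, it grows at the speed of `k` relative to `b`.
    · have h1 := h.tendsto_comb 1 (-2) 1 k b l (by have := hb k hk; linarith)
      simpa using (h.tendsto_coef b k).mul
        (Real.tendsto_exp_neg_atTop_nhds_zero.comp h1)
    · exact tendsto_const_nhds
  rw [Finset.sum_const_zero] at hsum
  refine hsum.congr' ?_
  filter_upwards [eventually_ge_atTop 0] with t ht
  rw [interR, Finset.sum_div]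
  refine Finset.sum_congr rfl fun k _ => ?_
  split_ifs with hk
  · rw [inter, exp_neg_abs_eq_of_lt (h.flow.strictMono t ht) hk, mul_div_assoc, ← Real.exp_sub]
    ring_nf
  · simp

/-- The mirror image: slower peaks behind `a` fall away at a positive rate, while the gap between
`a` and `l` has limiting rate zero. -/
theorem tendsto_interL_div (h : IsScattering x m n minf ninf c H) {a l : Fin N}
    (hl : minf l * ninf l = minf a * ninf a)
    (ha : ∀ k, k < a → minf k * ninf k < minf a * ninf a) :
    Tendsto (fun t => interL (x t) (m t) (n t) a / Real.exp (x t a - x t l)) atTop (𝓝 0) := by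
  have hsum : Tendsto (fun t => ∑ k, if k < a then
      (n t a * m t k + m t a * n t k) * Real.exp (-((-1) * x t k + 2 * x t a + (-1) * x t l)) else 0)
      atTop (𝓝 (∑ _k : Fin N, 0)) := by
    refine tendsto_finsetSum _ fun k _ => ?_
    split_ifs with hk
    · have h1 := h.tendsto_comb (-1) 2 (-1) k a l (by have := ha k hk; linarith)
      simpa using (h.tendsto_coef a k).mul
        (Real.tendsto_exp_neg_atTop_nhds_zero.comp h1)
    · exact tendsto_const_nhds
  rw [Finset.sum_const_zero] at hsum
  refine hsum.congr' ?_
  filter_upwards [eventually_ge_atTop 0] with t ht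
  rw [interL, Finset.sum_div]
  refine Finset.sum_congr rfl fun k _ => ?_
  split_ifs with hk
  · rw [inter, abs_sub_comm, exp_neg_abs_eq_of_lt (h.flow.strictMono t ht) hk, mul_div_assoc,
      ← Real.exp_sub]
    ring_nf
  · simp

/-- The leading peak of a group with equal asymptotic speeds is eventually
not faster than its limit. -/
theorem eventually_vel_le (h : IsScattering x m n minf ninf c H) {b l : Fin N} (hlb : l < b)
    (hpred : ∀ k, k < b → k ≤ l) (hl : minf l * ninf l = minf b * ninf b)
    (hb : ∀ k, b < k → minf b * ninf b < minf k * ninf k) :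
    ∀ᶠ t in atTop, vel x m n t b ≤ minf b * ninf b := by
  set ε : ℝ → ℝ := fun t => Real.exp (x t l - x t b)
  set S : ℝ := ∑ k, (ninf b * minf k + minf b * ninf k)
  -- `C ε` bounds the excess of the velocity over `m n` at `b`: eventually the left interaction is
  -- at most `(S + 1) ε`, because `l` is the immediate predecessor, and the right one at most `ε`.
  set C : ℝ := (1 + H / c) * (S + 2)
  have hHc : 0 ≤ 1 + H / c := by have := h.c_pos; have := h.H_nonneg; positivity
  have hR := h.tendsto_interR_div hl hb
  have hS : Tendsto (fun t => ∑ k, (n t b * m t k + m t b * n t k)) atTop (𝓝 S) :=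
    tendsto_finsetSum _ fun k _ => h.tendsto_coef b k
  have hbr : Tendsto (fun t => c * (n t b * m t l) -
      3 * H * (interR (x t) (m t) (n t) b / ε t) + C * (vel x m n t l - vel x m n t b)) atTop
      (𝓝 (c * (ninf b * minf l) - 3 * H * 0 +
        C * (minf l * ninf l - minf b * ninf b))) :=
    ((((h.tendsto_n b).mul (h.tendsto_m l)).const_mul c).sub (hR.const_mul (3 * H))).add
      (((h.tendsto_vel l).sub (h.tendsto_vel b)).const_mul C)
  have hbr0 : 0 < c * (ninf b * minf l) - 3 * H * 0 +
      C * (minf l * ninf l - minf b * ninf b) := by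
    rw [hl, sub_self, mul_zero, mul_zero, sub_zero, add_zero]
    exact mul_pos h.c_pos (mul_pos (h.ninf_pos b) (h.minf_pos l))
  obtain ⟨T, hT⟩ := eventually_atTop.mp (hbr.eventually (lt_mem_nhds hbr0))
  have hsub : Ici (max 0 T) ⊆ Ici (0 : ℝ) := Ici_subset_Ici.mpr (le_max_left _ _)
  -- The product at `b` gains a positive multiple of `ε` from `l`. The loss to the right is `o(ε)`,
  -- and so is `ε'` because the velocities of `l` and `b` have the same limit. The monotone sum
  -- therefore stays below its limit.
  have hmono : MonotoneOn (fun t => m t b * n t b + C * ε t) (Ici (max 0 T)) := by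
    refine monotoneOn_Ici_of_hasDerivWithinAt (fun t ht => ((h.flow.hasDeriv_mul (hsub ht) b).add
      ((h.flow.hasDeriv_exp_gap (hsub ht) l b).const_mul C)).mono hsub) fun t ht => ?_
    have ht0 : 0 ≤ t := hsub ht
    have hm := h.flow.m_pos t ht0
    have hn := h.flow.n_pos t ht0
    have h1 := (mulDeriv_bounds hm hn (h.energy_eq t ht0) b (h.le_mul t ht0 b)).1
    have h2 := (mul_exp_le_inter (x := x t) hm hn b l).trans (inter_le_interL hm hn hlb)
    rw [abs_sub_comm, exp_neg_abs_eq_of_lt (h.flow.strictMono t ht0) hlb] at h2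
    have h3 := mul_le_mul_of_nonneg_left h2 h.c_pos.le
    have hε : 0 < ε t := Real.exp_pos _
    have h4 : interR (x t) (m t) (n t) b / ε t * ε t = interR (x t) (m t) (n t) b :=
      div_mul_cancel₀ _ hε.ne'
    have h5 := mul_pos (hT t ((le_max_right _ _).trans ht)) hε
    have h6 : (c * (n t b * m t l) - 3 * H * (interR (x t) (m t) (n t) b / ε t) +
        C * (vel x m n t l - vel x m n t b)) * ε t = c * (n t b * m t l * ε t) -
        3 * H * (interR (x t) (m t) (n t) b / ε t * ε t) +
        C * (ε t * (vel x m n t l - vel x m n t b)) := by ring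
    rw [h6, h4] at h5
    change 0 ≤ mulDeriv (x t) (m t) (n t) b + C * (ε t * (vel x m n t l - vel x m n t b))
    change c * (n t b * m t l * ε t) ≤ _ at h3
    linarith
  have hlim : Tendsto (fun t => m t b * n t b + C * ε t) atTop (𝓝 (minf b * ninf b)) := by
    simpa using (h.tendsto_mul b).add ((h.tendsto_gap l b hlb).const_mul C)
  filter_upwards [eventually_ge_atTop (max 0 T), hS.eventually (gt_mem_nhds (lt_add_one S)),
    hR.eventually (gt_mem_nhds zero_lt_one)] with t ht hSt hRt
  have ht0 : 0 ≤ t := hsub ht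
  have hε : 0 < ε t := Real.exp_pos _
  have hle : m t b * n t b + C * ε t ≤ minf b * ninf b := le_of_monotoneOn_of_tendsto hmono hlim ht
  have hRle : interR (x t) (m t) (n t) b ≤ 1 * ε t := ((div_lt_iff₀ hε).mp hRt).le
  have hLle : interL (x t) (m t) (n t) b ≤ (S + 1) * ε t := by
    refine le_trans ?_ (mul_le_mul_of_nonneg_right hSt.le hε.le)
    rw [interL, Finset.sum_mul]
    refine Finset.sum_le_sum fun k _ => ?_
    have hcoef : 0 ≤ n t b * m t k + m t b * n t k := by
      have := h.flow.m_pos t ht0 b; have := h.flow.m_pos t ht0 k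
      have := h.flow.n_pos t ht0 b; have := h.flow.n_pos t ht0 k
      positivity
    split_ifs with hk
    · rw [inter, abs_sub_comm, exp_neg_abs_eq_of_lt (h.flow.strictMono t ht0) hk]
      refine mul_le_mul_of_nonneg_left (Real.exp_le_exp.mpr ?_) hcoef
      have := (h.flow.strictMono t ht0).monotone (hpred k hk)
      linarith
    · exact mul_nonneg hcoef hε.le
  have hsum : interL (x t) (m t) (n t) b + interR (x t) (m t) (n t) b ≤ (S + 2) * ε t := by
    linarith
  have hfin := mul_le_mul_of_nonneg_left hsum hHc
  have hv := (h.vel_bounds ht0 b).2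
  have hC : C * ε t = (1 + H / c) * ((S + 2) * ε t) := mul_assoc _ _ _
  linarith

/-- The last peak of a group with equal asymptotic speeds is eventually
not slower than its limit. -/
theorem eventually_le_vel (h : IsScattering x m n minf ninf c H) {a l : Fin N} (hal : a < l)
    (hl : minf l * ninf l = minf a * ninf a)
    (ha : ∀ k, k < a → minf k * ninf k < minf a * ninf a) :
    ∀ᶠ t in atTop, minf a * ninf a ≤ vel x m n t a := by
  set ε : ℝ → ℝ := fun t => Real.exp (x t a - x t l)
  have hL := h.tendsto_interL_div hl ha
  have hbr : Tendsto (fun t => c * (n t a * m t l) -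
      3 * H * (interL (x t) (m t) (n t) a / ε t)) atTop (𝓝 (c * (ninf a * minf l) - 3 * H * 0)) :=
    (((h.tendsto_n a).mul (h.tendsto_m l)).const_mul c).sub (hL.const_mul (3 * H))
  have hbr0 : 0 < c * (ninf a * minf l) - 3 * H * 0 := by
    rw [mul_zero, sub_zero]
    exact mul_pos h.c_pos (mul_pos (h.ninf_pos a) (h.minf_pos l))
  obtain ⟨T, hT⟩ := eventually_atTop.mp (hbr.eventually (lt_mem_nhds hbr0))
  have hsub : Ici (max 0 T) ⊆ Ici (0 : ℝ) := Ici_subset_Ici.mpr (le_max_left _ _)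
  -- At the rear peak the loss to `l` dominates, so the product decreases to its limit. The velocity
  -- is never below the product, so no correction term is needed here.
  have hmono : MonotoneOn (fun t => -(m t a * n t a)) (Ici (max 0 T)) := by
    refine monotoneOn_Ici_of_hasDerivWithinAt
      (fun t ht => ((h.flow.hasDeriv_mul (hsub ht) a).neg).mono hsub) fun t ht => ?_
    have ht0 : 0 ≤ t := hsub ht
    have hm := h.flow.m_pos t ht0
    have hn := h.flow.n_pos t ht0
    have h1 := (mulDeriv_bounds hm hn (h.energy_eq t ht0) a (h.le_mul t ht0 a)).2
    have h2 := (mul_exp_le_inter (x := x t) hm hn a l).trans (inter_le_interR hm hn hal)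
    rw [exp_neg_abs_eq_of_lt (h.flow.strictMono t ht0) hal] at h2
    have h3 := mul_le_mul_of_nonneg_left h2 h.c_pos.le
    have hε : 0 < ε t := Real.exp_pos _
    have h4 : interL (x t) (m t) (n t) a / ε t * ε t = interL (x t) (m t) (n t) a :=
      div_mul_cancel₀ _ hε.ne'
    have h5 := mul_pos (hT t ((le_max_right _ _).trans ht)) hε
    have h6 : (c * (n t a * m t l) - 3 * H * (interL (x t) (m t) (n t) a / ε t)) * ε t =
        c * (n t a * m t l * ε t) -
        3 * H * (interL (x t) (m t) (n t) a / ε t * ε t) := by ring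
    rw [h6, h4] at h5
    change c * (n t a * m t l * ε t) ≤ _ at h3
    linarith
  filter_upwards [eventually_ge_atTop (max 0 T)] with t ht
  have h1 : -(m t a * n t a) ≤ -(minf a * ninf a) :=
    le_of_monotoneOn_of_tendsto hmono (h.tendsto_mul a).neg ht
  linarith [(h.vel_bounds (hsub ht) a).1]

/-- Let `a` be the rear and `b` the front of a group with a common limiting speed. Eventually `b` is
no faster than `a`, so their distance does not increase, although it has to tend to infinity. -/
theorem strictMono_mul (h : IsScattering x m n minf ninf c H) :
    StrictMono fun j => minf j * ninf j := by
  refine h.monotone_mul.strictMono_of_injective fun j k hjk => ?_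
  wlog hlt : j < k generalizing j k
  · rcases (not_lt.mp hlt).eq_or_lt with h' | h'
    · exact h'.symm
    · exact (this k j hjk.symm h').symm
  exfalso
  set p : Fin N → ℝ := fun j => minf j * ninf j
  set s : Finset (Fin N) := Finset.univ.filter fun i => p i = p j with hs
  have hjs : j ∈ s := by simp [hs]
  have hks : k ∈ s := by simp only [hs, Finset.mem_filter, Finset.mem_univ, true_and]; exact hjk.symm
  set b := s.max' ⟨j, hjs⟩ with hb
  set a := s.min' ⟨j, hjs⟩ with ha
  have hbp : p b = p j :=
    (Finset.mem_filter.mp (s.max'_mem ⟨j, hjs⟩)).2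
  have hap : p a = p j :=
    (Finset.mem_filter.mp (s.min'_mem ⟨j, hjs⟩)).2
  have hab : a < b := ((s.min'_le j hjs).trans_lt hlt).trans_le (s.le_max' k hks)
  have hbgt : ∀ i, b < i → p b < p i := fun i hi => by
    refine lt_of_le_of_ne (h.monotone_mul hi.le) fun heq => ?_
    exact absurd (s.le_max' i (by simp [hs, ← heq, hbp])) (not_le.mpr hi)
  have halt : ∀ i, i < a → p i < p a := fun i hi => by
    refine lt_of_le_of_ne (h.monotone_mul hi.le) fun heq => ?_
    exact absurd (s.min'_le i (by simp [hs, heq, hap])) (not_le.mpr hi)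
  have hbv : 0 < b.val := lt_of_le_of_lt (Nat.zero_le _) hab
  -- The immediate predecessor of `b` lies between `a` and `b`, and so has the same limiting speed
  -- by monotonicity.
  set l : Fin N := ⟨b.val - 1, by omega⟩ with hl
  have hlb : l < b := by rw [Fin.lt_def]; simp [hl]; omega
  have hpred : ∀ i, i < b → i ≤ l := fun i hi => by
    rw [Fin.lt_def] at hi; rw [Fin.le_def]; simp [hl]; omega
  have hlp : p l = p b := le_antisymm (h.monotone_mul hlb.le)
    ((hbp.trans hap.symm).le.trans (h.monotone_mul (hpred a hab)))
  have h1 := h.eventually_vel_le hlb hpred hlp hbgt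
  have h2 := h.eventually_le_vel hab (hbp.trans hap.symm) halt
  obtain ⟨T, hT⟩ := eventually_atTop.mp (h1.and h2)
  have hsub : Ici (max 0 T) ⊆ Ici (0 : ℝ) := Ici_subset_Ici.mpr (le_max_left _ _)
  have hmono : MonotoneOn (fun t => x t a - x t b) (Ici (max 0 T)) :=
    monotoneOn_Ici_of_hasDerivWithinAt (fun t ht => ((h.flow.hasDeriv_x (hsub ht) a).sub
      (h.flow.hasDeriv_x (hsub ht) b)).mono hsub) fun t ht => by
        have h3 := hT t ((le_max_right _ _).trans ht)
        have h4 : minf a * ninf a = minf b * ninf b := hap.trans hbp.symm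
        linarith [h3.1, h3.2]
  have hexp : Real.exp (x (max 0 T) a - x (max 0 T) b) ≤ 0 :=
    ge_of_tendsto (h.tendsto_gap a b hab) (by
      filter_upwards [eventually_ge_atTop (max 0 T)] with t ht
      exact Real.exp_le_exp.mpr (hmono self_mem_Ici ht ht))
  exact absurd hexp (not_le.mpr (Real.exp_pos _))

end IsScattering

end Scattering


/-! ### Asymptotic positions and the spectrum at infinite time -/

namespace IsScattering

variable {N : ℕ} {x m n : ℝ → Fin N → ℝ} {minf ninf : Fin N → ℝ} {c H : ℝ}

theorem exp_gap_le_sum (x : Fin N → ℝ) {j k : Fin N} (hjk : j < k) :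
    Real.exp (x j - x k) ≤ ∑ j, ∑ k, if j < k then Real.exp (x j - x k) else 0 := by
  have hnn : ∀ j k : Fin N, 0 ≤ if j < k then Real.exp (x j - x k) else 0 := fun j k => by
    split_ifs <;> positivity
  have h1 := Finset.single_le_sum (fun k _ => hnn j k) (Finset.mem_univ k)
  have h2 := Finset.single_le_sum (f := fun j => ∑ k, if j < k then Real.exp (x j - x k) else 0)
    (fun j _ => Finset.sum_nonneg fun k _ => hnn j k) (Finset.mem_univ j)
  simp only [hjk, if_true] at h1
  exact h1.trans h2

/-- The coefficients of the interactions converge and are therefore eventually bounded. The factor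
`2N` counts the terms of both sums. -/
theorem eventually_inter_le (h : IsScattering x m n minf ninf c H) : ∃ C, 0 ≤ C ∧
    ∀ᶠ t in atTop, ∀ j, interL (x t) (m t) (n t) j + interR (x t) (m t) (n t) j ≤
      C * ∑ j, ∑ k, if j < k then Real.exp (x t j - x t k) else 0 := by
  obtain ⟨B, hB⟩ := Finite.exists_le
    (fun jk : Fin N × Fin N => ninf jk.1 * minf jk.2 + minf jk.1 * ninf jk.2)
  set D := max (B + 1) 0
  have hD : 0 ≤ D := le_max_right _ _
  refine ⟨2 * (N * D), by positivity, ?_⟩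
  have hcoef : ∀ᶠ t in atTop, ∀ j k, n t j * m t k + m t j * n t k ≤ D := by
    refine eventually_all.mpr fun j => eventually_all.mpr fun k => ?_
    have hlt : ninf j * minf k + minf j * ninf k < B + 1 := by
      have := hB (j, k); simp only at this; linarith
    filter_upwards [(h.tendsto_coef j k).eventually (gt_mem_nhds hlt)] with t ht
    exact ht.le.trans (le_max_left _ _)
  filter_upwards [hcoef, eventually_ge_atTop 0] with t hc ht j
  have hx := h.flow.strictMono t ht
  set e := ∑ j, ∑ k, if j < k then Real.exp (x t j - x t k) else 0
  have he : 0 ≤ e := Finset.sum_nonneg fun j _ => Finset.sum_nonneg fun k _ => by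
    split_ifs <;> positivity
  have hcard : ∑ _k : Fin N, D * e = N * D * e := by simp; ring
  have h1 : interL (x t) (m t) (n t) j ≤ N * D * e := by
    rw [← hcard]
    refine Finset.sum_le_sum fun k _ => ?_
    split_ifs with hk
    · rw [inter_comm, inter, exp_neg_abs_eq_of_lt hx hk]
      exact mul_le_mul (hc k j) (exp_gap_le_sum _ hk) (Real.exp_pos _).le hD
    · positivity
  have h2 : interR (x t) (m t) (n t) j ≤ N * D * e := by
    rw [← hcard]
    refine Finset.sum_le_sum fun k _ => ?_
    split_ifs with hk
    · rw [inter, exp_neg_abs_eq_of_lt hx hk]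
      exact mul_le_mul (hc j k) (exp_gap_le_sum _ hk) (Real.exp_pos _).le hD
    · positivity
  linarith

/-- The positions converge after subtraction of the asymptotic uniform motion. -/
theorem exists_tendsto_pos_sub (h : IsScattering x m n minf ninf c H) (j : Fin N) :
    ∃ L, Tendsto (fun t => x t j - minf j * ninf j * t) atTop (𝓝 L) := by
  obtain ⟨C, hC, hI⟩ := h.eventually_inter_le
  -- Half the limiting speed difference, which is eventually a lower bound for the actual one.
  -- Strictness of the ordering is essential here.
  set d : Fin N → Fin N → ℝ := fun j k => (minf k * ninf k - minf j * ninf j) / 2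
  have hd : ∀ j k, j < k → 0 < d j k := fun j k hjk => by
    have := h.strictMono_mul hjk
    simp only [d]; simp only at this; linarith
  have hV : ∀ᶠ t in atTop, ∀ j k, j < k → d j k ≤ vel x m n t k - vel x m n t j := by
    refine eventually_all.mpr fun j => eventually_all.mpr fun k => ?_
    by_cases hjk : j < k
    · have hlt : d j k < minf k * ninf k - minf j * ninf j := by
        have := hd j k hjk; simp only [d] at *; linarith
      filter_upwards [((h.tendsto_vel k).sub (h.tendsto_vel j)).eventually (lt_mem_nhds hlt)]
        with t ht _ using ht.le
    · exact .of_forall fun t h' => absurd h' hjk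
  obtain ⟨T, hT⟩ := eventually_atTop.mp (hI.and hV)
  have hsub : Ici (max 0 T) ⊆ Ici (0 : ℝ) := Ici_subset_Ici.mpr (le_max_left _ _)
  set e : ℝ → ℝ := fun t => ∑ j, ∑ k, if j < k then Real.exp (x t j - x t k) else 0
  -- Dividing each exponential by `d` gives `Φ' ≥ e`, while `Φ ≤ 0` and `-Φ` is again bounded by a
  -- multiple of `e`.
  set Φ : ℝ → ℝ := fun t => ∑ j, ∑ k, if j < k then
    -((d j k)⁻¹ * Real.exp (x t j - x t k)) else 0
  set Φ' : ℝ → ℝ := fun t => ∑ j, ∑ k, if j < k then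
    -((d j k)⁻¹ * (Real.exp (x t j - x t k) * (vel x m n t j - vel x m n t k))) else 0
  have hΦ : ∀ t, max 0 T ≤ t → HasDerivWithinAt Φ (Φ' t) (Ici (max 0 T)) t := fun t ht =>
    HasDerivWithinAt.fun_sum fun j _ => HasDerivWithinAt.fun_sum fun k _ => by
      split_ifs
      · exact (((h.flow.hasDeriv_exp_gap (hsub ht) j k).const_mul _).neg).mono hsub
      · exact hasDerivWithinAt_const _ _ _
  have he : ∀ t, 0 ≤ e t := fun t => Finset.sum_nonneg fun j _ => Finset.sum_nonneg fun k _ => by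
    split_ifs <;> positivity
  have heΦ : ∀ t, max 0 T ≤ t → e t ≤ Φ' t := fun t ht =>
    Finset.sum_le_sum fun j _ => Finset.sum_le_sum fun k _ => by
      split_ifs with hjk
      · have h1 := (hT t ((le_max_right _ _).trans ht)).2 j k hjk
        have h2 := hd j k hjk
        have h3 := mul_le_mul_of_nonneg_left h1 (Real.exp_pos (x t j - x t k)).le
        have h4 : -((d j k)⁻¹ * (Real.exp (x t j - x t k) * (vel x m n t j - vel x m n t k))) =
          (Real.exp (x t j - x t k) * (vel x m n t k - vel x m n t j)) / d j k := by
          field_simp; ring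
        rw [h4, le_div_iff₀ h2]
        exact h3
      · exact le_rfl
  have hΦ0 : ∀ t, max 0 T ≤ t → 0 ≤ Φ' t := fun t ht => (he t).trans (heΦ t ht)
  have hB : ∀ t, max 0 T ≤ t → Φ t ≤ 0 := fun t _ =>
    Finset.sum_nonpos fun j _ => Finset.sum_nonpos fun k _ => by
      split_ifs with hjk
      · have := inv_pos.mpr (hd j k hjk); have := Real.exp_pos (x t j - x t k)
        have : 0 ≤ (d j k)⁻¹ * Real.exp (x t j - x t k) := by positivity
        linarith
      · exact le_rfl
  obtain ⟨D, hD⟩ := Finite.exists_le (fun jk : Fin N × Fin N => (d jk.1 jk.2)⁻¹)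
  have hΦe : ∀ t, -Φ t ≤ max D 0 * e t := fun t => by
    simp only [Φ, e]
    rw [← Finset.sum_neg_distrib, Finset.mul_sum]
    refine Finset.sum_le_sum fun j _ => ?_
    rw [← Finset.sum_neg_distrib, Finset.mul_sum]
    refine Finset.sum_le_sum fun k _ => ?_
    split_ifs
    · rw [neg_neg]
      exact mul_le_mul_of_nonneg_right ((hD (j, k)).trans (le_max_left _ _)) (Real.exp_pos _).le
    · simp
  set I : ℝ → ℝ := fun t => interL (x t) (m t) (n t) j + interR (x t) (m t) (n t) j
  have hIt : ∀ t, max 0 T ≤ t → I t ≤ C * e t := fun t ht =>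
    (hT t ((le_max_right _ _).trans ht)).1 j
  have hK : 0 ≤ 3 * H * C := by have := h.H_nonneg; positivity
  have hc := h.c_pos
  have hH := h.H_nonneg
  have hmul : ∀ t, max 0 T ≤ t → |mulDeriv (x t) (m t) (n t) j| ≤ 3 * H * C * e t := by
    intro t ht
    have ht0 : 0 ≤ t := hsub ht
    have hm := h.flow.m_pos t ht0
    have hn := h.flow.n_pos t ht0
    have h1 := mulDeriv_bounds hm hn (h.energy_eq t ht0) j (h.le_mul t ht0 j)
    have h2 := mul_le_mul_of_nonneg_left (hIt t ht) (show 0 ≤ 3 * H by positivity)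
    have h3 := mul_nonneg hc.le (interL_nonneg (x := x t) hm hn j)
    have h4 := mul_nonneg hc.le (interR_nonneg (x := x t) hm hn j)
    have h5 := mul_nonneg hH (interL_nonneg (x := x t) hm hn j)
    have h6 := mul_nonneg hH (interR_nonneg (x := x t) hm hn j)
    simp only [I] at h2
    rw [abs_le]
    constructor <;> linarith [h1.1, h1.2]
  -- The rate is what matters: it bounds the distance of `mⱼ nⱼ` from its limit by a multiple of
  -- `-Φ`, hence of `e`. The velocity error is then also bounded by a multiple of `e ≤ Φ'`, and a
  -- second application gives convergence of the positions.
  obtain ⟨L, hL, hLr⟩ := exists_tendsto_of_abs_deriv_le hK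
    (fun t ht => (h.flow.hasDeriv_mul (hsub ht) j).mono hsub) hΦ
    (fun t ht => (hmul t ht).trans (mul_le_mul_of_nonneg_left (heΦ t ht) hK)) hΦ0 hB
  rw [tendsto_nhds_unique hL (h.tendsto_mul j)] at hLr
  have hK2 : 0 ≤ (1 + H / c) * C + 3 * H * C * max D 0 := by
    have : 0 ≤ max D 0 := le_max_right _ _
    positivity
  obtain ⟨L', hL', -⟩ := exists_tendsto_of_abs_deriv_le hK2
    (f := fun t => x t j - minf j * ninf j * t)
    (f' := fun t => vel x m n t j - minf j * ninf j) (fun t ht => by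
      have h1 := ((h.flow.hasDeriv_x (hsub ht) j).mono hsub).sub
        ((hasDerivAt_id t).const_mul (minf j * ninf j)).hasDerivWithinAt
      rw [mul_one] at h1
      exact h1) hΦ (fun t ht => by
      refine le_trans ?_ (mul_le_mul_of_nonneg_left (heΦ t ht) hK2)
      have ht0 : 0 ≤ t := hsub ht
      have h1 := h.vel_bounds ht0 j
      have h2 := hLr t ht
      rw [zero_sub] at h2
      have h3 := mul_le_mul_of_nonneg_left (hΦe t) hK
      have h4 := mul_le_mul_of_nonneg_left (hIt t ht) (show 0 ≤ 1 + H / c by positivity)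
      have h5 := abs_le.mp (h2.trans h3)
      simp only [I] at h4
      have h6 : 0 ≤ (1 + H / c) * (C * e t) := by have := he t; positivity
      rw [abs_le]
      constructor <;> linarith [h1.1, h1.2, h5.1, h5.2]) hΦ0 hB
  exact ⟨L', hL'⟩

/-- The polynomial does not depend on time, so it may be computed in the limit, where `E` is the
identity and `EG` is lower triangular. -/
theorem charpoly_redMatrix_eq_prod (h : IsScattering x m n minf ninf c H) {t : ℝ} (ht : 0 ≤ t) :
    (redMatrix (x t) (m t) (n t)).charpoly =
      ∏ j, (Polynomial.X - Polynomial.C (2 * (minf j * ninf j))) := by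
  have hE : Tendsto (fun t => matE (x t)) atTop (𝓝 1) := by
    refine tendsto_pi_nhds.mpr fun j => tendsto_pi_nhds.mpr fun k => ?_
    by_cases hjk : j = k
    · subst hjk
      simp [matE]
    · rw [Matrix.one_apply_ne hjk]
      exact h.tendsto_exp_neg_abs hjk
  have hG : Tendsto (fun t => matG (m t) (n t)) atTop (𝓝 (matG minf ninf)) := by
    refine tendsto_pi_nhds.mpr fun j => tendsto_pi_nhds.mpr fun k => ?_
    exact (((h.tendsto_m j).mul (h.tendsto_n k)).add
      ((h.tendsto_n j).mul (h.tendsto_m k))).const_mul _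
  have hlim : (redMatrix (x t) (m t) (n t)).charpoly = (matG minf ninf).charpoly := by
    refine Polynomial.funext fun κ => ?_
    have h1 : Tendsto (fun t => redMatrix (x t) (m t) (n t)) atTop (𝓝 (matG minf ninf)) := by
      have := hE.mul hG
      rwa [one_mul] at this
    have h2 : Tendsto (fun t => (redMatrix (x t) (m t) (n t)).charpoly.eval κ) atTop
        (𝓝 ((matG minf ninf).charpoly.eval κ)) := by
      simp_rw [Matrix.eval_charpoly]
      exact (((continuous_const.sub continuous_id).matrix_det).tendsto _).comp h1
    refine tendsto_nhds_unique (tendsto_const_nhds.congr' ?_) h2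
    filter_upwards [eventually_ge_atTop 0] with τ hτ
    rw [h.flow.charpoly_redMatrix hτ, h.flow.charpoly_redMatrix ht]
  rw [hlim, ← Matrix.charpoly_transpose, Matrix.charpoly_of_isUpperTriangular]
  · refine Finset.prod_congr rfl fun j _ => ?_
    have hj : matG minf ninf j j = 2 * (minf j * ninf j) := by
      simp [matG, matT]
      ring
    rw [Matrix.transpose_apply, hj]
  · intro i j hij
    have hij : j < i := hij
    simp [matG, matT, hij.ne, hij.not_gt]

theorem charpoly_specMatrixC_eq (h : IsScattering x m n minf ninf c H) {t : ℝ} (ht : 0 ≤ t) :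
    (specMatrixC (x t) (m t) (n t)).charpoly = Polynomial.X ^ N *
      ∏ j, (Polynomial.X - Polynomial.C ((2 * (minf j * ninf j) : ℝ) : ℂ)) := by
  have h1 := congrArg (Polynomial.map Complex.ofRealHom) (h.charpoly_redMatrix_eq_prod ht)
  rw [← Matrix.charpoly_map, Polynomial.map_prod] at h1
  rw [charpoly_specMatrixC]
  congr 1
  refine h1.trans (Finset.prod_congr rfl fun j _ => ?_)
  rw [Polynomial.map_sub, Polynomial.map_X, Polynomial.map_C]
  rfl

theorem isRoot_redMatrixC_iff (h : IsScattering x m n minf ninf c H) {t : ℝ} (ht : 0 ≤ t)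
    (κ : ℂ) : (redMatrixC (x t) (m t) (n t)).charpoly.IsRoot κ ↔
      ∃ j, κ = ((2 * (minf j * ninf j) : ℝ) : ℂ) := by
  have h1 := congrArg (Polynomial.map Complex.ofRealHom) (h.charpoly_redMatrix_eq_prod ht)
  rw [← Matrix.charpoly_map, Polynomial.map_prod] at h1
  have h2 : (redMatrixC (x t) (m t) (n t)).charpoly = _ := h1
  rw [h2, Polynomial.IsRoot, Polynomial.eval_prod, Finset.prod_eq_zero_iff]
  simp [sub_eq_zero]

theorem isRoot_specMatrixC_iff (h : IsScattering x m n minf ninf c H) {t : ℝ} (ht : 0 ≤ t)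
    {κ : ℂ} (hκ : κ ≠ 0) : (specMatrixC (x t) (m t) (n t)).charpoly.IsRoot κ ↔
      ∃ j, κ = ((2 * (minf j * ninf j) : ℝ) : ℂ) := by
  rw [charpoly_specMatrixC, ← h.isRoot_redMatrixC_iff ht]
  simp [Polynomial.IsRoot, hκ]

theorem rootMultiplicity_specMatrixC (h : IsScattering x m n minf ninf c H) {t : ℝ} (ht : 0 ≤ t)
    (j : Fin N) : (specMatrixC (x t) (m t) (n t)).charpoly.rootMultiplicity
      ((2 * (minf j * ninf j) : ℝ) : ℂ) = 1 := by
  set a : Fin N → ℂ := fun j => ((2 * (minf j * ninf j) : ℝ) : ℂ)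
  have hinj : Function.Injective a := by
    intro i k hik
    have h1 : 2 * (minf i * ninf i) = 2 * (minf k * ninf k) := Complex.ofReal_injective hik
    exact h.strictMono_mul.injective (by linarith)
  have ha : a j ≠ 0 := by
    have := h.minf_pos j; have := h.ninf_pos j
    simp only [a, ne_eq, Complex.ofReal_eq_zero]
    positivity
  rw [h.charpoly_specMatrixC_eq ht, ← Polynomial.count_roots, Polynomial.roots_mul
    (mul_ne_zero (pow_ne_zero _ Polynomial.X_ne_zero) (Finset.prod_ne_zero_iff.mpr fun i _ =>
      Polynomial.X_sub_C_ne_zero _)), Polynomial.roots_X_pow, Multiset.count_add,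
    Polynomial.roots_prod _ _ (Finset.prod_ne_zero_iff.mpr fun i _ =>
      Polynomial.X_sub_C_ne_zero _)]
  simp only [Polynomial.roots_X_sub_C]
  rw [Multiset.bind_singleton, Multiset.count_nsmul, Multiset.count_singleton, if_neg ha, mul_zero,
    zero_add]
  exact Multiset.count_eq_one_of_mem (Finset.univ.nodup.map hinj)
    (Multiset.mem_map_of_mem a (Finset.mem_univ j))

end IsScattering


/-! ### Global existence -/

/-- A bounded `C¹` vector field on a finite-dimensional space has forward global solutions. -/
theorem exists_global_solution {E : Type*} [NormedAddCommGroup E] [NormedSpace ℝ E]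
    [FiniteDimensional ℝ E] {g : E → E} (hg : ContDiff ℝ 1 g) {M : ℝ} (hM : ∀ y, ‖g y‖ ≤ M)
    (y₀ : E) : ∃ y : ℝ → E, y 0 = y₀ ∧
      ∀ t, 0 ≤ t → HasDerivWithinAt y (g (y t)) (Ici 0) t := by
  have : CompleteSpace E := FiniteDimensional.complete ℝ E
  have : ProperSpace E := FiniteDimensional.proper ℝ E
  have hM0 : 0 ≤ M := (norm_nonneg _).trans (hM y₀)
  have hlip : ∀ R, ∃ K, LipschitzOnWith K g (Metric.closedBall y₀ R) := fun R =>
    (hg.locallyLipschitz.locallyLipschitzOn (s := _)).exists_lipschitzOnWith_of_compact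
      (isCompact_closedBall y₀ R)
  have hloc : ∀ T : ℝ, ∃ γ : ℝ → E, 0 ≤ T → γ 0 = y₀ ∧
      ∀ t ∈ Icc 0 T, HasDerivWithinAt γ (g (γ t)) (Icc 0 T) t := by
    intro T
    by_cases hT : 0 ≤ T
    -- A solution cannot leave the ball of radius `MT` by time `T`, and a `C¹` field is Lipschitz on
    -- that compact ball, so a single Picard–Lindelöf step covers `[0, T]`.
    · obtain ⟨K, hK⟩ := hlip (M * T)
      have hPL : IsPicardLindelof (fun _ => g) (tmin := 0) (tmax := T) ⟨0, left_mem_Icc.mpr hT⟩ y₀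
          ⟨M * T, by positivity⟩ 0 ⟨M, hM0⟩ K :=
        { lipschitzOnWith := fun t _ => hK
          continuousOn := fun _ _ => continuousOn_const
          norm_le := fun t _ y _ => hM y
          mul_max_le := by
            simp only [sub_zero, NNReal.coe_zero]
            rw [max_eq_left (by simpa using hT)]
            exact le_rfl }
      obtain ⟨γ, h0, hγ⟩ := hPL.exists_eq_forall_mem_Icc_hasDerivWithinAt₀
      exact ⟨γ, fun _ => ⟨h0, hγ⟩⟩
    · exact ⟨fun _ => 0, fun h => absurd h hT⟩
  choose γ hγ using hloc
  have hright : ∀ (T S t : ℝ), t ∈ Ico 0 T → T ≤ S → HasDerivWithinAt (γ S) (g (γ S t)) (Ici t) t :=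
    fun T S t ht hTS => by
      have hS : t ∈ Ico 0 S := ⟨ht.1, ht.2.trans_le hTS⟩
      have := ((hγ S (ht.1.trans hS.2.le)).2 t ⟨ht.1, hS.2.le⟩).mono
        (Icc_subset_Icc_left ht.1)
      exact this.mono_of_mem_nhdsWithin (Icc_mem_nhdsGE hS.2)
  have hcont : ∀ T S, 0 ≤ T → T ≤ S → ContinuousOn (γ S) (Icc 0 T) := fun T S hT hTS t ht =>
    (((hγ S (hT.trans hTS)).2 t ⟨ht.1, ht.2.trans hTS⟩).continuousWithinAt).mono
      (Icc_subset_Icc_right hTS)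
  have heq : ∀ T S, 0 ≤ T → T ≤ S → EqOn (γ T) (γ S) (Icc 0 T) := by
    intro T S hT hTS
    obtain ⟨R₁, hR₁⟩ := (isCompact_Icc.image_of_continuousOn (hcont T T hT le_rfl)).isBounded
      |>.subset_closedBall y₀
    obtain ⟨R₂, hR₂⟩ := (isCompact_Icc.image_of_continuousOn (hcont T S hT hTS)).isBounded
      |>.subset_closedBall y₀
    obtain ⟨K, hK⟩ := hlip (max R₁ R₂)
    refine ODE_solution_unique_of_mem_Icc_right (v := fun _ => g)
      (s := fun _ => Metric.closedBall y₀ (max R₁ R₂)) (fun t _ => hK) (hcont T T hT le_rfl)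
      (fun t ht => hright T T t ht le_rfl) (fun t ht => ?_) (hcont T S hT hTS)
      (fun t ht => hright T S t ht hTS) (fun t ht => ?_) ?_
    · exact Metric.closedBall_subset_closedBall (le_max_left _ _)
        (hR₁ (mem_image_of_mem _ (Ico_subset_Icc_self ht)))
    · exact Metric.closedBall_subset_closedBall (le_max_right _ _)
        (hR₂ (mem_image_of_mem _ (Ico_subset_Icc_self ht)))
    · rw [(hγ T hT).1, (hγ S (hT.trans hTS)).1]
  have hy : ∀ S t, 0 ≤ t → t + 1 ≤ S → γ (t + 1) t = γ S t := fun S t ht htS =>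
    heq (t + 1) S (by linarith) htS ⟨ht, by linarith⟩
  -- The solutions on `[0, T]` are glued by uniqueness. Near `t` the glued function agrees with the
  -- solution on `[0, t + 2]`, which extends to the right of `t`.
  refine ⟨fun t => γ (t + 1) t, (hγ (0 + 1) (by norm_num)).1, fun t ht => ?_⟩
  have h1 := (hγ (t + 2) (by linarith)).2 t ⟨ht, by linarith⟩
  have h2 : HasDerivWithinAt (γ (t + 2)) (g (γ (t + 2) t)) (Ici 0) t := by
    refine h1.mono_of_mem_nhdsWithin ?_
    rw [← Ici_inter_Iic]
    exact inter_mem self_mem_nhdsWithin (mem_nhdsWithin_of_mem_nhds (Iic_mem_nhds (by linarith)))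
  change HasDerivWithinAt (fun t => γ (t + 1) t) (g (γ (t + 1) t)) (Ici 0) t
  have h3 : g (γ (t + 1) t) = g (γ (t + 2) t) := by rw [hy (t + 2) t ht (by linarith)]
  rw [h3]
  refine h2.congr_of_eventuallyEq ?_ (hy (t + 2) t ht (by linarith))
  have : Iio (t + 1) ∈ 𝓝[Ici 0] t := mem_nhdsWithin_of_mem_nhds (Iio_mem_nhds (by linarith))
  filter_upwards [self_mem_nhdsWithin, this] with τ hτ hτ'
  exact hy (t + 2) τ hτ (by have : τ < t + 1 := hτ'; linarith)

section Existence

variable {N : ℕ}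

/-- A smooth expression for the potential at a peak, correct for ordered peaks. -/
def smoothVal (x w : Fin N → ℝ) (j : Fin N) : ℝ :=
  leftMom x w j * Real.exp (-x j) + w j + rightMom x w (j + 1) * Real.exp (x j)

/-- A smooth expression for minus the mean slope at a peak, correct for ordered peaks. -/
def smoothSlope (x w : Fin N → ℝ) (j : Fin N) : ℝ :=
  leftMom x w j * Real.exp (-x j) - rightMom x w (j + 1) * Real.exp (x j)

theorem contDiff_leftMom {E : Type*} [NormedAddCommGroup E] [NormedSpace ℝ E] {x w : E → Fin N → ℝ}
    (hx : ContDiff ℝ 1 x) (hw : ContDiff ℝ 1 w) (k : ℕ) :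
    ContDiff ℝ 1 (fun y => leftMom (x y) (w y) k) := by
  unfold leftMom psum
  refine ContDiff.sum fun i _ => ?_
  split_ifs <;> fun_prop

theorem contDiff_rightMom {E : Type*} [NormedAddCommGroup E] [NormedSpace ℝ E]
    {x w : E → Fin N → ℝ} (hx : ContDiff ℝ 1 x) (hw : ContDiff ℝ 1 w) (k : ℕ) :
    ContDiff ℝ 1 (fun y => rightMom (x y) (w y) k) := by
  unfold rightMom psum
  refine ContDiff.sub (by fun_prop) (ContDiff.sum fun i _ => ?_)
  split_ifs <;> fun_prop

theorem contDiff_smoothVal {E : Type*} [NormedAddCommGroup E] [NormedSpace ℝ E]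
    {x w : E → Fin N → ℝ} (hx : ContDiff ℝ 1 x) (hw : ContDiff ℝ 1 w) (j : Fin N) :
    ContDiff ℝ 1 (fun y => smoothVal (x y) (w y) j) := by
  have h1 := contDiff_leftMom hx hw j
  have h2 := contDiff_rightMom hx hw (j + 1)
  unfold smoothVal
  fun_prop

theorem contDiff_smoothSlope {E : Type*} [NormedAddCommGroup E] [NormedSpace ℝ E]
    {x w : E → Fin N → ℝ} (hx : ContDiff ℝ 1 x) (hw : ContDiff ℝ 1 w) (j : Fin N) :
    ContDiff ℝ 1 (fun y => smoothSlope (x y) (w y) j) := by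
  have h1 := contDiff_leftMom hx hw j
  have h2 := contDiff_rightMom hx hw (j + 1)
  unfold smoothSlope
  fun_prop

/-- Positions and logarithms of the momenta. -/
abbrev LogState (N : ℕ) := (Fin N → ℝ) × (Fin N → ℝ) × (Fin N → ℝ)

/-- The first momenta of a state. -/
def LogState.m (y : LogState N) : Fin N → ℝ := fun j => Real.exp (y.2.1 j)

/-- The second momenta of a state. -/
def LogState.n (y : LogState N) : Fin N → ℝ := fun j => Real.exp (y.2.2 j)

theorem contDiff_fst_logState : ContDiff ℝ 1 (fun y : LogState N => y.1) := contDiff_fst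

theorem contDiff_m : ContDiff ℝ 1 (LogState.m : LogState N → Fin N → ℝ) := by
  unfold LogState.m; fun_prop

theorem contDiff_n : ContDiff ℝ 1 (LogState.n : LogState N → Fin N → ℝ) := by
  unfold LogState.n; fun_prop

/-- The peakon vector field in logarithmic coordinates. -/
def logField (y : LogState N) : LogState N :=
  (fun j => smoothVal y.1 y.m j * smoothVal y.1 y.n j,
    fun j => smoothSlope y.1 y.m j * smoothVal y.1 y.n j,
    fun j => smoothSlope y.1 y.n j * smoothVal y.1 y.m j)

theorem contDiff_logField : ContDiff ℝ 1 (logField : LogState N → LogState N) := by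
  have hx := contDiff_fst_logState (N := N)
  refine ContDiff.prodMk ?_ (ContDiff.prodMk ?_ ?_)
  · exact contDiff_pi.mpr fun j => (contDiff_smoothVal hx contDiff_m j).mul
      (contDiff_smoothVal hx contDiff_n j)
  · exact contDiff_pi.mpr fun j => (contDiff_smoothSlope hx contDiff_m j).mul
      (contDiff_smoothVal hx contDiff_n j)
  · exact contDiff_pi.mpr fun j => (contDiff_smoothSlope hx contDiff_n j).mul
      (contDiff_smoothVal hx contDiff_m j)

/-- The sum of the squares of the components of a state. -/
def sqNorm (y : LogState N) : ℝ := ∑ j, (y.1 j ^ 2 + y.2.1 j ^ 2 + y.2.2 j ^ 2)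

theorem contDiff_sqNorm : ContDiff ℝ 1 (sqNorm : LogState N → ℝ) := by
  unfold sqNorm; fun_prop

theorem norm_le_of_sqNorm_le {y : LogState N} {R : ℝ} (hR : 0 ≤ R) (h : sqNorm y ≤ R + 1) :
    ‖y‖ ≤ R + 1 := by
  have hj : ∀ j, y.1 j ^ 2 + y.2.1 j ^ 2 + y.2.2 j ^ 2 ≤ (R + 1) ^ 2 := fun j => by
    have := Finset.single_le_sum (f := fun j => y.1 j ^ 2 + y.2.1 j ^ 2 + y.2.2 j ^ 2)
      (fun j _ => by positivity) (Finset.mem_univ j)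
    have h2 : y.1 j ^ 2 + y.2.1 j ^ 2 + y.2.2 j ^ 2 ≤ R + 1 := this.trans h
    nlinarith
  have hR1 : 0 ≤ R + 1 := by linarith
  refine norm_prod_le_iff.mpr ⟨(pi_norm_le_iff_of_nonneg hR1).mpr fun j => ?_,
    norm_prod_le_iff.mpr ⟨(pi_norm_le_iff_of_nonneg hR1).mpr fun j => ?_,
      (pi_norm_le_iff_of_nonneg hR1).mpr fun j => ?_⟩⟩ <;>
  · refine abs_le_of_sq_le_sq ?_ hR1
    nlinarith [hj j, sq_nonneg (y.1 j), sq_nonneg (y.2.1 j), sq_nonneg (y.2.2 j)]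

/-- The speed factor that switches the flow off where the vector field is large. -/
def cutoff (R : ℝ) (y : LogState N) : ℝ := Real.smoothTransition (R + 1 - sqNorm (logField y))

theorem contDiff_cutoff (R : ℝ) : ContDiff ℝ 1 (cutoff R : LogState N → ℝ) :=
  Real.smoothTransition.contDiff.comp
    (contDiff_const.sub (contDiff_sqNorm.comp contDiff_logField))

theorem norm_cutoff_smul_le {R : ℝ} (hR : 0 ≤ R) (y : LogState N) :
    ‖cutoff R y • logField y‖ ≤ R + 1 := by
  rw [norm_smul, Real.norm_eq_abs, cutoff, abs_of_nonneg (Real.smoothTransition.nonneg _)]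
  by_cases h : sqNorm (logField y) ≤ R + 1
  · exact (mul_le_of_le_one_left (norm_nonneg _) (Real.smoothTransition.le_one _)).trans
      (norm_le_of_sqNorm_le hR h)
  · rw [Real.smoothTransition.zero_of_nonpos (by linarith), zero_mul]
    linarith

/-- Adjacent peaks of the smooth field keep their order. -/
theorem smoothVal_mul_sub {x m n : Fin N → ℝ} {j k : Fin N} (hjk : k.val = j.val + 1) :
    2 * Real.exp (2 * x k) * (smoothVal x m k * smoothVal x n k) -
      2 * Real.exp (2 * x j) * (smoothVal x m j * smoothVal x n j) =
    (2 * Real.exp (2 * x k) * (rightMom x m k * rightMom x n k - leftMom x m k * leftMom x n k *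
      (Real.exp (-(2 * x k)) * Real.exp (-(2 * x j)))) +
      2 * (smoothVal x m j * smoothVal x n j)) * (Real.exp (2 * x k) - Real.exp (2 * x j)) := by
  -- At both ends of the gap between `j` and `k` the smooth potential is `A e⁻ʸ + B eʸ` with the
  -- same `A` and `B`. This is why `exp (2xₖ) - exp (2xⱼ)` can be factored out of its own
  -- derivative.
  have hk : ∀ w : Fin N → ℝ, smoothVal x w k =
      leftMom x w k * Real.exp (-x k) + rightMom x w k * Real.exp (x k) := fun w => by
    have h1 := rightMom_succ x w k
    have h2 : Real.exp (-x k) * Real.exp (x k) = 1 := by rw [← Real.exp_add]; simp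
    rw [smoothVal, h1]
    linear_combination -(w k) * h2
  have hj : ∀ w : Fin N → ℝ, smoothVal x w j =
      leftMom x w k * Real.exp (-x j) + rightMom x w k * Real.exp (x j) := fun w => by
    have h1 := leftMom_succ x w j
    have h2 : Real.exp (-x j) * Real.exp (x j) = 1 := by rw [← Real.exp_add]; simp
    rw [smoothVal, hjk, h1]
    linear_combination -(w j) * h2
  rw [hk m, hk n, hj m, hj n]
  simp only [Real.exp_neg, two_mul (x j), two_mul (x k), Real.exp_add]
  have h1 := (Real.exp_pos (x j)).ne'
  have h2 := (Real.exp_pos (x k)).ne'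
  field_simp
  ring

theorem abs_peakSlope_le {x w : Fin N → ℝ} (hw : ∀ j, 0 < w j) (j : Fin N) :
    |peakSlope x w j| ≤ peakVal x w j := by
  rw [peakSlope_eq_parts, peakVal_eq_parts]
  have := leftPart_nonneg (x := x) hw j
  have := rightPart_nonneg (x := x) hw j
  have := hw j
  rw [abs_le]
  constructor <;> linarith

/-- Logarithmic momenta build in positivity, and the smooth expressions replace `exp (-|·|)`, which
is not `C¹` where peaks meet. The field with its cutoff is bounded, so it has a global solution. The
solution keeps its order, is therefore a scaled flow, conserves energy, and so never enters the
region where the cutoff acts. -/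
theorem exists_isPeakonFlow {x₀ m₀ n₀ : Fin N → ℝ} (hx₀ : StrictMono x₀) (hm₀ : ∀ j, 0 < m₀ j)
    (hn₀ : ∀ j, 0 < n₀ j) : ∃ x m n : ℝ → Fin N → ℝ,
      IsPeakonFlow x m n ∧ x 0 = x₀ ∧ m 0 = m₀ ∧ n 0 = n₀ := by
  set H := energy x₀ m₀ n₀
  set R : ℝ := ∑ _j : Fin N, (H ^ 2 + H ^ 2 + H ^ 2)
  have hR : 0 ≤ R := Finset.sum_nonneg fun j _ => by positivity
  obtain ⟨y, hy0, hy⟩ := exists_global_solution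
    ((contDiff_cutoff R).smul (contDiff_logField (N := N))) (norm_cutoff_smul_le hR)
    (x₀, fun j => Real.log (m₀ j), fun j => Real.log (n₀ j))
  set s : ℝ → ℝ := fun t => cutoff R (y t)
  have hyc : ContinuousOn y (Ici 0) := fun t ht => (hy t ht).continuousWithinAt
  have dx : ∀ t, 0 ≤ t → ∀ j, HasDerivWithinAt (fun τ => (y τ).1 j)
      (s t * (smoothVal (y t).1 (y t).m j * smoothVal (y t).1 (y t).n j)) (Ici 0) t :=
    fun t ht j => hasDerivWithinAt_pi.mp (hy t ht).fst j
  have da : ∀ t, 0 ≤ t → ∀ j, HasDerivWithinAt (fun τ => (y τ).2.1 j)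
      (s t * (smoothSlope (y t).1 (y t).m j * smoothVal (y t).1 (y t).n j)) (Ici 0) t :=
    fun t ht j => hasDerivWithinAt_pi.mp (hy t ht).snd.fst j
  have db : ∀ t, 0 ≤ t → ∀ j, HasDerivWithinAt (fun τ => (y τ).2.2 j)
      (s t * (smoothSlope (y t).1 (y t).n j * smoothVal (y t).1 (y t).m j)) (Ici 0) t :=
    fun t ht j => hasDerivWithinAt_pi.mp (hy t ht).snd.snd j
  have hadj : ∀ j k : Fin N, k.val = j.val + 1 → ∀ t, 0 ≤ t → (y t).1 j < (y t).1 k := by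
    intro j k hjk t ht
    -- The function `q` below is the logarithmic derivative of `exp (2xₖ) - exp (2xⱼ)`; being
    -- continuous in the state, it is bounded on compact time intervals.
    have hjk' : j < k := by rw [Fin.lt_def]; omega
    set q : LogState N → ℝ := fun y => cutoff R y * (2 * Real.exp (2 * y.1 k) *
      (rightMom y.1 y.m k * rightMom y.1 y.n k - leftMom y.1 y.m k * leftMom y.1 y.n k *
        (Real.exp (-(2 * y.1 k)) * Real.exp (-(2 * y.1 j)))) +
      2 * (smoothVal y.1 y.m j * smoothVal y.1 y.n j)) with hq
    have hqc : Continuous q := by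
      have hx := contDiff_fst_logState (N := N)
      have h1 := (contDiff_cutoff (N := N) R).continuous
      have h2 := (contDiff_rightMom hx contDiff_m k).continuous
      have h3 := (contDiff_rightMom hx contDiff_n k).continuous
      have h4 := (contDiff_leftMom hx contDiff_m k).continuous
      have h5 := (contDiff_leftMom hx contDiff_n k).continuous
      have h6 := (contDiff_smoothVal hx contDiff_m j).continuous
      have h7 := (contDiff_smoothVal hx contDiff_n j).continuous
      fun_prop
    have hpos := pos_of_abs_deriv_le
      (f := fun t => Real.exp (2 * (y t).1 k) - Real.exp (2 * (y t).1 j))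
      (f' := fun t => q (y t) * (Real.exp (2 * (y t).1 k) - Real.exp (2 * (y t).1 j)))
      (fun t ht => by
        refine ((((dx t ht k).const_mul 2).exp).sub (((dx t ht j).const_mul 2).exp)).congr_deriv ?_
        have := smoothVal_mul_sub (x := (y t).1) (m := (y t).m) (n := (y t).n) hjk
        simp only [hq]
        linear_combination s t * this)
      (by
        have : x₀ j < x₀ k := hx₀ hjk'
        simp only [hy0, sub_pos, Real.exp_lt_exp]
        linarith)
      (fun T _ => by
        have hc := hqc.comp_continuousOn (hyc.mono (Icc_subset_Ici_self : Icc 0 T ⊆ Ici 0))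
        obtain ⟨K, hK⟩ := isCompact_Icc.exists_bound_of_continuousOn hc
        refine ⟨K, fun t h0 hT => ?_⟩
        rw [abs_mul]
        exact mul_le_mul_of_nonneg_right (hK t ⟨h0, hT⟩) (abs_nonneg _)) t ht
    simp only [sub_pos, Real.exp_lt_exp] at hpos
    linarith
  have hmono : ∀ t, 0 ≤ t → StrictMono (y t).1 := by
    intro t ht
    have h1 : ∀ d : ℕ, ∀ j k : Fin N, k.val = j.val + (d + 1) → (y t).1 j < (y t).1 k := by
      intro d
      induction d with
      | zero => exact fun j k hjk => hadj j k hjk t ht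
      | succ d ih =>
        intro j k hjk
        have := k.2
        exact (ih j ⟨j.val + (d + 1), by omega⟩ rfl).trans (hadj _ k (by simp; omega) t ht)
    intro j k hjk
    exact h1 (k.val - j.val - 1) j k (by rw [Fin.lt_def] at hjk; omega)
  have hflow : IsScaledFlow s (fun t => (y t).1) (fun t => (y t).m) (fun t => (y t).n) := by
    refine ⟨hmono, fun t _ j => Real.exp_pos _, fun t _ j => Real.exp_pos _, fun t ht j => ?_,
      fun t ht j => ?_, fun t ht j => ?_⟩
    · rw [peakVal_eq (hmono t ht), peakVal_eq (hmono t ht)]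
      exact dx t ht j
    · rw [peakSlope_eq (hmono t ht), peakVal_eq (hmono t ht)]
      refine (da t ht j).exp.congr_deriv ?_
      simp only [LogState.m, smoothSlope, smoothVal]
      ring
    · rw [peakSlope_eq (hmono t ht), peakVal_eq (hmono t ht)]
      refine (db t ht j).exp.congr_deriv ?_
      simp only [LogState.n, smoothSlope, smoothVal]
      ring
  have hm0 : (y 0).m = m₀ := by
    ext j; simp [LogState.m, hy0, Real.exp_log (hm₀ j)]
  have hn0 : (y 0).n = n₀ := by
    ext j; simp [LogState.n, hy0, Real.exp_log (hn₀ j)]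
  -- Energy conservation holds for every speed factor. It bounds each component of the uncut field
  -- by `H` along the solution, so the squared norm is at most `R` and the cutoff equals one.
  have hs : ∀ t, 0 ≤ t → s t = 1 := by
    intro t ht
    have hE : energy (y t).1 (y t).m (y t).n = H := by
      have := hflow.energy_eq ht
      simp only [hm0, hn0] at this
      rw [this, hy0]
    refine Real.smoothTransition.one_of_one_le ?_
    have hsq : sqNorm (logField (y t)) ≤ R := by
      refine Finset.sum_le_sum fun j _ => ?_
      have h1 := peakVal_mul_peakVal_le_energy (x := (y t).1) (hflow.m_pos t ht)
        (hflow.n_pos t ht) j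
      rw [hE] at h1
      have hu := abs_peakSlope_le (x := (y t).1) (hflow.m_pos t ht) j
      have hv := abs_peakSlope_le (x := (y t).1) (hflow.n_pos t ht) j
      have hu0 := (abs_nonneg _).trans hu
      have hv0 := (abs_nonneg _).trans hv
      simp only [logField, smoothVal, smoothSlope]
      simp only [← peakVal_eq (hmono t ht), ← peakSlope_eq (hmono t ht)]
      refine add_le_add (add_le_add ?_ ?_) ?_ <;> refine sq_le_sq' ?_ ?_
      · linarith [mul_nonneg hu0 hv0]
      · exact h1
      · have := mul_le_mul_of_nonneg_right (abs_le.mp hu).1 hv0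
        linarith
      · have := mul_le_mul_of_nonneg_right (abs_le.mp hu).2 hv0
        linarith
      · have := mul_le_mul_of_nonneg_right (abs_le.mp hv).1 hu0
        linarith
      · have := mul_le_mul_of_nonneg_right (abs_le.mp hv).2 hu0
        linarith
    linarith
  exact ⟨_, _, _, hflow.isPeakonFlow hs, by simp [hy0], hm0, hn0⟩

end Existence


/-! ### Distributional derivatives -/

section Distributions

variable {F : Type*} [NormedAddCommGroup F] [NormedSpace ℝ F]

theorem integrable_smul_of_hasCompactSupport {f : ℝ → F} (hf : LocallyIntegrable f volume)
    {η : ℝ → ℝ} (hη : Continuous η) (hc : HasCompactSupport η) :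
    Integrable (fun y => η y • f y) volume :=
  hf.integrable_smul_left_of_hasCompactSupport hη hc

/-- A smooth compactly supported function with vanishing integral has a compactly supported
primitive. -/
theorem exists_primitive_hasCompactSupport {k : ℝ → ℝ} (hk : ContDiff ℝ ∞ k)
    (hc : HasCompactSupport k) (h0 : ∫ y, k y = 0) :
    ∃ η : ℝ → ℝ, ContDiff ℝ ∞ η ∧ HasCompactSupport η ∧ deriv η = k := by
  obtain ⟨R, hR⟩ := hc.isCompact.isBounded.subset_closedBall 0
  have hz : ∀ y, R < |y| → k y = 0 := fun y hy => by
    by_contra hne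
    have := hR (subset_tsupport k hne)
    rw [mem_closedBall_zero_iff, Real.norm_eq_abs] at this
    linarith
  have hd : ∀ y, HasDerivAt (fun y => ∫ s in (-(|R| + 1))..y, k s) (k y) y := fun y =>
    (hk.continuous.integral_hasStrictDerivAt _ y).hasDerivAt
  have hderiv : deriv (fun y => ∫ s in (-(|R| + 1))..y, k s) = k := funext fun y => (hd y).deriv
  refine ⟨_, contDiff_infty_iff_deriv.mpr ⟨fun y => (hd y).differentiableAt, by rwa [hderiv]⟩, ?_,
    hderiv⟩
  refine HasCompactSupport.of_support_subset_isCompact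
    (isCompact_Icc (a := -(|R| + 1)) (b := |R| + 1)) fun y hy => ?_
  have hRR := le_abs_self R
  by_contra hmem
  change (∫ s in (-(|R| + 1))..y, k s) ≠ 0 at hy
  rw [mem_Icc, not_and_or, not_le, not_le] at hmem
  refine hy ?_
  rcases hmem with h | h
  · refine intervalIntegral.integral_zero_ae (ae_of_all _ fun s hs => ?_)
    rw [uIoc_of_ge h.le] at hs
    refine hz s ?_
    have := neg_le_abs s
    linarith [hs.2]
  · rw [intervalIntegral.integral_eq_integral_of_support_subset, h0]
    intro s hs
    have hs' : |s| ≤ R := not_lt.mp fun hlt => hs (hz s hlt)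
    rw [abs_le] at hs'
    constructor <;> linarith

/-- A locally integrable function with vanishing distributional derivative is constant. -/
theorem ae_eq_const_of_integral_deriv_smul [CompleteSpace F] {f : ℝ → F}
    (hf : LocallyIntegrable f volume)
    (h : ∀ η : ℝ → ℝ, ContDiff ℝ ∞ η → HasCompactSupport η → ∫ y, deriv η y • f y = 0) :
    ∃ C : F, f =ᵐ[volume] fun _ => C := by
  let ρ : ContDiffBump (0 : ℝ) := ⟨1, 2, one_pos, one_lt_two⟩
  have hρ1 : ContDiff ℝ ∞ (ρ.normed volume) := ρ.contDiff_normed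
  have hρ2 : HasCompactSupport (ρ.normed volume) := ρ.hasCompactSupport_normed
  have hρ3 : ∫ y, ρ.normed volume y = 1 := ρ.integral_normed
  refine ⟨∫ y, ρ.normed volume y • f y, ?_⟩
  set C := ∫ y, ρ.normed volume y • f y
  have hLI : LocallyIntegrable (fun y => f y - C) volume := hf.sub (locallyIntegrable_const C)
  refine (ae_eq_zero_of_integral_contDiff_smul_eq_zero hLI fun g hg hgc => ?_).mono
    fun y hy => sub_eq_zero.mp hy
  have hgi : Integrable g volume := hg.continuous.integrable_of_hasCompactSupport hgc
  have hρi : Integrable (ρ.normed volume) volume :=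
    hρ1.continuous.integrable_of_hasCompactSupport hρ2
  -- Subtracting a multiple of the normalized bump makes the integral of `g` vanish, so the
  -- difference is the derivative of a test function.
  obtain ⟨η, hη, hηc, hd⟩ := exists_primitive_hasCompactSupport
    (k := fun y => g y - (∫ s, g s) * ρ.normed volume y)
    (hg.sub (contDiff_const.mul hρ1)) (hgc.sub hρ2.mul_left) (by
      rw [integral_sub hgi (hρi.const_mul _), integral_const_mul, hρ3, mul_one, sub_self])
  have := h η hη hηc
  rw [hd] at this
  have i1 := integrable_smul_of_hasCompactSupport hf hg.continuous hgc
  have i2 := integrable_smul_of_hasCompactSupport hf hρ1.continuous hρ2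
  have e : ∀ y, (g y - (∫ s, g s) * ρ.normed volume y) • f y =
      g y • f y - (∫ s, g s) • (ρ.normed volume y • f y) := fun y => by
    rw [sub_smul, mul_smul]
  simp_rw [e] at this
  rw [integral_sub i1 (i2.fun_smul _), integral_smul] at this
  simp_rw [smul_sub]
  rw [integral_sub i1 (hgi.smul_const C), integral_smul_const]
  exact this

theorem HasDistribDeriv.sub {N : ℕ} {f₁ f₂ h₁ h₂ : ℝ → F} {x : Fin N → ℝ} {c₁ c₂ : Fin N → F}
    (H₁ : HasDistribDeriv f₁ h₁ x c₁) (H₂ : HasDistribDeriv f₂ h₂ x c₂) :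
    HasDistribDeriv (fun y => f₁ y - f₂ y) (fun y => h₁ y - h₂ y) x (fun k => c₁ k - c₂ k) := by
  refine ⟨H₁.locallyIntegrable.sub H₂.locallyIntegrable,
    H₁.locallyIntegrable_deriv.sub H₂.locallyIntegrable_deriv, fun η hη hc => ?_⟩
  have hd : Continuous (deriv η) := hη.continuous_deriv (by simp)
  simp_rw [smul_sub]
  rw [integral_sub (integrable_smul_of_hasCompactSupport H₁.locallyIntegrable hd hc.deriv)
      (integrable_smul_of_hasCompactSupport H₂.locallyIntegrable hd hc.deriv),
    integral_sub
      (integrable_smul_of_hasCompactSupport H₁.locallyIntegrable_deriv hη.continuous hc)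
      (integrable_smul_of_hasCompactSupport H₂.locallyIntegrable_deriv hη.continuous hc),
    Finset.sum_sub_distrib]
  have e₁ := H₁.integral_eq η hη hc
  have e₂ := H₂.integral_eq η hη hc
  rw [neg_sub', e₁, e₂]
  abel

theorem HasDistribDeriv.sum {N : ℕ} {f h : Fin N → ℝ → F} {x : Fin N → ℝ} {c : Fin N → F}
    (H : ∀ k, HasDistribDeriv (f k) (h k) (fun _ : Fin 1 => x k) (fun _ => c k)) :
    HasDistribDeriv (fun y => ∑ k, f k y) (fun y => ∑ k, h k y) x c := by
  refine ⟨locallyIntegrable_finsetSum _ fun k _ => (H k).locallyIntegrable,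
    locallyIntegrable_finsetSum _ fun k _ => (H k).locallyIntegrable_deriv, fun η hη hc => ?_⟩
  have hd : Continuous (deriv η) := hη.continuous_deriv (by simp)
  simp_rw [Finset.smul_sum]
  rw [integral_finsetSum _ fun k _ =>
      integrable_smul_of_hasCompactSupport (H k).locallyIntegrable hd hc.deriv,
    integral_finsetSum _ fun k _ =>
      integrable_smul_of_hasCompactSupport (H k).locallyIntegrable_deriv hη.continuous hc,
    ← Finset.sum_add_distrib, ← Finset.sum_neg_distrib]
  refine Finset.sum_congr rfl fun k _ => ?_
  simpa using (H k).integral_eq η hη hc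

theorem locallyIntegrable_ite {E : Type*} [NormedAddCommGroup E] {fl fr : ℝ → E}
    (hl : Continuous fl) (hr : Continuous fr) (a : ℝ) :
    LocallyIntegrable (fun y => if a < y then fr y else fl y) volume := by
  have e : (fun y => if a < y then fr y else fl y) =
      fun y => (Ioi a).indicator fr y + (Iic a).indicator fl y := by
    ext y
    by_cases h : a < y
    · simp [h]
    · simp [h, not_lt.mp h]
  rw [e]
  exact (hr.locallyIntegrable.indicator measurableSet_Ioi).add
    (hl.locallyIntegrable.indicator measurableSet_Iic)

theorem integral_ite {fl fr : ℝ → F} {a : ℝ}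
    (hi : Integrable (fun y => if a < y then fr y else fl y) volume) :
    ∫ y, (if a < y then fr y else fl y) = (∫ y in Iic a, fl y) + ∫ y in Ioi a, fr y := by
  rw [← integral_add_compl measurableSet_Iic hi, compl_Iic]
  congr 1
  · exact setIntegral_congr_fun measurableSet_Iic fun y hy => if_neg (not_lt.mpr hy)
  · exact setIntegral_congr_fun measurableSet_Ioi fun y hy => if_pos hy

/-- The distributional derivative of a piecewise `C¹` function with one jump. -/
theorem hasDistribDeriv_ite [CompleteSpace F] {fl fr fl' fr' : ℝ → F}
    (hl : ∀ y, HasDerivAt fl (fl' y) y)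
    (hr : ∀ y, HasDerivAt fr (fr' y) y) (hl' : Continuous fl') (hr' : Continuous fr') (a : ℝ)
    {c : F} (hc : fr a - fl a = c) :
    HasDistribDeriv (fun y => if a < y then fr y else fl y)
      (fun y => if a < y then fr' y else fl' y) (fun _ : Fin 1 => a) (fun _ => c) := by
  have cl : Continuous fl := continuous_iff_continuousAt.mpr fun y => (hl y).continuousAt
  have cr : Continuous fr := continuous_iff_continuousAt.mpr fun y => (hr y).continuousAt
  have I₁ := locallyIntegrable_ite cl cr a
  have I₂ := locallyIntegrable_ite hl' hr' a
  refine ⟨I₁, I₂, fun η hη hcs => ?_⟩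
  have hd : Continuous (deriv η) := hη.continuous_deriv (by simp)
  have key : ∀ {g g' : ℝ → F}, (∀ y, HasDerivAt g (g' y) y) → Continuous g' →
      Integrable (fun y => deriv η y • g y) volume ∧ Integrable (fun y => η y • g' y) volume ∧
      ContDiff ℝ 1 (fun y => η y • g y) ∧ HasCompactSupport (fun y => η y • g y) ∧
      ∀ y, deriv (fun y => η y • g y) y = η y • g' y + deriv η y • g y := by
    intro g g' hg hg'
    have cg : Continuous g := continuous_iff_continuousAt.mpr fun y => (hg y).continuousAt
    have hg1 : ContDiff ℝ 1 g := by
      rw [contDiff_one_iff_deriv]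
      exact ⟨fun y => (hg y).differentiableAt, by rwa [funext fun y => (hg y).deriv]⟩
    refine ⟨integrable_smul_of_hasCompactSupport cg.locallyIntegrable hd hcs.deriv,
      integrable_smul_of_hasCompactSupport hg'.locallyIntegrable hη.continuous hcs,
      (hη.of_le (by simp)).smul hg1, hcs.smul_right, fun y => ?_⟩
    exact (((hη.differentiable (by simp)) y).hasDerivAt.smul (hg y)).deriv
  obtain ⟨l1, l2, l3, l4, l5⟩ := key hl hl'
  obtain ⟨r1, r2, r3, r4, r5⟩ := key hr hr'
  have hL := l4.integral_Iic_deriv_eq l3 a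
  have hR := r4.integral_Ioi_deriv_eq r3 a
  simp_rw [l5] at hL
  simp_rw [r5] at hR
  rw [integral_add l2.integrableOn l1.integrableOn] at hL
  rw [integral_add r2.integrableOn r1.integrableOn] at hR
  have J₁ := integrable_smul_of_hasCompactSupport I₁ hd hcs.deriv
  have J₂ := integrable_smul_of_hasCompactSupport I₂ hη.continuous hcs
  simp_rw [smul_ite] at J₁ J₂ ⊢
  rw [integral_ite J₁, integral_ite J₂, Finset.univ_unique, Finset.sum_singleton, ← hc, smul_sub,
    ← sub_eq_zero]
  rw [← sub_eq_zero] at hL hR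
  have := congrArg₂ (· + ·) hL hR
  simp only [add_zero] at this
  rw [← neg_eq_zero, ← this]
  abel

end Distributions

/-- Integrating factor: testing with `η exp (-sy)` shows that `exp (-sy) f` has zero distributional
derivative. -/
theorem HasDistribDeriv.ae_eq_exp_smul {N : ℕ} {F : Type*} [NormedAddCommGroup F]
    [NormedSpace ℝ F] [CompleteSpace F] {f h : ℝ → F} {x : Fin N → ℝ} {s : ℝ}
    (H : HasDistribDeriv f h x 0) (hf : ∀ y, h y = s • f y) :
    ∃ C : F, f =ᵐ[volume] fun y => Real.exp (s * y) • C := by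
  have hexp : ContDiff ℝ ∞ fun y : ℝ => Real.exp (-(s * y)) := by fun_prop
  have hLI : LocallyIntegrable (fun y => Real.exp (-(s * y)) • f y) volume := by
    rw [← locallyIntegrableOn_univ]
    exact (locallyIntegrableOn_univ.mpr H.locallyIntegrable).continuousOn_smul
      isOpen_univ.isLocallyClosed hexp.continuous.continuousOn
  obtain ⟨C, hC⟩ := ae_eq_const_of_integral_deriv_smul hLI fun η hη hc => by
    have hd : Continuous (deriv η) := hη.continuous_deriv (by simp)
    have hder : deriv (fun y => η y * Real.exp (-(s * y))) =
        fun y => deriv η y * Real.exp (-(s * y)) - s * (η y * Real.exp (-(s * y))) := by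
      ext y
      have h1 := ((hη.differentiable (by simp)) y).hasDerivAt
      have h2 : HasDerivAt (fun y => Real.exp (-(s * y))) (Real.exp (-(s * y)) * -s) y := by
        simpa using (((hasDerivAt_id y).const_mul s).fun_neg).exp
      rw [(h1.fun_mul h2).deriv]
      ring
    have e := H.integral_eq _ (hη.mul hexp) hc.mul_right
    simp only [Pi.zero_apply, smul_zero, Finset.sum_const_zero, add_zero, hf] at e
    have i1 := integrable_smul_of_hasCompactSupport (η := fun y => deriv η y * Real.exp (-(s * y)))
      H.locallyIntegrable
      (hd.mul hexp.continuous) hc.deriv.mul_right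
    have i2 := integrable_smul_of_hasCompactSupport (η := fun y => η y * Real.exp (-(s * y)))
      H.locallyIntegrable (hη.continuous.mul hexp.continuous) hc.mul_right
    change -∫ y, deriv (fun y => η y * Real.exp (-(s * y))) y • f y = _ at e
    rw [hder] at e
    simp only [sub_smul, mul_smul s] at e
    simp_rw [smul_comm _ s] at e
    rw [integral_sub i1 (i2.fun_smul s), integral_smul, neg_sub, sub_eq_self] at e
    simpa only [smul_smul] using e
  refine ⟨C, hC.mono fun y hy => ?_⟩
  simp only at hy ⊢
  rw [← hy, smul_smul, ← Real.exp_add]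
  simp

/-! ### Limits along sets of full measure -/

/-- Used to identify the limits of functions that agree only almost everywhere. -/
theorem inf_ae_neBot {l : Filter ℝ} (h : ∀ s ∈ l, volume s ≠ 0) : (l ⊓ ae volume).NeBot := by
  refine inf_neBot_iff.mpr fun {s} hs {t} ht => ?_
  by_contra hne
  rw [not_nonempty_iff_eq_empty, ← disjoint_iff_inter_eq_empty] at hne
  exact h s hs (measure_mono_null hne.subset_compl_right (mem_ae_iff.mp ht))

theorem nhdsLT_inf_ae_neBot (a : ℝ) : (𝓝[<] a ⊓ ae volume).NeBot := by
  refine inf_ae_neBot fun s hs h0 => ?_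
  obtain ⟨b, hb, hbs⟩ := (mem_nhdsLT_iff_exists_Ioo_subset).mp hs
  have := measure_mono_null hbs h0
  rw [Real.volume_Ioo, ENNReal.ofReal_eq_zero] at this
  have hb' : b < a := hb
  linarith

theorem nhdsGT_inf_ae_neBot (a : ℝ) : (𝓝[>] a ⊓ ae volume).NeBot := by
  refine inf_ae_neBot fun s hs h0 => ?_
  obtain ⟨b, hb, hbs⟩ := (mem_nhdsGT_iff_exists_Ioo_subset).mp hs
  have := measure_mono_null hbs h0
  rw [Real.volume_Ioo, ENNReal.ofReal_eq_zero] at this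
  have hb' : a < b := hb
  linarith

theorem atBot_inf_ae_neBot : ((atBot : Filter ℝ) ⊓ ae volume).NeBot := by
  refine inf_ae_neBot fun s hs h0 => ?_
  obtain ⟨b, hb⟩ := mem_atBot_sets.mp hs
  have := measure_mono_null (show Iic b ⊆ s from hb) h0
  simp at this

theorem eq_of_tendsto_of_ae_eq {E : Type*} [TopologicalSpace E] [T2Space E] {f g : ℝ → E}
    {l : Filter ℝ} (hl : (l ⊓ ae volume).NeBot) (hfg : f =ᵐ[volume] g) {a b : E}
    (ha : Tendsto f l (𝓝 a)) (hb : Tendsto g l (𝓝 b)) : a = b :=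
  tendsto_nhds_unique ((ha.mono_left inf_le_left).congr' (hfg.filter_mono inf_le_right))
    (hb.mono_left inf_le_left)

/-- A function of locally bounded variation has the same mean of one-sided limits as any almost
everywhere equal function with one-sided limits. -/
theorem avg_eq_of_ae_eq {F : Type*} [NormedAddCommGroup F] [NormedSpace ℝ F] [CompleteSpace F]
    {f g : ℝ → F} (hf : LocallyBoundedVariationOn f univ) (hfg : f =ᵐ[volume] g) {a : ℝ} {l r : F}
    (hl : Tendsto g (𝓝[<] a) (𝓝 l)) (hr : Tendsto g (𝓝[>] a) (𝓝 r)) :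
    avg f a = (1 / 2 : ℝ) • (l + r) := by
  -- Bounded variation supplies the one-sided limits; without them `leftLim` and `rightLim` would
  -- return the default value `f a`.
  have hbv := hf (a - 1) (a + 1) trivial trivial
  rw [univ_inter] at hbv
  obtain ⟨l', hl'⟩ := hbv.exists_tendsto_left a
  obtain ⟨r', hr'⟩ := hbv.exists_tendsto_right a
  have hN : Icc (a - 1) (a + 1) ∈ 𝓝 a := Icc_mem_nhds (by linarith) (by linarith)
  rw [nhdsWithin_inter_of_mem (mem_nhdsWithin_of_mem_nhds hN)] at hl' hr'
  have e1 := eq_of_tendsto_of_ae_eq (nhdsLT_inf_ae_neBot a) hfg hl' hl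
  have e2 := eq_of_tendsto_of_ae_eq (nhdsGT_inf_ae_neBot a) hfg hr' hr
  rw [avg, leftLim_eq_of_tendsto hl', rightLim_eq_of_tendsto hr', e1, e2]

/-! ### Functions of bounded variation -/

theorem LocallyBoundedVariationOn.fun_add {F : Type*} [NormedAddCommGroup F] {f g : ℝ → F}
    {s : Set ℝ} (hf : LocallyBoundedVariationOn f s) (hg : LocallyBoundedVariationOn g s) :
    LocallyBoundedVariationOn (fun y => f y + g y) s := by
  intro a b ha hb
  refine ne_top_of_le_ne_top (ENNReal.add_ne_top.mpr ⟨hf a b ha hb, hg a b ha hb⟩) ?_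
  refine iSup_le fun ⟨n, u, hu, us⟩ => ?_
  refine (Finset.sum_le_sum fun i _ => edist_add_add_le _ _ _ _).trans ?_
  rw [Finset.sum_add_distrib]
  exact add_le_add (eVariationOn.sum_le hu us) (eVariationOn.sum_le hu us)

theorem locallyBoundedVariationOn_sum {F ι : Type*} [NormedAddCommGroup F] {f : ι → ℝ → F}
    {s : Set ℝ} (S : Finset ι) (hf : ∀ k ∈ S, LocallyBoundedVariationOn (f k) s) :
    LocallyBoundedVariationOn (fun y => ∑ k ∈ S, f k y) s := by
  classical
  induction S using Finset.induction_on with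
  | empty =>
    simpa using (LipschitzWith.const (0 : F)).locallyBoundedVariationOn (s := s)
  | insert k S hk ih =>
    simp only [Finset.sum_insert hk]
    exact LocallyBoundedVariationOn.fun_add (hf k (Finset.mem_insert_self k S))
      (ih fun i hi => hf i (Finset.mem_insert_of_mem hi))

/-! ### Step functions -/

/-- The step function with jumps `w k` at `x k` that vanishes near `-∞`. -/
def stepFun {N : ℕ} {F : Type*} [AddCommMonoid F] (x : Fin N → ℝ) (w : Fin N → F) (y : ℝ) : F :=
  ∑ k, if x k < y then w k else 0

section StepFun

variable {N : ℕ} {F : Type*} [NormedAddCommGroup F] (x : Fin N → ℝ)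
  (w : Fin N → F)

theorem hasDistribDeriv_stepFun [NormedSpace ℝ F] [CompleteSpace F] :
    HasDistribDeriv (stepFun x w) 0 x w := by
  have := HasDistribDeriv.sum (x := x) (c := w) fun k =>
    hasDistribDeriv_ite (fl := fun _ => (0 : F)) (fr := fun _ => w k) (fun y => hasDerivAt_const y _)
      (fun y => hasDerivAt_const y _) continuous_const continuous_const (x k) (sub_zero (w k))
  simp only [ite_self, Finset.sum_const_zero] at this
  exact this

theorem locallyBoundedVariationOn_stepFun [NormedSpace ℝ F] :
    LocallyBoundedVariationOn (stepFun x w) univ := by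
  refine locallyBoundedVariationOn_sum _ fun k _ => ?_
  have hmono : Monotone fun y : ℝ => if x k < y then (1 : ℝ) else 0 := by
    intro a b hab
    dsimp only
    split_ifs with h1 h2
    · exact le_rfl
    · exact absurd (h1.trans_le hab) h2
    · exact zero_le_one
    · exact le_rfl
  have e : (fun y => if x k < y then w k else 0) =
      ContinuousLinearMap.toSpanSingleton ℝ (w k) ∘ fun y => if x k < y then (1 : ℝ) else 0 := by
    ext y
    by_cases h : x k < y <;> simp [h]
  rw [e]
  exact ((ContinuousLinearMap.toSpanSingleton ℝ (w k)).lipschitz).comp_locallyBoundedVariationOn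
    (hmono.monotoneOn univ).locallyBoundedVariationOn

theorem tendsto_stepFun_atBot : Tendsto (stepFun x w) atBot (𝓝 0) := by
  have : ∀ k, ∀ᶠ y : ℝ in atBot, y ≤ x k := fun k => eventually_le_atBot (x k)
  refine tendsto_const_nhds.congr' ?_
  filter_upwards [eventually_all.mpr this] with y hy
  exact (Finset.sum_eq_zero fun k _ => if_neg (not_lt.mpr (hy k))).symm

theorem tendsto_stepFun_nhdsLT (a : ℝ) :
    Tendsto (stepFun x w) (𝓝[<] a) (𝓝 (∑ k, if x k < a then w k else 0)) := by
  refine tendsto_finsetSum _ fun k _ => tendsto_const_nhds.congr' ?_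
  by_cases h : x k < a
  · filter_upwards [mem_nhdsWithin_of_mem_nhds (Ioi_mem_nhds h)] with y hy
    have hy' : x k < y := hy
    simp [h, hy']
  · filter_upwards [self_mem_nhdsWithin] with y hy
    have hy' : ¬ x k < y := not_lt.mpr ((le_of_lt hy).trans (not_lt.mp h))
    simp [h, hy']

theorem tendsto_stepFun_nhdsGT (a : ℝ) :
    Tendsto (stepFun x w) (𝓝[>] a) (𝓝 (∑ k, if x k ≤ a then w k else 0)) := by
  refine tendsto_finsetSum _ fun k _ => tendsto_const_nhds.congr' ?_
  by_cases h : x k ≤ a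
  · filter_upwards [self_mem_nhdsWithin] with y hy
    have hy' : x k < y := h.trans_lt hy
    simp [h, hy']
  · filter_upwards [mem_nhdsWithin_of_mem_nhds (Iio_mem_nhds (not_le.mp h))] with y hy
    have hy' : ¬ x k < y := not_lt.mpr (le_of_lt hy)
    simp [h, hy']

/-- The one-sided limits are the partial sums without and with the jump at `xⱼ`. The mean depends
only on the almost-everywhere class, so it applies to any solution of bounded variation. -/
theorem avg_eq_of_ae_eq_stepFun [NormedSpace ℝ F] [CompleteSpace F] {x : Fin N → ℝ}
    (hx : StrictMono x) {w : Fin N → F} {f : ℝ → F} (hf : LocallyBoundedVariationOn f univ)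
    (h : f =ᵐ[volume] stepFun x w) (j : Fin N) :
    avg f (x j) = psum w j + (1 / 2 : ℝ) • w j := by
  rw [avg_eq_of_ae_eq hf h (tendsto_stepFun_nhdsLT x w (x j)) (tendsto_stepFun_nhdsGT x w (x j))]
  have e1 : (∑ k, if x k < x j then w k else 0) = psum w j := by
    simp only [hx.lt_iff_lt, Fin.lt_def, psum]
  have e2 : (∑ k, if x k ≤ x j then w k else 0) = psum w (j + 1) := by
    simp only [hx.le_iff_le, Fin.le_def, psum, Nat.lt_succ_iff]
  rw [e1, e2, psum_succ, ← add_assoc, ← two_smul ℝ (psum w j), smul_add, smul_smul]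
  norm_num

end StepFun

/-! ### Peakon functions -/

/-- The derivative of `exp (-|y - a|)` away from `a`. -/
def slopeFun (a y : ℝ) : ℝ := if a < y then -Real.exp (a - y) else Real.exp (y - a)

section PeakonFunctions

variable {N : ℕ} {F : Type*} [NormedAddCommGroup F] [NormedSpace ℝ F]

theorem exp_neg_abs_sub_eq_ite (a y : ℝ) :
    Real.exp (-|y - a|) = if a < y then Real.exp (a - y) else Real.exp (y - a) := by
  split_ifs with h
  · rw [abs_of_pos (sub_pos.mpr h), neg_sub]
  · rw [abs_of_nonpos (by linarith), neg_neg]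

theorem hasDerivAt_exp_sub_smul (a : ℝ) (w : F) (y : ℝ) :
    HasDerivAt (fun y => Real.exp (y - a) • w) (Real.exp (y - a) • w) y := by
  have := (((hasDerivAt_id y).sub_const a).exp).smul_const w
  simpa using this

theorem hasDerivAt_exp_sub_smul' (a : ℝ) (w : F) (y : ℝ) :
    HasDerivAt (fun y => Real.exp (a - y) • w) ((-Real.exp (a - y)) • w) y := by
  have := (((hasDerivAt_id y).const_sub a).exp).smul_const w
  simpa using this

theorem hasDistribDeriv_exp_neg_abs_smul [CompleteSpace F] (x : Fin N → ℝ) (w : Fin N → F) :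
    HasDistribDeriv (fun y => ∑ k, Real.exp (-|y - x k|) • w k)
      (fun y => ∑ k, slopeFun (x k) y • w k) x 0 := by
  refine HasDistribDeriv.sum fun k => ?_
  have := hasDistribDeriv_ite (hasDerivAt_exp_sub_smul (x k) (w k))
    (hasDerivAt_exp_sub_smul' (x k) (w k)) (by fun_prop) (by fun_prop) (x k)
    (c := 0) (by simp)
  simpa only [exp_neg_abs_sub_eq_ite, slopeFun, ite_smul, Pi.zero_apply] using this

theorem hasDistribDeriv_slopeFun_smul [CompleteSpace F] (x : Fin N → ℝ) (w : Fin N → F) :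
    HasDistribDeriv (fun y => ∑ k, slopeFun (x k) y • w k)
      (fun y => ∑ k, Real.exp (-|y - x k|) • w k) x (fun k => (-2 : ℝ) • w k) := by
  refine HasDistribDeriv.sum fun k => ?_
  have := hasDistribDeriv_ite (hasDerivAt_exp_sub_smul (x k) (w k))
    (fun y => (hasDerivAt_exp_sub_smul' (x k) (w k) y).fun_neg) (by fun_prop) (by fun_prop) (x k)
    (c := (-2 : ℝ) • w k) (by
      simp only [sub_self, Real.exp_zero, one_smul, neg_smul, two_smul]
      abel)
  simpa only [exp_neg_abs_sub_eq_ite, slopeFun, ite_smul, neg_smul, neg_neg] using this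

theorem tendsto_exp_neg_abs_smul_atTop (x : Fin N → ℝ) (w : Fin N → F) :
    Tendsto (fun y => ∑ k, Real.exp (-|y - x k|) • w k) atTop (𝓝 0) := by
  rw [← Finset.sum_const_zero (s := (Finset.univ : Finset (Fin N)))]
  refine tendsto_finsetSum _ fun k _ => ?_
  rw [← zero_smul ℝ (w k)]
  refine Tendsto.smul_const (Real.tendsto_exp_neg_atTop_nhds_zero.comp ?_) _
  exact tendsto_abs_atTop_atTop.comp (tendsto_atTop_add_const_right _ _ tendsto_id)

theorem tendsto_exp_neg_abs_smul_atBot (x : Fin N → ℝ) (w : Fin N → F) :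
    Tendsto (fun y => ∑ k, Real.exp (-|y - x k|) • w k) atBot (𝓝 0) := by
  rw [← Finset.sum_const_zero (s := (Finset.univ : Finset (Fin N)))]
  refine tendsto_finsetSum _ fun k _ => ?_
  rw [← zero_smul ℝ (w k)]
  refine Tendsto.smul_const (Real.tendsto_exp_neg_atTop_nhds_zero.comp ?_) _
  exact tendsto_abs_atBot_atTop.comp (tendsto_atBot_add_const_right _ _ tendsto_id)

/-- The system `χ₁' = χ₃`, `χ₃' = χ₁` has no nonzero solution with `χ₃(±∞) = 0`. -/
theorem ae_eq_zero_of_hasDistribDeriv [CompleteSpace F] {χ₁ χ₃ : ℝ → F} {x : Fin N → ℝ}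
    (h₁ : HasDistribDeriv χ₁ χ₃ x 0) (h₃ : HasDistribDeriv χ₃ χ₁ x 0) (hc : Continuous χ₃)
    (hbot : Tendsto χ₃ atBot (𝓝 0)) (htop : Tendsto χ₃ atTop (𝓝 0)) :
    χ₃ = 0 ∧ χ₁ =ᵐ[volume] 0 := by
  have hneg : HasDistribDeriv (fun y => -χ₁ y) (fun y => -χ₃ y) x 0 := by
    have h0 : HasDistribDeriv (fun _ => (0 : F)) (fun _ => 0) x 0 :=
      ⟨locallyIntegrable_const 0, locallyIntegrable_const 0, by simp⟩
    have h2 := h0.sub h₁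
    simp only [Pi.zero_apply, zero_sub, neg_zero] at h2
    exact h2
  -- The sum `χ₃ + χ₁` and the difference `χ₃ - χ₁` satisfy first-order equations, so they are
  -- multiples of `eʸ` and `e⁻ʸ`. The boundary conditions remove both.
  have hp := h₃.sub hneg
  have hm := h₃.sub h₁
  simp only [Pi.zero_apply, sub_self, sub_neg_eq_add] at hp hm
  obtain ⟨A, hA⟩ := HasDistribDeriv.ae_eq_exp_smul (s := 1) hp (fun y => by rw [one_smul, add_comm])
  obtain ⟨B, hB⟩ := HasDistribDeriv.ae_eq_exp_smul (s := -1) hm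
    (fun y => by rw [neg_one_smul, neg_sub])
  have e : ∀ y, (2 : ℝ) • χ₃ y = Real.exp y • A + Real.exp (-y) • B := by
    have hae : (fun y => (2 : ℝ) • χ₃ y) =ᵐ[volume]
        fun y => Real.exp y • A + Real.exp (-y) • B := by
      filter_upwards [hA, hB] with y h1 h2
      rw [one_mul] at h1
      rw [neg_one_mul] at h2
      rw [← h1, ← h2, two_smul]
      abel
    exact congrFun ((Continuous.ae_eq_iff_eq volume (by fun_prop) (by fun_prop)).mp hae)
  have hA0 : A = 0 := by
    have h1 : Tendsto (fun y => Real.exp (-y) • ((2 : ℝ) • χ₃ y) - (Real.exp (-y) *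
        Real.exp (-y)) • B) atTop (𝓝 ((0 : ℝ) • ((2 : ℝ) • (0 : F)) - ((0 : ℝ) * 0) • B)) :=
      (Real.tendsto_exp_neg_atTop_nhds_zero.smul (htop.const_smul _)).sub
        ((Real.tendsto_exp_neg_atTop_nhds_zero.mul
          Real.tendsto_exp_neg_atTop_nhds_zero).smul_const B)
    refine tendsto_nhds_unique (tendsto_const_nhds.congr fun y => ?_) (by simpa using h1)
    rw [e, smul_add, smul_smul, smul_smul, ← Real.exp_add, neg_add_cancel, Real.exp_zero, one_smul,
      add_sub_cancel_right]
  have hB0 : B = 0 := by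
    have h1 : Tendsto (fun y => Real.exp y • ((2 : ℝ) • χ₃ y)) atBot
        (𝓝 ((0 : ℝ) • ((2 : ℝ) • (0 : F)))) :=
      Real.tendsto_exp_atBot.smul (hbot.const_smul _)
    refine tendsto_nhds_unique (tendsto_const_nhds.congr fun y => ?_) (by simpa using h1)
    rw [e, hA0, smul_zero, zero_add, smul_smul, ← Real.exp_add, add_neg_cancel, Real.exp_zero,
      one_smul]
  have h3 : χ₃ = 0 := by
    ext y
    have := e y
    rw [hA0, hB0, smul_zero, smul_zero, add_zero] at this
    exact (smul_eq_zero.mp this).resolve_left two_ne_zero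
  refine ⟨h3, ?_⟩
  filter_upwards [hA] with y hy
  simpa [h3, hA0] using hy

end PeakonFunctions

/-! ### The boundary value problem -/

section BoundaryValueProblem

variable {N : ℕ} {x m n : Fin N → ℝ}

/-- The jumps of the first component, in terms of the values of the third component. -/
theorem two_mul_pairing_massC (z : ℂ) (φ : Fin N → ℂ) (j : Fin N) :
    z * (2 * pairing (massC m n j) (psum (fun k => (z * 2 * φ k) • massC m n k) j +
      (1 / 2 : ℝ) • ((z * 2 * φ j) • massC m n j))) =
    2 * z ^ 2 * ((matG m n).map Complex.ofReal).mulVec φ j := by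
  have e0 : psum (fun k => (z * 2 * φ k) • massC m n k) j 0 =
      2 * z * psum (fun k => (m k : ℂ) * φ k) j := by
    simp only [psum, Finset.sum_apply, Finset.mul_sum]
    refine Finset.sum_congr rfl fun k _ => ?_
    split_ifs <;> simp [massC, mass]
    ring
  have e1 : psum (fun k => (z * 2 * φ k) • massC m n k) j 1 =
      2 * z * psum (fun k => (n k : ℂ) * φ k) j := by
    simp only [psum, Finset.sum_apply, Finset.mul_sum]
    refine Finset.sum_congr rfl fun k _ => ?_
    split_ifs <;> simp [massC, mass]
    ring
  rw [matG_mulVec]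
  simp only [pairing, dual, dotProduct, Fin.sum_univ_two, Pi.add_apply, e0, e1, Pi.smul_apply]
  simp [massC, mass]
  ring

theorem sum_exp_neg_abs_smul_matG (z : ℂ) (φ : Fin N → ℂ) (j : Fin N) :
    ∑ k, Real.exp (-|x j - x k|) • (-(z ^ 2 * ((matG m n).map Complex.ofReal).mulVec φ k)) =
      ((-z ^ 2) • (redMatrixC x m n).mulVec φ) j := by
  have : redMatrixC x m n = (matE x).map Complex.ofReal * (matG m n).map Complex.ofReal := by
    unfold redMatrixC redMatrix
    exact Matrix.map_mul (f := Complex.ofRealHom)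
  rw [this, ← Matrix.mulVec_mulVec, Pi.smul_apply, Matrix.mulVec, dotProduct, Finset.smul_sum]
  refine Finset.sum_congr rfl fun k _ => ?_
  simp only [Matrix.map_apply, matE, Matrix.of_apply, Complex.real_smul, smul_eq_mul]
  ring

/-- The solution is explicit: `φ₃` superposes peakons with weights `-z² (Gφ)ₖ`, whose slopes jump by
`2z² (Gφ)ₖ` as required, and `φ₂` is a step function. The eigenvalue equation says exactly that `φ₃`
takes the values `φ` at the peaks. -/
theorem isBVPEigenvalue_of_eq_smul_mulVec (hx : StrictMono x) {z : ℂ} {φ : Fin N → ℂ}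
    (h0 : φ ≠ 0) (h : φ = (-z ^ 2) • (redMatrixC x m n).mulVec φ) : IsBVPEigenvalue x m n z := by
  set g : Fin N → ℂ := ((matG m n).map Complex.ofReal).mulVec φ with hg
  set w : Fin N → Fin 2 → ℂ := fun k => (z * 2 * φ k) • massC m n k with hw
  have hval : ∀ j, ∑ k, Real.exp (-|x j - x k|) • (-(z ^ 2 * g k)) = φ j := fun j =>
    (sum_exp_neg_abs_smul_matG z φ j).trans (congrFun h j).symm
  have hcont : Continuous fun y => ∑ k, Real.exp (-|y - x k|) • (-(z ^ 2 * g k)) := by fun_prop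
  refine ⟨fun y => ∑ k, slopeFun (x k) y • (-(z ^ 2 * g k)), stepFun x w,
    fun y => ∑ k, Real.exp (-|y - x k|) • (-(z ^ 2 * g k)), ?_, ?_⟩
  · refine ⟨locallyBoundedVariationOn_stepFun x w, hcont, ?_, ?_,
      hasDistribDeriv_exp_neg_abs_smul x _, tendsto_exp_neg_abs_smul_atBot x _,
      tendsto_stepFun_atBot x w, tendsto_exp_neg_abs_smul_atTop x _⟩
    · convert hasDistribDeriv_slopeFun_smul x (fun k => -(z ^ 2 * g k)) using 2 with k
      rw [avg_eq_of_ae_eq_stepFun hx (locallyBoundedVariationOn_stepFun x w) (ae_eq_refl _),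
        two_mul_pairing_massC, Complex.real_smul]
      push_cast
      ring
    · simp only [hval]
      exact hasDistribDeriv_stepFun x w
  · rintro ⟨-, -, h3⟩
    refine h0 (funext fun j => ?_)
    rw [← hval j]
    exact congrFun ((Continuous.ae_eq_iff_eq volume hcont continuous_const).mp h3) (x j)

/-- The difference has zero derivative, hence is constant almost everywhere, and the condition at
`-∞` makes the constant zero. -/
theorem IsBVPSolution.ae_eq_stepFun {z : ℂ} {φ₁ : ℝ → ℂ} {φ₂ : ℝ → Fin 2 → ℂ} {φ₃ : ℝ → ℂ}
    (h : IsBVPSolution x m n z φ₁ φ₂ φ₃) :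
    φ₂ =ᵐ[volume] stepFun x (fun k => (z * 2 * φ₃ (x k)) • massC m n k) := by
  set w : Fin N → Fin 2 → ℂ := fun k => (z * 2 * φ₃ (x k)) • massC m n k
  have hd := h.eq₂.sub (hasDistribDeriv_stepFun x w)
  obtain ⟨C, hC⟩ := ae_eq_const_of_integral_deriv_smul hd.locallyIntegrable fun η hη hc => by
    simpa [w] using hd.integral_eq η hη hc
  have h0 : (0 : Fin 2 → ℂ) = C := by
    have hlim := h.left₂.sub (tendsto_stepFun_atBot x w)
    rw [sub_zero] at hlim
    exact eq_of_tendsto_of_ae_eq atBot_inf_ae_neBot hC hlim tendsto_const_nhds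
  filter_upwards [hC] with y hy
  exact sub_eq_zero.mp (hy.trans h0.symm)

/-- Subtracting the superposition of peakons with the same jumps leaves a solution of the free
system that decays at both ends, which vanishes. Evaluation at the peaks gives the matrix equation.
If all peak values were zero, the whole solution would vanish almost everywhere. -/
theorem IsBVPEigenvalue.exists_eq_smul_mulVec (hx : StrictMono x) {z : ℂ}
    (h : IsBVPEigenvalue x m n z) :
    ∃ φ : Fin N → ℂ, φ ≠ 0 ∧ φ = (-z ^ 2) • (redMatrixC x m n).mulVec φ := by
  obtain ⟨φ₁, φ₂, φ₃, hs, hne⟩ := h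
  set φ : Fin N → ℂ := fun k => φ₃ (x k) with hφ
  set g : Fin N → ℂ := ((matG m n).map Complex.ofReal).mulVec φ with hg
  have h2 := hs.ae_eq_stepFun
  have e1 := hs.eq₁.sub (hasDistribDeriv_slopeFun_smul x (fun k => -(z ^ 2 * g k)))
  have e3 := hs.eq₃.sub (hasDistribDeriv_exp_neg_abs_smul x (fun k => -(z ^ 2 * g k)))
  have hjump : (fun k => z * (2 * pairing (massC m n k) (avg φ₂ (x k))) -
      (-2 : ℝ) • (-(z ^ 2 * g k))) = 0 := by
    ext k
    rw [avg_eq_of_ae_eq_stepFun hx hs.bv h2, two_mul_pairing_massC z φ, Complex.real_smul]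
    push_cast
    simp only [Pi.zero_apply, hg]
    ring
  rw [hjump] at e1
  simp only [Pi.zero_apply, sub_zero] at e3
  obtain ⟨c3, c1⟩ := ae_eq_zero_of_hasDistribDeriv e1 e3 (hs.cont.sub (by fun_prop))
    (by simpa using hs.left₃.sub (tendsto_exp_neg_abs_smul_atBot x fun k => -(z ^ 2 * g k)))
    (by simpa using hs.right₃.sub (tendsto_exp_neg_abs_smul_atTop x fun k => -(z ^ 2 * g k)))
  refine ⟨φ, fun hz => hne ?_, funext fun j => ?_⟩
  · have hg0 : g = 0 := by rw [hg, hz, Matrix.mulVec_zero]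
    have hk : ∀ k, φ₃ (x k) = 0 := fun k => congrFun hz k
    simp only [hg0, Pi.zero_apply, mul_zero, neg_zero, smul_zero, Finset.sum_const_zero,
      sub_zero] at c1 c3
    refine ⟨c1, ?_, by rw [show φ₃ = 0 from c3]⟩
    filter_upwards [h2] with y hy
    simp [hy, stepFun, hk]
  · rw [← sum_exp_neg_abs_smul_matG]
    exact sub_eq_zero.mp (congrFun c3 (x j))

theorem isBVPEigenvalue_iff (hx : StrictMono x) (z : ℂ) : IsBVPEigenvalue x m n z ↔
    ∃ φ : Fin N → ℂ, φ ≠ 0 ∧ φ = (-z ^ 2) • (redMatrixC x m n).mulVec φ :=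
  ⟨fun h => h.exists_eq_smul_mulVec hx, fun ⟨_, h0, h⟩ => isBVPEigenvalue_of_eq_smul_mulVec hx h0 h⟩

end BoundaryValueProblem

/-! ### The spectra -/

/-- Characteristic values of a matrix are the reciprocals of its nonzero eigenvalues. -/
theorem exists_eq_smul_mulVec_iff {ι : Type*} [Fintype ι] [DecidableEq ι] (A : Matrix ι ι ℂ)
    (μ : ℂ) : (∃ φ : ι → ℂ, φ ≠ 0 ∧ φ = μ • A.mulVec φ) ↔ μ ≠ 0 ∧ A.charpoly.IsRoot μ⁻¹ := by
  rw [isRoot_charpoly_iff]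
  constructor
  · rintro ⟨φ, h0, h⟩
    have hμ : μ ≠ 0 := by
      rintro rfl
      exact h0 (by rw [h, zero_smul])
    refine ⟨hμ, φ, h0, ?_⟩
    conv_rhs => rw [h, inv_smul_smul₀ hμ]
  · rintro ⟨hμ, φ, h0, h⟩
    exact ⟨φ, h0, by rw [h, smul_inv_smul₀ hμ]⟩

theorem pairing_mass {N : ℕ} (m n : Fin N → ℝ) (j : Fin N) :
    pairing (mass m n j) (mass m n j) = 2 * m j * n j := by
  simp [pairing, mass, dual]
  ring

theorem neg_sq_eq_iff {a : ℝ} (ha : 0 < a) (z : ℂ) :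
    -z ^ 2 = (a : ℂ) ↔
      z = Complex.I * (Real.sqrt a : ℂ) ∨ z = -(Complex.I * (Real.sqrt a : ℂ)) := by
  rw [← sq_eq_sq_iff_eq_or_eq_neg, mul_pow, Complex.I_sq, ← Complex.ofReal_pow,
    Real.sq_sqrt ha.le, neg_one_mul, eq_neg_iff_add_eq_zero, neg_eq_iff_add_eq_zero]

namespace IsScattering

variable {N : ℕ} {x m n : ℝ → Fin N → ℝ} {minf ninf : Fin N → ℝ} {c H : ℝ}

theorem setOf_eq_smul_mulVec_specMatrixC (h : IsScattering x m n minf ninf c H) {t : ℝ}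
    (ht : 0 ≤ t) :
    {μ : ℂ | ∃ Ψ : Fin N × Fin 2 → ℂ, Ψ ≠ 0 ∧
      Ψ = μ • (specMatrixC (x t) (m t) (n t)).mulVec Ψ} =
      range (fun j => ((1 / (2 * minf j * ninf j) : ℝ) : ℂ)) := by
  ext μ
  rw [mem_ofPred_eq, exists_eq_smul_mulVec_iff]
  constructor
  · rintro ⟨hμ, hr⟩
    obtain ⟨j, hj⟩ := (h.isRoot_specMatrixC_iff ht (inv_ne_zero hμ)).mp hr
    refine ⟨j, ?_⟩
    rw [← inv_inv μ, hj]
    push_cast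
    ring
  · rintro ⟨j, rfl⟩
    have hp := mul_pos (h.minf_pos j) (h.ninf_pos j)
    have hne : ((1 / (2 * minf j * ninf j) : ℝ) : ℂ) ≠ 0 := by
      rw [mul_assoc]
      exact_mod_cast (one_div_pos.mpr (mul_pos two_pos hp)).ne'
    refine ⟨hne, (h.isRoot_specMatrixC_iff ht (inv_ne_zero hne)).mpr ⟨j, ?_⟩⟩
    push_cast
    rw [one_div, inv_inv]
    ring

theorem rootMultiplicity_eq_one_of_hasEigenvalue (h : IsScattering x m n minf ninf c H) {t : ℝ}
    (ht : 0 ≤ t) {κ : ℂ} (hκ : κ ≠ 0)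
    (he : Module.End.HasEigenvalue (Matrix.toLin' (specMatrixC (x t) (m t) (n t))) κ) :
    (specMatrixC (x t) (m t) (n t)).charpoly.rootMultiplicity κ = 1 := by
  obtain ⟨v, hv⟩ := he.exists_hasEigenvector
  have hr := (isRoot_charpoly_iff (specMatrixC (x t) (m t) (n t)) κ).mpr
    ⟨v, hv.2, by simpa using hv.apply_eq_smul⟩
  obtain ⟨j, rfl⟩ := (h.isRoot_specMatrixC_iff ht hκ).mp hr
  exact h.rootMultiplicity_specMatrixC ht j

theorem setOf_isBVPEigenvalue (h : IsScattering x m n minf ninf c H) {t : ℝ} (ht : 0 ≤ t) :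
    {z : ℂ | IsBVPEigenvalue (x t) (m t) (n t) z} =
      {z : ℂ | ∃ j, z = Complex.I * (Real.sqrt (1 / (2 * minf j * ninf j)) : ℂ) ∨
        z = -(Complex.I * (Real.sqrt (1 / (2 * minf j * ninf j)) : ℂ))} := by
  ext z
  have hpos : ∀ j, 0 < 1 / (2 * minf j * ninf j) := fun j => by
    have := h.minf_pos j
    have := h.ninf_pos j
    positivity
  simp only [mem_ofPred_eq]
  rw [isBVPEigenvalue_iff (h.flow.strictMono t ht), exists_eq_smul_mulVec_iff,
    h.isRoot_redMatrixC_iff ht]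
  have key : ∀ j, (-z ^ 2)⁻¹ = ((2 * (minf j * ninf j) : ℝ) : ℂ) ↔
      -z ^ 2 = ((1 / (2 * minf j * ninf j) : ℝ) : ℂ) := fun j => by
    rw [inv_eq_iff_eq_inv, ← Complex.ofReal_inv, one_div, mul_assoc]
  constructor
  · rintro ⟨-, j, hj⟩
    exact ⟨j, (neg_sq_eq_iff (hpos j) z).mp ((key j).mp hj)⟩
  · rintro ⟨j, hj⟩
    have hz := (neg_sq_eq_iff (hpos j) z).mpr hj
    refine ⟨?_, j, (key j).mpr hz⟩
    rw [hz]
    exact_mod_cast (hpos j).ne'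

end IsScattering

end Peakon

end

/-! ### Existence, scattering and spectrum combined -/

theorem mainTheorem3 (N : ℕ) (x₀ m₀ n₀ : Fin N → ℝ) (hx₀ : StrictMono x₀)
    (hm₀ : ∀ j, 0 < m₀ j) (hn₀ : ∀ j, 0 < n₀ j) :
    (∃ x m n : ℝ → Fin N → ℝ,
      Peakon.IsPeakonFlow x m n ∧ x 0 = x₀ ∧ m 0 = m₀ ∧ n 0 = n₀) ∧
    ∀ x m n : ℝ → Fin N → ℝ,
      Peakon.IsPeakonFlow x m n → x 0 = x₀ → m 0 = m₀ → n 0 = n₀ →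
      ∃ minf ninf lam : Fin N → ℝ,
        -- the limiting momenta and the numbers `λⱼ`
        (∀ j, Tendsto (fun t => m t j) atTop (𝓝 (minf j)) ∧ 0 < minf j) ∧
        (∀ j, Tendsto (fun t => n t j) atTop (𝓝 (ninf j)) ∧ 0 < ninf j) ∧
        (∀ j, lam j = 1 / (2 * minf j * ninf j)) ∧
        (∀ j, lam j =
          1 / Peakon.pairing (Peakon.mass minf ninf j) (Peakon.mass minf ninf j)) ∧
        -- the matrix eigenvalue problem, at every time
        (∀ t, 0 ≤ t →
          {μ : ℂ | ∃ Ψ : Fin N × Fin 2 → ℂ, Ψ ≠ 0 ∧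
              Ψ = μ • (Peakon.specMatrixC (x t) (m t) (n t)).mulVec Ψ} =
            range (fun j => (lam j : ℂ))) ∧
        (∀ t, 0 ≤ t → ∀ κ : ℂ, κ ≠ 0 →
          Module.End.HasEigenvalue
            (Matrix.toLin' (Peakon.specMatrixC (x t) (m t) (n t))) κ →
          (Peakon.specMatrixC (x t) (m t) (n t)).charpoly.rootMultiplicity κ = 1) ∧
        -- positivity and ordering
        (∀ j, 0 < lam j) ∧ StrictAnti lam ∧
        -- asymptotic velocities and positions
        (∀ j, Tendsto (fun t => deriv (fun s => x s j) t) atTop (𝓝 (1 / (2 * lam j)))) ∧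
        (∀ j, (fun t => x t j - t / (2 * lam j)) =O[atTop] (fun _ => (1 : ℝ))) ∧
        -- the spectrum of the original boundary value problem, at every time
        (∀ t, 0 ≤ t →
          {z : ℂ | Peakon.IsBVPEigenvalue (x t) (m t) (n t) z} =
            {z : ℂ | ∃ j, z = Complex.I * (Real.sqrt (lam j) : ℂ) ∨
              z = -(Complex.I * (Real.sqrt (lam j) : ℂ))}) := by
  refine ⟨Peakon.exists_isPeakonFlow hx₀ hm₀ hn₀, ?_⟩
  intro x m n hflow hx hm hn
  have hs : Peakon.IsScaledFlow (fun _ => 1) x m n :=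
    hflow.isScaledFlow (hx ▸ hx₀) (hm ▸ hm₀) (hn ▸ hn₀)
  obtain ⟨minf, ninf, c, H, h⟩ := hs.exists_isScattering
  have hpos : ∀ j, 0 < minf j * ninf j := fun j => mul_pos (h.minf_pos j) (h.ninf_pos j)
  have hinv : ∀ j, 1 / (2 * (1 / (2 * minf j * ninf j))) = minf j * ninf j := fun j => by
    have := (h.minf_pos j).ne'
    have := (h.ninf_pos j).ne'
    field_simp
  refine ⟨minf, ninf, fun j => 1 / (2 * minf j * ninf j), fun j => ⟨h.tendsto_m j, h.minf_pos j⟩,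
    fun j => ⟨h.tendsto_n j, h.ninf_pos j⟩, fun j => rfl,
    fun j => by rw [Peakon.pairing_mass], fun t ht => h.setOf_eq_smul_mulVec_specMatrixC ht,
    fun t ht κ hκ he => h.rootMultiplicity_eq_one_of_hasEigenvalue ht hκ he,
    fun j => ?_, fun i j hij => ?_, fun j => ?_, fun j => ?_,
    fun t ht => h.setOf_isBVPEigenvalue ht⟩
  · have := hpos j
    simp only [mul_assoc]
    positivity
  · have := hpos i
    have hlt : minf i * ninf i < minf j * ninf j := h.strictMono_mul hij
    simp only [mul_assoc]
    exact one_div_lt_one_div_of_lt (by positivity) (by linarith)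
  · simp only [hinv]
    refine (h.tendsto_vel j).congr' ?_
    -- The flow has only a one-sided derivative at time zero, so the two-sided `deriv` is used for
    -- `t > 0`.
    filter_upwards [eventually_gt_atTop 0] with t ht
    exact ((h.flow.hasDeriv_x ht.le j).hasDerivAt (Ici_mem_nhds ht)).deriv.symm
  · obtain ⟨L, hL⟩ := h.exists_tendsto_pos_sub j
    refine (hL.isBigO_one ℝ).congr_left fun t => ?_
    rw [div_eq_mul_one_div, hinv, mul_comm]
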